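/- Let $K\ge 2$ and let $X_1,\dots,X_K$ be memoryless sources (arms) over finite alphabets $\mathcal X_1,\dots,\mathcal X_K$, with PMFs $p_1,\dots,p_K$ and entropies $H_i=-\sum_{x\in\mathcal X_i}p_i(x)\log p_i(x)$ (natural logarithm). Let $H_{i^*}=\max_i H_i$ and $\Delta_i=H_{i^*}-H_i$. For a PMF $q$ let $\zeta(q)=1-\sum_y q(y)^2$. In each round $t=1,2,\dots$ a player picks an arm $I(t)$, based on the past only, and observes the symbol $X_{I(t)}(t)$; $N_i(t)$ is the number of plays of arm $i$ in rounds $1,\dots,t$, $\boldsymbol X_i(t)$ is the sequence of the $N_i(t)$ symbols observed from arm $i$, and $$R(t)=t\,H_{i^*}-\sum_{i=1}^K\mathbb E[N_i(t)]\,H_i$$ is the expected pseudo-regret. For a sample $\boldsymbol Y$ of size $n$ over an alphabet $\mathcal Y$ with empirical PMF $\hat p=\hat p(\boldsymbol Y,n)$, let $\hat\zeta(\boldsymbol Y,n)=1-\sum_y\hat p(y)^2$, and let $$\mathrm{UCD}_{\mathrm{tv}}(\zeta,\mathcal Y,\delta,n)=3\sqrt{\tfrac{\zeta|\mathcal Y|}{n}}\log\Big(\tfrac{n|\mathcal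 Y|}{36\zeta}\Big)+\tfrac32\sqrt{\tfrac{\log(2/\delta)}{n}}\log\Big(\tfrac{n|\mathcal Y|^2}{9}\Big)+\frac{2|\mathcal Y|^{1/2}\log^{1/4}(2/\delta)\log(n|\mathcal Y|^{2/3})}{n^{3/4}},$$ where the first summand is $0$ for $\zeta=0$. Let $\alpha>2$. Suppose that the player first plays each arm $3$ times, and then, in every later round $t$, plays an arm $i$ that maximizes (ties broken arbitrarily) $$H\big(\hat p(\boldsymbol X_i(t-1),N_i(t-1))\big)+\mathrm{UCD}_{\mathrm{tv}}\big(\hat\zeta(\boldsymbol X_i(t-1),N_i(t-1)),\mathcal X_i,t^{-\alpha},N_i(t-1)\big).$$ Let $\Lambda_k(s)=s\log^k s$ (with $x^{4/3}=(\sqrt[3]{x})^4$), and for an arm with alphabet $\mathcal Y$ let $\Gamma_{\mathrm{tv}}(\alpha,\zeta,\Delta,t)$ be the maximum of the six numbers $$288\frac{\zeta}{|\mathcal Y|}\Lambda_1^2\Big(\frac{2|\mathcal Y|}{3\Delta}\Big),\quad 36230\frac{\alpha^{1/3}\log^{1/3}(t)}{|\mathcal Y|^{2/3}}\Lambda_1^{4/3}\Big(\frac{2|\mathcal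 Y|}{3\Delta}\Big),\quad \frac{135}{|\mathcal Y|^2}\Lambda_2\Big(\frac{9|\mathcal Y|^2\alpha\log t}{\Delta^2}\Big),$$ $$\frac{3}{|\mathcal Y|^{2/3}}\Lambda_{4/3}\Big(\frac{27|\mathcal Y|^{4/3}\alpha^{1/3}\log^{1/3}(t)}{\Delta^{4/3}}\Big),\quad 30\,\alpha\log(2^{1/\alpha}t),\quad 119\,\zeta|\mathcal Y|,$$ where $\Lambda_k(0)=0$. Then, for every $t\ge 1$, $$R(t)\le\sum_{i:\Delta_i>0}\Big[\Gamma_{\mathrm{tv}}(\alpha,\zeta(p_i),\Delta_i,t)\,\Delta_i+\frac{4(\alpha-1)}{\alpha-2}\,\Delta_i\Big],$$ where $\Gamma_{\mathrm{tv}}$ for arm $i$ is taken with $\mathcal Y=\mathcal X_i$. -/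

import Mathlib

open MeasureTheory ProbabilityTheory

noncomputable section

namespace EntropyBandit

/-- `x ^ (4/3)`, read as the fourth power of the real cube root of `x`. -/
def fourThirdsPow (x : ℝ) : ℝ := |x| ^ (4 / 3 : ℝ)

/-- `Λ₁(s) = s log s`. -/
def Lam1 (s : ℝ) : ℝ := s * Real.log s

/-- `Λ₂(s) = s log² s`. -/
def Lam2 (s : ℝ) : ℝ := s * Real.log s ^ 2

/-- `Λ_{4/3}(s) = s log^{4/3} s`. -/
def Lam43 (s : ℝ) : ℝ := s * fourThirdsPow (Real.log s)

section Functionals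

variable {Y : Type*} [Fintype Y]

/-- The entropy `-∑ q(y) log q(y)` in nats, with `0 log 0 = 0`. -/
def entropy (q : Y → ℝ) : ℝ := -∑ y, q y * Real.log (q y)

/-- `ζ(q) = 1 - ∑ q(y)²`. -/
def zeta (q : Y → ℝ) : ℝ := 1 - ∑ y, q y ^ 2

/-- The probability vector of a `PMF`. -/
def probVec (p : PMF Y) (y : Y) : ℝ := (p y).toReal

variable [DecidableEq Y]

/-- The empirical distribution of a finite sample. -/
def empirical (S : List Y) (y : Y) : ℝ := (S.count y : ℝ) / (S.length : ℝ)

/-- The plug-in entropy estimator. -/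
def plugInEntropy (S : List Y) : ℝ := entropy (empirical S)

/-- The plug-in estimator of `ζ`. -/
def plugInZeta (S : List Y) : ℝ := zeta (empirical S)

end Functionals

/-- The confidence deviation `UCD_tv(ζ, 𝒴, δ, n)`, where `c = |𝒴|`. At `ζ = 0` the first summand
is `0`, which is also its limit as `ζ ↓ 0`. -/
def ucdTV (z : ℝ) (c : ℕ) (δ : ℝ) (n : ℕ) : ℝ :=
  3 * √(z * c / n) * Real.log (n * c / (36 * z))
    + 3 / 2 * √(Real.log (2 / δ) / n) * Real.log (n * (c : ℝ) ^ 2 / 9)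
    + 2 * (c : ℝ) ^ (1 / 2 : ℝ) * Real.log (2 / δ) ^ (1 / 4 : ℝ)
        * Real.log (n * (c : ℝ) ^ (2 / 3 : ℝ)) / (n : ℝ) ^ (3 / 4 : ℝ)

/-- `Γ_tv(α, ζ, Δ, t)` for an arm whose alphabet has `c` symbols. -/
def gammaTV (c : ℕ) (α z Δ : ℝ) (t : ℕ) : ℝ :=
  max (288 * (z / c) * Lam1 (2 * c / (3 * Δ)) ^ 2)
  (max (36230 * (α ^ (1 / 3 : ℝ) * Real.log t ^ (1 / 3 : ℝ) / (c : ℝ) ^ (2 / 3 : ℝ))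
          * fourThirdsPow (Lam1 (2 * c / (3 * Δ))))
  (max (135 / (c : ℝ) ^ 2 * Lam2 (9 * (c : ℝ) ^ 2 * α * Real.log t / Δ ^ 2))
  (max (3 / (c : ℝ) ^ (2 / 3 : ℝ)
          * Lam43 (27 * (c : ℝ) ^ (4 / 3 : ℝ) * α ^ (1 / 3 : ℝ) * Real.log t ^ (1 / 3 : ℝ)
              / Δ ^ (4 / 3 : ℝ)))
  (max (30 * α * Real.log ((2 : ℝ) ^ (1 / α) * t))
       (119 * z * c)))))

section Algorithm

variable {K : ℕ} {A : Fin K → Type*} {Ω : Type*}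

/-- `N_i(t)`: how often arm `i` is played in rounds `1, …, t`. -/
def playCount (I : ℕ → Ω → Fin K) (i : Fin K) (t : ℕ) (ω : Ω) : ℕ :=
  ∑ τ ∈ Finset.Icc 1 t, if I τ ω = i then 1 else 0

/-- The sample set of arm `i` after round `t`: the symbol `X_i(t)` is appended exactly when arm `i`
is played in round `t`. -/
def samples (I : ℕ → Ω → Fin K) (X : ∀ i, ℕ → Ω → A i) (i : Fin K) : ℕ → Ω → List (A i)
  | 0, _ => []
  | t + 1, ω =>
    if I (t + 1) ω = i then samples I X i t ω ++ [X i (t + 1) ω] else samples I X i t ω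

theorem length_samples (I : ℕ → Ω → Fin K) (X : ∀ i, ℕ → Ω → A i) (i : Fin K) (t : ℕ) (ω : Ω) :
    (samples I X i t ω).length = playCount I i t ω := by
  induction t with
  | zero => simp [samples, playCount]
  | succ t ih =>
    have h : playCount I i (t + 1) ω
        = playCount I i t ω + if I (t + 1) ω = i then 1 else 0 := by
      simp only [playCount]
      rw [Finset.sum_Icc_succ_top (by omega)]
    rw [h, samples]
    split_ifs <;> simp [ih]

/-- On the outcome `ω`, the arms `I(1), I(2), …` are chosen by the general UCB algorithm with
estimators `Hhat`, confidence deviations `UCD` (sample, confidence parameter, sample size) and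
confidence function `δ`, where every arm is played `m` times at the beginning. Ties, and the order
of the initial plays, are arbitrary. -/
def IsUCBRun (Hhat : ∀ i, List (A i) → ℝ) (UCD : ∀ i, List (A i) → ℝ → ℕ → ℝ) (δ : ℕ → ℝ) (m : ℕ)
    (I : ℕ → Ω → Fin K) (X : ∀ i, ℕ → Ω → A i) (ω : Ω) : Prop :=
  ∀ t : ℕ,
    ((∃ i, playCount I i t ω < m) → playCount I (I (t + 1) ω) t ω < m) ∧
    ((∀ i, m ≤ playCount I i t ω) → ∀ j,
      Hhat j (samples I X j t ω) + UCD j (samples I X j t ω) (δ (t + 1)) (playCount I j t ω)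
        ≤ Hhat (I (t + 1) ω) (samples I X (I (t + 1) ω) t ω)
          + UCD (I (t + 1) ω) (samples I X (I (t + 1) ω) t ω) (δ (t + 1))
              (playCount I (I (t + 1) ω) t ω))

/-- Memoryless sources on a filtered probability space: the symbol `X_i(t)` (for rounds `t ≥ 1`)
has law `p_i`, is known after round `t`, and is independent of everything before round `t`. -/
structure MemorylessSources {mΩ : MeasurableSpace Ω} [∀ i, MeasurableSpace (A i)] (μ : Measure Ω)
    (ℱ : Filtration ℕ mΩ) (p : ∀ i, PMF (A i)) (X : ∀ i, ℕ → Ω → A i) : Prop where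
  adapted : ∀ i t, Measurable[ℱ (t + 1)] (X i (t + 1))
  law : ∀ i t, μ.map (X i (t + 1)) = (p i).toMeasure
  indep : ∀ i t, Indep (MeasurableSpace.comap (X i (t + 1)) inferInstance) (ℱ t) μ

variable [∀ i, Fintype (A i)]

/-- `H_i`, the entropy of source `i`. -/
def armEntropy (p : ∀ i, PMF (A i)) (i : Fin K) : ℝ := entropy (probVec (p i))

/-- `H_{i*}`, the largest entropy of an arm. -/
def bestEntropy (p : ∀ i, PMF (A i)) : ℝ := ⨆ i, armEntropy p i

/-- The gap `Δ_i = H_{i*} - H_i`. -/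
def gap (p : ∀ i, PMF (A i)) (i : Fin K) : ℝ := bestEntropy p - armEntropy p i

/-- The expected pseudo-regret `R(t) = t H_{i*} - ∑ 𝔼[N_i(t)] H_i`. -/
def pseudoRegret [MeasurableSpace Ω] (μ : Measure Ω) (p : ∀ i, PMF (A i)) (I : ℕ → Ω → Fin K)
    (t : ℕ) : ℝ :=
  t * bestEntropy p - ∑ i, (∫ ω, (playCount I i t ω : ℝ) ∂μ) * armEntropy p i

end Algorithm

end EntropyBandit

end

/-! The regret is the gap-weighted sum of expected play counts, so it suffices to show that a
suboptimal arm `i` is played about `Γ` times on average. Put `L = log (2 / δ)` with `δ = (s + 1) ^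
(-α)`. If arm `i` is played in round `s + 1` after at least `Γ` plays, its index is at least that of
a best arm `j`; outside four rare events this is impossible, because index `j` is at least `H_j`
while index `i` is below `H_i + Δ_i = H_j`.

Best arm. A Fannes-type inequality bounds `H(p) - H(p̂)` by `T log (c / T) + T`, where `T` is the
total variation distance (`entropy_le_add_tvDist`). Two of the events are that `T` exceeds `√(c ζ /
n) / 2 + √(L / (2 n))`, or that `ζ̂` is too small for `ζ` to be replaced by it. Otherwise `T` splits
into three pieces, dominated by the three summands of UCD (`fannes_le_ucdLog`). This needs `n c ≥
100`; for smaller samples UCD is at least `log c`, which bounds every entropy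
(`log_card_le_ucdLog`).

Suboptimal arm. The plug-in entropy is biased downwards and has bounded differences, so only its
upward fluctuation matters. The other two events are that this fluctuation or that of `ζ̂` is too
large. Otherwise `n ≥ Γ` forces fluctuation plus UCD below the gap (`deviation_lt_gap`).

Probabilities. Adaptive sampling does no harm: the sample of an arm starts with a given word with
probability at most the product of its symbol probabilities (`measure_prefix_le`). Hence at each
fixed length McDiarmid's inequality for i.i.d. samples applies. A union over the at most `s` lengths
gives `s δ / 2` per event, and `∑ s (s + 1) ^ (-α)` converges since `α > 2` (`sum_mul_rpow_le`). -/

noncomputable section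

namespace EntropyBandit

set_option linter.unusedSectionVars false

/-! ### Entropy and total variation of finite distributions -/

section FiniteDistributions

variable {Y : Type*} [Fintype Y]

theorem probVec_nonneg (p : PMF Y) (y : Y) : 0 ≤ probVec p y := ENNReal.toReal_nonneg

theorem sum_probVec (p : PMF Y) : ∑ y, probVec p y = 1 := by
  have h := p.tsum_coe
  rw [tsum_fintype] at h
  unfold probVec
  rw [← ENNReal.toReal_sum (fun a _ => p.apply_ne_top a), h, ENNReal.toReal_one]

theorem probVec_le_one (p : PMF Y) (y : Y) : probVec p y ≤ 1 := by
  rw [← sum_probVec p]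
  exact Finset.single_le_sum (fun a _ => probVec_nonneg p a) (Finset.mem_univ y)

/-- This is `log x ≤ x - 1` at `x = r / a`. The correction `r - a` cancels on summation over two
probability vectors, and also in expectation when `a` is an unbiased estimate of `r`. -/
theorem gibbs_pointwise {a r : ℝ} (ha : 0 ≤ a) (hr : 0 < r) :
    -(a * Real.log a) ≤ -(a * Real.log r) + (r - a) := by
  rcases ha.eq_or_lt with rfl | ha
  · simp [hr.le]
  · have h := Real.log_le_sub_one_of_pos (div_pos hr ha)
    rw [Real.log_div hr.ne' ha.ne'] at h
    have h2 := mul_le_mul_of_nonneg_left h ha.le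
    have h3 : a * (r / a - 1) = r - a := by field_simp
    linarith

theorem entropy_le_cross {q r : Y → ℝ} (hq : ∀ y, 0 ≤ q y) (hq1 : ∑ y, q y = 1)
    (hr : ∀ y, 0 < r y) (hr1 : ∑ y, r y = 1) :
    entropy q ≤ ∑ y, -(q y * Real.log (r y)) := by
  have h := Finset.sum_le_sum (fun y (_ : y ∈ Finset.univ) => gibbs_pointwise (hq y) (hr y))
  rw [Finset.sum_add_distrib, Finset.sum_sub_distrib, hq1, hr1] at h
  unfold entropy
  rw [← Finset.sum_neg_distrib]
  linarith

theorem entropy_nonneg {q : Y → ℝ} (hq : ∀ y, 0 ≤ q y) (hq1 : ∀ y, q y ≤ 1) :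
    0 ≤ entropy q := by
  unfold entropy
  rw [← Finset.sum_neg_distrib]
  exact Finset.sum_nonneg fun y _ => by
    have := mul_nonneg (hq y) (neg_nonneg.2 (Real.log_nonpos (hq y) (hq1 y)))
    linarith

theorem entropy_le_log_card [Nonempty Y] {q : Y → ℝ} (hq : ∀ y, 0 ≤ q y) (hq1 : ∑ y, q y = 1) :
    entropy q ≤ Real.log (Fintype.card Y) := by
  have hc : (0 : ℝ) < Fintype.card Y := by exact_mod_cast Fintype.card_pos
  have h := entropy_le_cross (r := fun _ => (Fintype.card Y : ℝ)⁻¹) hq hq1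
    (fun _ => inv_pos.2 hc) (by simp [hc.ne'])
  refine h.trans (le_of_eq ?_)
  simp only [Real.log_inv, mul_neg, neg_neg]
  rw [← Finset.sum_mul, hq1, one_mul]

/-- The total variation distance of two probability vectors. -/
def tvDist (p q : Y → ℝ) : ℝ := ∑ y, |p y - q y| / 2

theorem tvDist_nonneg (p q : Y → ℝ) : 0 ≤ tvDist p q :=
  Finset.sum_nonneg fun _ _ => by positivity

theorem tvDist_le_one {p q : Y → ℝ} (hp : ∀ y, 0 ≤ p y) (hp1 : ∑ y, p y = 1)
    (hq : ∀ y, 0 ≤ q y) (hq1 : ∑ y, q y = 1) : tvDist p q ≤ 1 := by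
  have : tvDist p q ≤ ∑ y, (p y + q y) / 2 := by
    refine Finset.sum_le_sum fun y _ => ?_
    have : |p y - q y| ≤ p y + q y := abs_le.2 ⟨by linarith [hp y, hq y], by linarith [hp y, hq y]⟩
    linarith
  rw [← Finset.sum_div, Finset.sum_add_distrib, hp1, hq1] at this
  linarith

theorem sum_sub_min_eq_tvDist {p q : Y → ℝ} (hp1 : ∑ y, p y = 1) (hq1 : ∑ y, q y = 1) :
    ∑ y, (p y - min (p y) (q y)) = tvDist p q := by
  have h : ∀ y, p y - min (p y) (q y) = |p y - q y| / 2 + (p y - q y) / 2 := by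
    intro y
    rcases le_total (p y) (q y) with h | h
    · rw [min_eq_left h, abs_of_nonpos (by linarith)]; ring
    · rw [min_eq_right h, abs_of_nonneg (by linarith)]; ring
  simp_rw [h]
  rw [Finset.sum_add_distrib, ← Finset.sum_div Finset.univ (fun y => p y - q y),
    Finset.sum_sub_distrib, hp1, hq1]
  simp [tvDist]

/-- A Fannes-type continuity bound for the entropy. -/
theorem entropy_le_add_tvDist [Nonempty Y] {p q : Y → ℝ} (hp : ∀ y, 0 ≤ p y)
    (hp1 : ∑ y, p y = 1) (hq : ∀ y, 0 ≤ q y) (hq1 : ∑ y, q y = 1) :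
    entropy p ≤ entropy q
      + tvDist p q * Real.log (Fintype.card Y / tvDist p q) + tvDist p q := by
  have hc : (0 : ℝ) < Fintype.card Y := by exact_mod_cast Fintype.card_pos
  have hqle : ∀ y, q y ≤ 1 := fun y => by
    rw [← hq1]; exact Finset.single_le_sum (fun a _ => hq a) (Finset.mem_univ y)
  have hsum := sum_sub_min_eq_tvDist hp1 hq1
  rcases (tvDist_nonneg p q).eq_or_lt with h0 | hT
  · have : p = q := by
      funext y
      have := (Finset.sum_eq_zero_iff_of_nonneg
        (fun y _ => by positivity : ∀ y ∈ Finset.univ, 0 ≤ |p y - q y| / 2)).1 h0.symm y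
        (Finset.mem_univ y)
      have : |p y - q y| = 0 := by linarith
      linarith [abs_eq_zero.1 this]
    rw [← h0, this]; simp
  set T := tvDist p q with hTdef
  set c : ℝ := (Fintype.card Y : ℝ) with hcdef
  -- Gibbs' inequality is used against `q` mixed with uniform mass `T`. The floor `T / c` bounds the
  -- logarithm by `log (c / T)` on the excess `p - min p q`, whose total mass is `T`; the
  -- normalization costs `log (1 + T) ≤ T`.
  have hr : ∀ y, 0 < (q y + T / c) / (1 + T) := fun y => by
    have := hq y; positivity
  have hr1 : ∑ y, (q y + T / c) / (1 + T) = 1 := by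
    rw [← Finset.sum_div, Finset.sum_add_distrib, hq1]
    simp only [Finset.sum_const, Finset.card_univ, nsmul_eq_mul]
    rw [← hcdef]
    field_simp
  have h := entropy_le_cross hp hp1 hr hr1
  have hlog1 : Real.log (1 + T) ≤ T := by
    have := Real.log_le_sub_one_of_pos (by linarith : 0 < 1 + T); linarith
  have hpt : ∀ y, -(p y * Real.log ((q y + T / c) / (1 + T))) ≤
      p y * T + -(q y * Real.log (q y)) + (p y - min (p y) (q y)) * Real.log (c / T) := by
    intro y
    have hqT : 0 < q y + T / c := by have := hq y; positivity
    rw [Real.log_div hqT.ne' (by linarith)]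
    have e1 : p y * Real.log (1 + T) ≤ p y * T := mul_le_mul_of_nonneg_left hlog1 (hp y)
    have e2 : -(min (p y) (q y) * Real.log (q y + T / c)) ≤ -(q y * Real.log (q y)) := by
      rcases (hq y).eq_or_lt with hz | hz
      · rw [← hz, min_eq_right (hp y)]; simp
      · have l1 : Real.log (q y) ≤ Real.log (q y + T / c) :=
          Real.log_le_log hz (by have : 0 < T / c := by positivity
                                 linarith)
        have l2 := Real.log_nonpos (hq y) (hqle y)
        have m0 : 0 ≤ min (p y) (q y) := le_min (hp y) (hq y)
        have m1 : min (p y) (q y) ≤ q y := min_le_right _ _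
        nlinarith [mul_le_mul_of_nonneg_left l1 m0,
          mul_le_mul_of_nonneg_right m1 (neg_nonneg.2 l2)]
    have e3 : -((p y - min (p y) (q y)) * Real.log (q y + T / c)) ≤
        (p y - min (p y) (q y)) * Real.log (c / T) := by
      have m0 : 0 ≤ p y - min (p y) (q y) := sub_nonneg.2 (min_le_left _ _)
      have l1 : Real.log (T / c) ≤ Real.log (q y + T / c) :=
        Real.log_le_log (by positivity) (by linarith [hq y])
      have l2 : Real.log (c / T) = -Real.log (T / c) := by
        rw [← Real.log_inv, inv_div]
      rw [l2]
      nlinarith [mul_le_mul_of_nonneg_left l1 m0]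
    nlinarith
  have h2 := h.trans (Finset.sum_le_sum fun y _ => hpt y)
  rw [Finset.sum_add_distrib, Finset.sum_add_distrib, ← Finset.sum_mul, ← Finset.sum_mul, hp1,
    hsum, Finset.sum_neg_distrib] at h2
  unfold entropy at h2 ⊢
  linarith

end FiniteDistributions

/-! ### Expectations over i.i.d. samples and McDiarmid's inequality -/

section IidExpectation

variable {Y : Type*} [Fintype Y]

/-- The expectation of `f` over a sample of `n` independent symbols of law `p`. -/
def iidE (p : PMF Y) : ℕ → (List Y → ℝ) → ℝ
  | 0, f => f []
  | n + 1, f => ∑ a, probVec p a * iidE p n fun l => f (a :: l)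

variable (p : PMF Y)

theorem iidE_mono {n : ℕ} {f g : List Y → ℝ} (h : ∀ l, l.length = n → f l ≤ g l) :
    iidE p n f ≤ iidE p n g := by
  induction n generalizing f g with
  | zero => exact h [] rfl
  | succ n ih =>
    refine Finset.sum_le_sum fun a _ => mul_le_mul_of_nonneg_left (ih fun l hl => ?_)
      (probVec_nonneg p a)
    exact h _ (by simp [hl])

theorem iidE_congr {n : ℕ} {f g : List Y → ℝ} (h : ∀ l, l.length = n → f l = g l) :
    iidE p n f = iidE p n g :=
  le_antisymm (iidE_mono p fun l hl => (h l hl).le) (iidE_mono p fun l hl => (h l hl).ge)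

theorem iidE_add (n : ℕ) (f g : List Y → ℝ) :
    iidE p n (fun l => f l + g l) = iidE p n f + iidE p n g := by
  induction n generalizing f g with
  | zero => rfl
  | succ n ih => simp only [iidE, ih, mul_add, Finset.sum_add_distrib]

theorem iidE_const_mul (n : ℕ) (c : ℝ) (f : List Y → ℝ) :
    iidE p n (fun l => c * f l) = c * iidE p n f := by
  induction n generalizing f with
  | zero => rfl
  | succ n ih =>
    simp only [iidE, ih, Finset.mul_sum]
    exact Finset.sum_congr rfl fun a _ => by ring

theorem iidE_const (n : ℕ) (c : ℝ) : iidE p n (fun _ => c) = c := by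
  induction n with
  | zero => rfl
  | succ n ih => simp only [iidE, ih]; rw [← Finset.sum_mul, sum_probVec, one_mul]

theorem iidE_neg (n : ℕ) (f : List Y → ℝ) : iidE p n (fun l => -f l) = -iidE p n f := by
  have := iidE_const_mul p n (-1) f
  simpa using this

theorem iidE_sub (n : ℕ) (f g : List Y → ℝ) :
    iidE p n (fun l => f l - g l) = iidE p n f - iidE p n g := by
  simp only [sub_eq_add_neg, iidE_add, iidE_neg]

theorem iidE_sum {ι : Type*} (s : Finset ι) (n : ℕ) (f : ι → List Y → ℝ) :
    iidE p n (fun l => ∑ i ∈ s, f i l) = ∑ i ∈ s, iidE p n (f i) := by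
  classical
  induction s using Finset.induction_on with
  | empty => simpa using iidE_const p n 0
  | insert i s hi ih => simp only [Finset.sum_insert hi, iidE_add, ih]

theorem iidE_eq_sum_ofFn (n : ℕ) (f : List Y → ℝ) :
    iidE p n f = ∑ g : Fin n → Y, (∏ j, probVec p (g j)) * f (List.ofFn g) := by
  induction n generalizing f with
  | zero => simp [iidE]
  | succ n ih =>
    simp only [iidE, ih]
    rw [← (Fin.consEquiv fun _ => Y).sum_comp, Fintype.sum_prod_type]
    refine Finset.sum_congr rfl fun a _ => ?_
    rw [Finset.mul_sum]
    refine Finset.sum_congr rfl fun g _ => ?_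
    simp [Fin.prod_univ_succ, Fin.consEquiv, List.ofFn_succ, mul_assoc]

/-- Hoeffding's lemma on a finite alphabet. -/
theorem sum_exp_le_hoeffding (g : Y → ℝ) {d : ℝ} (hg : ∀ a b, g a - g b ≤ d) (s : ℝ) :
    ∑ a, probVec p a * Real.exp (s * g a)
      ≤ Real.exp (s * ∑ a, probVec p a * g a + s ^ 2 * d ^ 2 / 8) := by
  let _ : MeasurableSpace Y := ⊤
  have : Nonempty Y := by
    by_contra h
    rw [not_nonempty_iff] at h
    have := sum_probVec p
    simp at this
  obtain ⟨a₀, ha₀⟩ := Finite.exists_min g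
  have hb : ∀ᵐ y ∂p.toMeasure, g y ∈ Set.Icc (g a₀) (g a₀ + d) :=
    Filter.Eventually.of_forall fun y => ⟨ha₀ y, by linarith [hg y a₀]⟩
  have hd : 0 ≤ d := by simpa using hg a₀ a₀
  have h := (hasSubgaussianMGF_of_mem_Icc (μ := p.toMeasure)
    (Measurable.of_discrete (f := g)).aemeasurable hb).mgf_le s
  rw [mgf, PMF.integral_eq_sum, PMF.integral_eq_sum] at h
  simp only [smul_eq_mul] at h
  set m := ∑ a, probVec p a * g a with hm
  have hm' : ∑ a, (p a).toReal * g a = m := rfl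
  rw [hm'] at h
  have e : ∀ a, probVec p a * Real.exp (s * g a)
      = Real.exp (s * m) * ((p a).toReal * Real.exp (s * (g a - m))) := by
    intro a
    have : s * g a = s * m + s * (g a - m) := by ring
    rw [this, Real.exp_add]; unfold probVec; ring
  simp_rw [e]
  rw [← Finset.mul_sum, Real.exp_add]
  refine mul_le_mul_of_nonneg_left (h.trans (le_of_eq ?_)) (Real.exp_pos _).le
  congr 1
  simp [abs_of_nonneg hd]
  ring

/-- `f` changes by at most `d` when one symbol of a sample of size `n` is replaced. -/
def BoundedDiff (n : ℕ) (d : ℝ) (f : List Y → ℝ) : Prop :=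
  ∀ l₁ l₂ : List Y, ∀ a b : Y, l₁.length + l₂.length + 1 = n →
    f (l₁ ++ a :: l₂) - f (l₁ ++ b :: l₂) ≤ d

variable {p}

theorem BoundedDiff.neg {n : ℕ} {d : ℝ} {f : List Y → ℝ} (h : BoundedDiff n d f) :
    BoundedDiff n d fun l => -f l := fun l₁ l₂ a b hl => by
  have := h l₁ l₂ b a hl
  linarith

variable (p)

/-- Induction by conditioning on the first symbol: the conditional mean varies by at most `d` with
that symbol, so Hoeffding's lemma charges `s ^ 2 * d ^ 2 / 8` per symbol. -/
theorem iidE_exp_le {n : ℕ} {d : ℝ} {f : List Y → ℝ} (h : BoundedDiff n d f) (s : ℝ) :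
    iidE p n (fun l => Real.exp (s * f l))
      ≤ Real.exp (s * iidE p n f + n * (s ^ 2 * d ^ 2 / 8)) := by
  induction n generalizing f with
  | zero => simp [iidE]
  | succ n ih =>
    have hstep : ∀ a, BoundedDiff n d fun l => f (a :: l) := fun a l₁ l₂ x y hl =>
      h (a :: l₁) l₂ x y (by simp; omega)
    have hosc : ∀ a b, iidE p n (fun l => f (a :: l)) - iidE p n (fun l => f (b :: l)) ≤ d := by
      intro a b
      rw [← iidE_sub]
      refine (iidE_mono p (g := fun _ => d) fun l hl => ?_).trans_eq (iidE_const p n d)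
      exact h [] l a b (by simp [hl])
    have hH := sum_exp_le_hoeffding p _ hosc s
    calc iidE p (n + 1) (fun l => Real.exp (s * f l))
        ≤ ∑ a, probVec p a *
            Real.exp (s * iidE p n (fun l => f (a :: l)) + n * (s ^ 2 * d ^ 2 / 8)) :=
          Finset.sum_le_sum fun a _ =>
            mul_le_mul_of_nonneg_left (ih (hstep a)) (probVec_nonneg p a)
      _ = Real.exp (n * (s ^ 2 * d ^ 2 / 8)) *
            ∑ a, probVec p a * Real.exp (s * iidE p n (fun l => f (a :: l))) := by
          rw [Finset.mul_sum]
          exact Finset.sum_congr rfl fun a _ => by rw [Real.exp_add]; ring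
      _ ≤ Real.exp (n * (s ^ 2 * d ^ 2 / 8)) * Real.exp (s * iidE p (n + 1) f
            + s ^ 2 * d ^ 2 / 8) := mul_le_mul_of_nonneg_left hH (Real.exp_pos _).le
      _ = _ := by
          rw [← Real.exp_add]
          congr 1
          push_cast
          ring

open Classical in
/-- McDiarmid's inequality at confidence level `exp (-L)`. -/
theorem mcdiarmid {n : ℕ} (hn : 0 < n) {d : ℝ} (hd : 0 < d) {f : List Y → ℝ}
    (h : BoundedDiff n d f) {L : ℝ} (hL : 0 ≤ L) :
    iidE p n (fun l => if iidE p n f + d * √(n * L / 2) < f l then 1 else 0)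
      ≤ Real.exp (-L) := by
  have hn' : (0 : ℝ) < n := by exact_mod_cast hn
  set ε := d * √(n * L / 2) with hε
  set m := iidE p n f with hm
  -- The minimizer of the Chernoff exponent `-s ε + n s² d² / 8`; there the two terms equal `-2 L`
  -- and `L`.
  set s := 4 * ε / (n * d ^ 2) with hs
  have hε0 : 0 ≤ ε := by positivity
  have hs0 : 0 ≤ s := by positivity
  have hε2 : ε ^ 2 = d ^ 2 * (n * L / 2) := by
    rw [hε, mul_pow, Real.sq_sqrt (by positivity)]
  have h1 : iidE p n (fun l => if m + ε < f l then 1 else 0)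
      ≤ iidE p n (fun l => Real.exp (-(s * (m + ε))) * Real.exp (s * f l)) := by
    refine iidE_mono p fun l _ => ?_
    rw [← Real.exp_add]
    split_ifs with hlt
    · refine Real.one_le_exp ?_
      nlinarith
    · exact (Real.exp_pos _).le
  rw [iidE_const_mul] at h1
  refine h1.trans ((mul_le_mul_of_nonneg_left (iidE_exp_le p h s) (Real.exp_pos _).le).trans ?_)
  rw [← Real.exp_add, Real.exp_le_exp, ← hm]
  have e : s * ε = 2 * L := by
    rw [hs]; field_simp; rw [hε2]; ring
  have e2 : n * (s ^ 2 * d ^ 2 / 8) = L := by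
    have : n * (s ^ 2 * d ^ 2 / 8) = (s * ε) / 2 := by
      rw [hs]; field_simp; ring
    rw [this, e]; ring
  rw [e2]
  nlinarith

end IidExpectation

/-! ### Moments and bounded differences of the plug-in statistics -/

section Counts

variable {Y : Type*} [Fintype Y] [DecidableEq Y]

/-- A sum of functions of the counts has bounded differences. -/
theorem boundedDiff_sum_count {n : ℕ} {m M : ℝ} (φ : Y → ℕ → ℝ)
    (hm : ∀ y k, k < n → m ≤ φ y (k + 1) - φ y k) (hM : ∀ y k, k < n → φ y (k + 1) - φ y k ≤ M)
    (hmM : m ≤ M) : BoundedDiff n (M - m) fun l : List Y => ∑ y, φ y (l.count y) := by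
  intro l₁ l₂ a b hl
  rcases eq_or_ne a b with rfl | hab
  · simpa using hmM
  have hc : ∀ x y : Y, (l₁ ++ x :: l₂).count y
      = (l₁.count y + l₂.count y) + if x = y then 1 else 0 := by
    intro x y
    rw [List.count_append, List.count_cons]
    simp only [beq_iff_eq]
    omega
  have hk : ∀ y, l₁.count y + l₂.count y < n := by
    intro y
    have h1 := List.count_le_length (a := y) (l := l₁)
    have h2 := List.count_le_length (a := y) (l := l₂)
    omega
  -- Both samples are one common remainder plus one symbol, so the exchange is the increment at `a`
  -- minus the increment at `b`. Only the spread `M - m` of the increments enters.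
  have hsplit : ∀ x : Y, ∑ y, φ y ((l₁ ++ x :: l₂).count y)
      = ∑ y, φ y (l₁.count y + l₂.count y)
        + (φ x (l₁.count x + l₂.count x + 1) - φ x (l₁.count x + l₂.count x)) := by
    intro x
    rw [← sub_eq_iff_eq_add', ← Finset.sum_sub_distrib, Finset.sum_eq_single x]
    · rw [hc]; simp
    · intro y _ hy
      rw [hc, if_neg hy.symm]; simp
    · simp
  simp only [hsplit]
  have h1 := hM a _ (hk a)
  have h2 := hm b _ (hk b)
  linarith

variable (p : PMF Y)

theorem iidE_count (n : ℕ) (y : Y) :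
    iidE p n (fun l => (l.count y : ℝ)) = n * probVec p y := by
  induction n with
  | zero => simp [iidE]
  | succ n ih =>
    have : ∀ a, iidE p n (fun l => (((a :: l).count y : ℕ) : ℝ))
        = n * probVec p y + if a = y then 1 else 0 := by
      intro a
      simp only [List.count_cons, beq_iff_eq]
      push_cast
      rw [iidE_add, ih, iidE_const]
    simp only [iidE, this, mul_add, Finset.sum_add_distrib, mul_ite, mul_one, mul_zero,
      Finset.sum_ite_eq', Finset.mem_univ, if_true]
    rw [← Finset.sum_mul, sum_probVec]
    push_cast; ring

theorem iidE_count_sq (n : ℕ) (y : Y) :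
    iidE p n (fun l => (l.count y : ℝ) ^ 2)
      = n * (probVec p y * (1 - probVec p y)) + (n * probVec p y) ^ 2 := by
  induction n with
  | zero => simp [iidE]
  | succ n ih =>
    have : ∀ a, iidE p n (fun l => (((a :: l).count y : ℕ) : ℝ) ^ 2)
        = (n * (probVec p y * (1 - probVec p y)) + (n * probVec p y) ^ 2)
          + if a = y then 2 * (n * probVec p y) + 1 else 0 := by
      intro a
      rw [← ih]
      split_ifs with h
      · subst h
        simp only [List.count_cons_self]
        push_cast
        rw [← iidE_count, ← iidE_const_mul, ← iidE_const p n 1, ← iidE_add, ← iidE_add]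
        simp only [iidE_const]
        exact iidE_congr p fun l _ => by ring
      · simp [h]
    simp only [iidE, this, mul_add, Finset.sum_add_distrib, mul_ite, mul_one, mul_zero,
      Finset.sum_ite_eq', Finset.mem_univ, if_true]
    simp only [← Finset.sum_mul, sum_probVec]
    push_cast; ring

variable {p}

theorem empirical_nonneg (l : List Y) (y : Y) : 0 ≤ empirical l y := by
  unfold empirical; positivity

theorem sum_empirical {l : List Y} (hl : l ≠ []) : ∑ y, empirical l y = 1 := by
  have h : ∑ y, l.count y = l.length := by
    have := Multiset.sum_count_eq_card (s := Finset.univ) (m := (l : Multiset Y)) (by simp)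
    simpa using this
  have h0 : (l.length : ℝ) ≠ 0 := by simpa using hl
  unfold empirical
  rw [← Finset.sum_div, div_eq_one_iff_eq h0]
  exact_mod_cast h

theorem zeta_nonneg {q : Y → ℝ} (hq : ∀ y, 0 ≤ q y) (hq1 : ∑ y, q y = 1) : 0 ≤ zeta q := by
  have hle : ∀ y, q y ≤ 1 := fun y => by
    rw [← hq1]; exact Finset.single_le_sum (fun a _ => hq a) (Finset.mem_univ y)
  have : ∑ y, q y ^ 2 ≤ ∑ y, q y := Finset.sum_le_sum fun y _ => by nlinarith [hq y, hle y]
  unfold zeta; linarith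

theorem zeta_le {q : Y → ℝ} (hq1 : ∑ y, q y = 1) :
    zeta q ≤ 1 - 1 / (Fintype.card Y : ℝ) := by
  have h := sq_sum_le_card_mul_sum_sq (s := Finset.univ) (f := q)
  rw [hq1, Finset.card_univ] at h
  have hc : (0 : ℝ) < Fintype.card Y := by
    rcases Nat.eq_zero_or_pos (Fintype.card Y) with h0 | h0
    · rw [h0] at h; norm_num at h
    · exact_mod_cast h0
  have : 1 / (Fintype.card Y : ℝ) ≤ ∑ y, q y ^ 2 := by
    rw [div_le_iff₀ hc]; linarith
  unfold zeta; linarith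

theorem iidE_empirical {n : ℕ} (hn : 0 < n) (y : Y) :
    iidE p n (fun l => empirical l y) = probVec p y := by
  have hn' : (n : ℝ) ≠ 0 := by exact_mod_cast hn.ne'
  have : iidE p n (fun l => empirical l y) = iidE p n (fun l => (1 / (n : ℝ)) * l.count y) :=
    iidE_congr p fun l hl => by unfold empirical; rw [hl]; ring
  rw [this, iidE_const_mul, iidE_count]
  field_simp

theorem iidE_empirical_sq {n : ℕ} (hn : 0 < n) (y : Y) :
    iidE p n (fun l => empirical l y ^ 2)
      = probVec p y * (1 - probVec p y) / n + probVec p y ^ 2 := by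
  have hn' : (n : ℝ) ≠ 0 := by exact_mod_cast hn.ne'
  have : iidE p n (fun l => empirical l y ^ 2)
      = iidE p n (fun l => (1 / (n : ℝ)) ^ 2 * (l.count y : ℝ) ^ 2) :=
    iidE_congr p fun l hl => by unfold empirical; rw [hl]; ring
  rw [this, iidE_const_mul, iidE_count_sq]
  field_simp

theorem sum_variance_eq_zeta (p : PMF Y) :
    ∑ y, probVec p y * (1 - probVec p y) = zeta (probVec p) := by
  have h := sum_probVec p
  simp only [mul_sub, mul_one, Finset.sum_sub_distrib, h, zeta, sq]

/-- The variance in `𝔼 p̂² = p² + p (1 - p) / n` sums to `ζ / n`, which is the downward bias. -/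
theorem iidE_plugInZeta {n : ℕ} (hn : 0 < n) :
    iidE p n plugInZeta = (1 - 1 / n) * zeta (probVec p) := by
  have : iidE p n plugInZeta = iidE p n (fun l => 1 - ∑ y, empirical l y ^ 2) := rfl
  rw [this, iidE_sub, iidE_const, iidE_sum]
  simp only [iidE_empirical_sq hn]
  rw [Finset.sum_add_distrib, ← Finset.sum_div, sum_variance_eq_zeta]
  unfold zeta; ring

/-- Here `ζ` enters: each mean absolute deviation is at most a standard deviation, and
Cauchy–Schwarz over the alphabet leaves the sum of the variances, `ζ / n`. -/
theorem iidE_tvDist_le {n : ℕ} (hn : 0 < n) :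
    iidE p n (fun l => tvDist (probVec p) (empirical l))
      ≤ √(Fintype.card Y * zeta (probVec p) / n) / 2 := by
  have hn' : (0 : ℝ) < n := by exact_mod_cast hn
  have hv : ∀ y, 0 ≤ probVec p y * (1 - probVec p y) := fun y =>
    mul_nonneg (probVec_nonneg p y) (sub_nonneg.2 (probVec_le_one p y))
  have habs : ∀ y, iidE p n (fun l => |probVec p y - empirical l y|)
      ≤ √(probVec p y * (1 - probVec p y) / n) := by
    intro y
    set E := iidE p n (fun l => |probVec p y - empirical l y|) with hE
    have hvar : iidE p n (fun l => |probVec p y - empirical l y| ^ 2)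
        = probVec p y * (1 - probVec p y) / n := by
      have : iidE p n (fun l => |probVec p y - empirical l y| ^ 2)
          = iidE p n (fun l => (probVec p y ^ 2 - (2 * probVec p y) * empirical l y)
              + empirical l y ^ 2) :=
        iidE_congr p fun l _ => by rw [sq_abs]; ring
      rw [this, iidE_add, iidE_sub, iidE_const, iidE_const_mul, iidE_empirical hn,
        iidE_empirical_sq hn]
      ring
    have hpos : 0 ≤ iidE p n (fun l => (|probVec p y - empirical l y| - E) ^ 2) := by
      rw [← iidE_const p n 0]
      exact iidE_mono p fun l _ => sq_nonneg _
    have hexp : iidE p n (fun l => (|probVec p y - empirical l y| - E) ^ 2)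
        = probVec p y * (1 - probVec p y) / n - E ^ 2 := by
      have : iidE p n (fun l => (|probVec p y - empirical l y| - E) ^ 2)
          = iidE p n (fun l => (|probVec p y - empirical l y| ^ 2
              - (2 * E) * |probVec p y - empirical l y|) + E ^ 2) :=
        iidE_congr p fun l _ => by ring
      rw [this, iidE_add, iidE_sub, iidE_const, iidE_const_mul, hvar, ← hE]
      ring
    exact Real.le_sqrt_of_sq_le (by linarith)
  have h1 : iidE p n (fun l => tvDist (probVec p) (empirical l))
      ≤ (∑ y, √(probVec p y * (1 - probVec p y) / n)) / 2 := by
    unfold tvDist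
    rw [iidE_sum, Finset.sum_div]
    refine Finset.sum_le_sum fun y _ => ?_
    have : iidE p n (fun l => |probVec p y - empirical l y| / 2)
        = iidE p n (fun l => (1 / 2) * |probVec p y - empirical l y|) :=
      iidE_congr p fun l _ => by ring
    rw [this, iidE_const_mul]
    linarith [habs y]
  refine h1.trans (div_le_div_of_nonneg_right ?_ (by norm_num))
  refine Real.le_sqrt_of_sq_le ?_
  have h2 := sq_sum_le_card_mul_sum_sq (s := Finset.univ)
    (f := fun y => √(probVec p y * (1 - probVec p y) / n))
  refine h2.trans (le_of_eq ?_)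
  have : ∀ y, √(probVec p y * (1 - probVec p y) / n) ^ 2
      = probVec p y * (1 - probVec p y) / n := fun y =>
    Real.sq_sqrt (div_nonneg (hv y) hn'.le)
  simp only [this]
  rw [← Finset.sum_div, sum_variance_eq_zeta, Finset.card_univ]
  ring

theorem negMulLog_div_le (n k : ℕ) :
    -((k : ℝ) / n * Real.log ((k : ℝ) / n)) ≤ k / n * Real.log n := by
  rcases Nat.eq_zero_or_pos k with rfl | hk
  · simp
  rcases Nat.eq_zero_or_pos n with rfl | hn
  · simp
  have hk' : (0 : ℝ) < k := by exact_mod_cast hk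
  have hn' : (0 : ℝ) < n := by exact_mod_cast hn
  rw [Real.log_div hk'.ne' hn'.ne']
  have : 0 ≤ Real.log k := Real.log_natCast_nonneg k
  have := mul_nonneg (div_nonneg hk'.le hn'.le) this
  nlinarith

/-- The plug-in entropy estimator has a nonpositive bias. -/
theorem iidE_plugInEntropy_le {n : ℕ} (hn : 0 < n) :
    iidE p n plugInEntropy ≤ entropy (probVec p) := by
  have h0 : iidE p n plugInEntropy
      = iidE p n (fun l => -∑ y, empirical l y * Real.log (empirical l y)) := rfl
  rw [h0]
  simp only [← Finset.sum_neg_distrib]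
  unfold entropy
  rw [← Finset.sum_neg_distrib, iidE_sum]
  refine Finset.sum_le_sum fun y _ => ?_
  -- Jensen's inequality through the tangent of `-x log x` at `p y`. There is no tangent at `0`;
  -- there a linear bound with slope `log n` suffices, as its expectation vanishes.
  rcases (probVec_nonneg p y).eq_or_lt with hp | hp
  · rw [← hp]
    have : iidE p n (fun l => -(empirical l y * Real.log (empirical l y)))
        ≤ iidE p n (fun l => Real.log n * empirical l y) := by
      refine iidE_mono p fun l hl => ?_
      have := negMulLog_div_le n (l.count y)
      unfold empirical
      rw [hl]; linarith
    refine this.trans ?_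
    rw [iidE_const_mul, iidE_empirical hn, ← hp]; simp
  · have : iidE p n (fun l => -(empirical l y * Real.log (empirical l y)))
        ≤ iidE p n (fun l => (-Real.log (probVec p y) - 1) * empirical l y + probVec p y) := by
      refine iidE_mono p fun l _ => ?_
      have := gibbs_pointwise (empirical_nonneg l y) hp
      linarith
    refine this.trans (le_of_eq ?_)
    rw [iidE_add, iidE_const_mul, iidE_const, iidE_empirical hn]
    ring

theorem boundedDiff_congr {n : ℕ} {d : ℝ} {f g : List Y → ℝ} (hf : BoundedDiff n d f)
    (h : ∀ l, l.length = n → g l = f l) : BoundedDiff n d g := fun l₁ l₂ a b hl => by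
  rw [h _ (by simp; omega), h _ (by simp; omega)]
  exact hf l₁ l₂ a b hl

theorem boundedDiff_tvDist {n : ℕ} (hn : 0 < n) :
    BoundedDiff n (1 / n) fun l : List Y => tvDist (probVec p) (empirical l) := by
  have hn' : (0 : ℝ) < n := by exact_mod_cast hn
  have key : ∀ (y : Y) (k : ℕ),
      |(|probVec p y - ((k + 1 : ℕ) : ℝ) / n| / 2 - |probVec p y - (k : ℝ) / n| / 2)|
        ≤ 1 / (2 * n) := by
    intro y k
    have h := abs_abs_sub_abs_le (probVec p y - ((k + 1 : ℕ) : ℝ) / n) (probVec p y - (k : ℝ) / n)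
    have e : probVec p y - ((k + 1 : ℕ) : ℝ) / n - (probVec p y - (k : ℝ) / n) = -(1 / n) := by
      push_cast; ring
    rw [e, abs_neg, abs_of_pos (by positivity : 0 < 1 / (n : ℝ))] at h
    rw [← sub_div, abs_div, abs_two, div_le_iff₀ two_pos]
    refine h.trans (le_of_eq ?_)
    field_simp
  have h := boundedDiff_sum_count (Y := Y) (n := n) (m := -(1 / (2 * n))) (M := 1 / (2 * n))
    (fun y k => |probVec p y - (k : ℝ) / n| / 2)
    (fun y k _ => (abs_le.1 (key y k)).1) (fun y k _ => (abs_le.1 (key y k)).2)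
    (by have : 0 < 1 / (2 * (n : ℝ)) := by positivity
        linarith)
  have e : 1 / (2 * (n : ℝ)) - -(1 / (2 * n)) = 1 / n := by field_simp; ring
  rw [e] at h
  exact boundedDiff_congr h fun l hl => by unfold tvDist empirical; rw [hl]

/-- The increments of `-(k / n) ^ 2` all lie in `[-2 / n, 0]`; having one sign, they give `2 / n`
and not twice that. -/
theorem boundedDiff_plugInZeta {n : ℕ} (hn : 0 < n) :
    BoundedDiff n (2 / n) (plugInZeta : List Y → ℝ) := by
  have hn' : (0 : ℝ) < n := by exact_mod_cast hn
  have h := boundedDiff_sum_count (Y := Y) (n := n) (m := -(2 / n)) (M := 0)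
    (fun _ k => -((k : ℝ) / n) ^ 2)
    (fun y k hk => by
      have hk' : (k : ℝ) + 1 ≤ n := by exact_mod_cast hk
      have : -((k + 1 : ℕ) / (n : ℝ)) ^ 2 - -((k : ℝ) / n) ^ 2 + 2 / n
          = (2 * (n - (k + 1)) + 1) / n ^ 2 := by
        push_cast; field_simp; ring
      have h2 : 0 ≤ (2 * ((n : ℝ) - (k + 1)) + 1) / n ^ 2 := by
        apply div_nonneg _ (by positivity); linarith
      linarith)
    (fun y k hk => by
      have : (k : ℝ) / n ≤ (k + 1 : ℕ) / n := by
        push_cast; gcongr; linarith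
      have h0 : 0 ≤ (k : ℝ) / n := by positivity
      nlinarith)
    (by have : 0 < 2 / (n : ℝ) := by positivity
        linarith)
  have e : 0 - -(2 / (n : ℝ)) = 2 / n := by ring
  rw [e] at h
  intro l₁ l₂ a b hl
  have := h l₁ l₂ a b hl
  have e1 : ∀ x : Y, (l₁ ++ x :: l₂).length = n := fun x => by simp; omega
  unfold plugInZeta zeta empirical
  rw [e1, e1]
  simp only [Finset.sum_neg_distrib] at this
  linarith

/-- On `[0, 1]` the function `-x log x` is concave: over steps of length `1 / n` its largest
increment is the first, `log n / n`, and its slope never falls below `-1`. -/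
theorem boundedDiff_plugInEntropy {n : ℕ} (hn : 0 < n) :
    BoundedDiff n ((Real.log n + 1) / n) (plugInEntropy : List Y → ℝ) := by
  have hn' : (0 : ℝ) < n := by exact_mod_cast hn
  have hlog : 0 ≤ Real.log n := Real.log_natCast_nonneg n
  have h := boundedDiff_sum_count (Y := Y) (n := n) (m := -(1 / n)) (M := Real.log n / n)
    (fun _ k => -((k : ℝ) / n * Real.log ((k : ℝ) / n)))
    (fun y k hk => by
      have hk' : (k : ℝ) + 1 ≤ n := by exact_mod_cast hk
      have hx1 : ((k + 1 : ℕ) : ℝ) / n ≤ 1 := by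
        rw [div_le_one hn']; push_cast; linarith
      have hx0 : 0 < ((k + 1 : ℕ) : ℝ) / n := by positivity
      have g := gibbs_pointwise (by positivity : 0 ≤ (k : ℝ) / n) hx0
      have hl : Real.log (((k + 1 : ℕ) : ℝ) / n) ≤ 0 := Real.log_nonpos hx0.le hx1
      have e : ((k + 1 : ℕ) : ℝ) / n = k / n + 1 / n := by push_cast; ring
      have h1 : 0 < 1 / (n : ℝ) := by positivity
      set x := ((k + 1 : ℕ) : ℝ) / n
      have : x * Real.log x = k / n * Real.log x + 1 / n * Real.log x := by
        nth_rewrite 1 [e]; ring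
      nlinarith [mul_nonneg h1.le (neg_nonneg.2 hl)])
    (fun y k hk => by
      rcases Nat.eq_zero_or_pos k with rfl | hk0
      · simp only [zero_add, Nat.cast_one, Nat.cast_zero, zero_div, zero_mul, neg_zero, sub_zero]
        rw [one_div, Real.log_inv]
        apply le_of_eq; ring
      have hk0' : (0 : ℝ) < k := by exact_mod_cast hk0
      have l1 : Real.log ((k : ℝ) / n) ≤ Real.log (((k + 1 : ℕ) : ℝ) / n) :=
        Real.log_le_log (by positivity) (by push_cast; gcongr; linarith)
      have l2 : -Real.log n ≤ Real.log (((k + 1 : ℕ) : ℝ) / n) := by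
        rw [← Real.log_inv]
        refine Real.log_le_log (by positivity) ?_
        rw [inv_eq_one_div]; gcongr; push_cast; linarith
      have e : ((k + 1 : ℕ) : ℝ) / n = k / n + 1 / n := by push_cast; ring
      have h1 : 0 < 1 / (n : ℝ) := by positivity
      have h2 : 0 < (k : ℝ) / n := by positivity
      set x := ((k + 1 : ℕ) : ℝ) / n
      have ex : x * Real.log x = k / n * Real.log x + 1 / n * Real.log x := by
        nth_rewrite 1 [e]; ring
      have e3 : Real.log n / n = 1 / n * Real.log n := by ring
      rw [e3]
      nlinarith [mul_le_mul_of_nonneg_left l1 h2.le, mul_le_mul_of_nonneg_left l2 h1.le])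
    (by have : 0 < 1 / (n : ℝ) := by positivity
        have : 0 ≤ Real.log n / n := by positivity
        linarith)
  have e : Real.log n / n - -(1 / (n : ℝ)) = (Real.log n + 1) / n := by ring
  rw [e] at h
  refine boundedDiff_congr h fun l hl => ?_
  unfold plugInEntropy entropy empirical
  rw [hl, Finset.sum_neg_distrib]

end Counts

/-! ### The four deviation bounds, each at level `exp (-L)` -/

section Deviations

variable {Y : Type*} [Fintype Y] [DecidableEq Y]

open Classical in
theorem iidE_tvDist_deviation (p : PMF Y) {n : ℕ} (hn : 0 < n) {L : ℝ} (hL : 0 ≤ L) :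
    iidE p n (fun l => if √(Fintype.card Y * zeta (probVec p) / n) / 2 + √(L / (2 * n))
      < tvDist (probVec p) (empirical l) then 1 else 0) ≤ Real.exp (-L) := by
  have hn' : (0 : ℝ) < n := by exact_mod_cast hn
  refine le_trans (iidE_mono p fun l _ => ?_)
    (mcdiarmid p hn (by positivity) (boundedDiff_tvDist (p := p) hn) hL)
  have e : 1 / (n : ℝ) * √(n * L / 2) = √(L / (2 * n)) := by
    rw [show L / (2 * (n : ℝ)) = (1 / n) ^ 2 * (n * L / 2) by field_simp,
      Real.sqrt_mul (by positivity), Real.sqrt_sq (by positivity)]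
  have := iidE_tvDist_le (p := p) hn
  split_ifs with h1 h2
  · rfl
  · exact absurd (by rw [e]; linarith) h2
  · norm_num
  · rfl

open Classical in
theorem iidE_zeta_lower_deviation (p : PMF Y) {n : ℕ} (hn : 0 < n) {L : ℝ} (hL : 0 ≤ L) :
    iidE p n (fun l => if plugInZeta l + √(2 * L / n) < (1 - 1 / n) * zeta (probVec p)
      then 1 else 0) ≤ Real.exp (-L) := by
  have hn' : (0 : ℝ) < n := by exact_mod_cast hn
  refine le_trans (iidE_mono p fun l _ => ?_)
    (mcdiarmid p hn (by positivity) (boundedDiff_plugInZeta (Y := Y) hn).neg hL)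
  have e : 2 / (n : ℝ) * √(n * L / 2) = √(2 * L / n) := by
    rw [show 2 * L / (n : ℝ) = (2 / n) ^ 2 * (n * L / 2) by field_simp,
      Real.sqrt_mul (by positivity), Real.sqrt_sq (by positivity)]
  have := iidE_plugInZeta (p := p) hn
  split_ifs with h1 h2
  · rfl
  · exact absurd (by rw [e, iidE_neg, this]; linarith) h2
  · norm_num
  · rfl

open Classical in
-- The bias of the plug-in estimator helps in this direction, so the factor `1 - 1 / n` can be
-- dropped, unlike in the lower deviation.
theorem iidE_zeta_upper_deviation (p : PMF Y) {n : ℕ} (hn : 0 < n) {L : ℝ} (hL : 0 ≤ L) :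
    iidE p n (fun l => if zeta (probVec p) + √(2 * L / n) < plugInZeta l then 1 else 0)
      ≤ Real.exp (-L) := by
  have hn' : (0 : ℝ) < n := by exact_mod_cast hn
  refine le_trans (iidE_mono p fun l _ => ?_)
    (mcdiarmid p hn (by positivity) (boundedDiff_plugInZeta (Y := Y) hn) hL)
  have e : 2 / (n : ℝ) * √(n * L / 2) = √(2 * L / n) := by
    rw [show 2 * L / (n : ℝ) = (2 / n) ^ 2 * (n * L / 2) by field_simp,
      Real.sqrt_mul (by positivity), Real.sqrt_sq (by positivity)]
  have := iidE_plugInZeta (p := p) hn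
  have hz := zeta_nonneg (probVec_nonneg p) (sum_probVec p)
  have h3 : 0 ≤ 1 / (n : ℝ) * zeta (probVec p) := by positivity
  split_ifs with h1 h2
  · rfl
  · exact absurd (by rw [e, this]; linarith) h2
  · norm_num
  · rfl

open Classical in
theorem iidE_entropy_upper_deviation (p : PMF Y) {n : ℕ} (hn : 0 < n) {L : ℝ} (hL : 0 ≤ L) :
    iidE p n (fun l => if entropy (probVec p) + (Real.log n + 1) * √(L / (2 * n))
      < plugInEntropy l then 1 else 0) ≤ Real.exp (-L) := by
  have hn' : (0 : ℝ) < n := by exact_mod_cast hn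
  have hlog : 0 ≤ Real.log n := Real.log_natCast_nonneg n
  refine le_trans (iidE_mono p fun l _ => ?_)
    (mcdiarmid p hn (by positivity) (boundedDiff_plugInEntropy (Y := Y) hn) hL)
  have e : (Real.log n + 1) / (n : ℝ) * √(n * L / 2) = (Real.log n + 1) * √(L / (2 * n)) := by
    rw [show L / (2 * (n : ℝ)) = (1 / n) ^ 2 * (n * L / 2) by field_simp,
      Real.sqrt_mul (by positivity), Real.sqrt_sq (by positivity)]
    ring
  have := iidE_plugInEntropy_le (p := p) hn
  split_ifs with h1 h2
  · rfl
  · exact absurd (by rw [e]; linarith) h2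
  · norm_num
  · rfl

end Deviations

/-! ### Adaptively collected samples compared with i.i.d. samples -/

section SampleLaw

variable {K : ℕ} {A : Fin K → Type*} [∀ i, Fintype (A i)] [∀ i, DecidableEq (A i)]
  [∀ i, MeasurableSpace (A i)] [∀ i, MeasurableSingletonClass (A i)]
  {Ω : Type*} [mΩ : MeasurableSpace Ω] {μ : Measure Ω} [IsProbabilityMeasure μ]
  {ℱ : Filtration ℕ mΩ} {p : ∀ i, PMF (A i)} {X : ∀ i, ℕ → Ω → A i} {I : ℕ → Ω → Fin K}

theorem measurableSet_play (hI : ∀ t, Measurable[ℱ t] (I (t + 1))) (i : Fin K) (t : ℕ) :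
    MeasurableSet[ℱ t] {ω | I (t + 1) ω = i} :=
  hI t (measurableSet_singleton i)

theorem measurableSet_samples (hX : MemorylessSources μ ℱ p X)
    (hI : ∀ t, Measurable[ℱ t] (I (t + 1))) (i : Fin K) (t : ℕ) (P : List (A i) → Prop) :
    MeasurableSet[ℱ t] {ω | P (samples I X i t ω)} := by
  induction t generalizing P with
  | zero => exact MeasurableSet.const (P [])
  | succ t ih =>
    have hmono : ℱ t ≤ ℱ (t + 1) := ℱ.mono (Nat.le_succ t)
    have hplay := hmono _ (measurableSet_play hI i t)
    have e : {ω | P (samples I X i (t + 1) ω)}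
        = ({ω | I (t + 1) ω = i} ∩ ⋃ a : A i, ((X i (t + 1)) ⁻¹' {a}
            ∩ {ω | P (samples I X i t ω ++ [a])}))
          ∪ ({ω | I (t + 1) ω = i}ᶜ ∩ {ω | P (samples I X i t ω)}) := by
      ext ω
      by_cases h : I (t + 1) ω = i <;> simp [samples, h]
    rw [e]
    refine (hplay.inter (MeasurableSet.iUnion fun a => ?_)).union
      (hplay.compl.inter (hmono _ (ih P)))
    exact (hX.adapted i t (measurableSet_singleton a)).inter
      (hmono _ (ih fun l => P (l ++ [a])))

theorem measure_inter_symbol (hX : MemorylessSources μ ℱ p X) (i : Fin K) (t : ℕ) (a : A i)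
    {s : Set Ω} (hs : MeasurableSet[ℱ t] s) :
    μ (s ∩ (X i (t + 1)) ⁻¹' {a}) = μ s * p i a := by
  have h := (Indep_iff _ _ μ).1 (hX.indep i t) ((X i (t + 1)) ⁻¹' {a}) s
    ⟨{a}, measurableSet_singleton a, rfl⟩ hs
  have hm : Measurable (X i (t + 1)) := (hX.adapted i t).mono (ℱ.le _) le_rfl
  have hl : μ ((X i (t + 1)) ⁻¹' {a}) = p i a := by
    rw [← Measure.map_apply hm (measurableSet_singleton a), hX.law,
      PMF.toMeasure_apply_singleton _ _ (measurableSet_singleton a)]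
  rw [Set.inter_comm, h, hl, mul_comm]

/-- A sample can start with `l ++ [a]` only if in some round it equals `l`, the arm is played, and
the symbol is `a`. The events of leaving `l` in different rounds are disjoint and make up the proper
extensions of `l`; independence charges `p i a` to each. Keeping the proper extensions on the right
makes the induction on `t` close. -/
theorem measure_prefix_concat_le (hX : MemorylessSources μ ℱ p X)
    (hI : ∀ t, Measurable[ℱ t] (I (t + 1))) (i : Fin K) (t : ℕ) (l : List (A i)) (a : A i) :
    μ {ω | l ++ [a] <+: samples I X i t ω}
      ≤ μ {ω | l <+: samples I X i t ω ∧ samples I X i t ω ≠ l} * p i a := by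
  induction t with
  | zero => simp [samples]
  | succ t ih =>
    have hmeas : ∀ P : List (A i) → Prop, MeasurableSet[ℱ t] {ω | P (samples I X i t ω)} :=
      measurableSet_samples hX hI i t
    have hE : MeasurableSet[ℱ t] ({ω | samples I X i t ω = l} ∩ {ω | I (t + 1) ω = i}) :=
      (hmeas fun x => x = l).inter (measurableSet_play hI i t)
    have h1 : {ω | l ++ [a] <+: samples I X i (t + 1) ω}
        ⊆ {ω | l ++ [a] <+: samples I X i t ω}
          ∪ (({ω | samples I X i t ω = l} ∩ {ω | I (t + 1) ω = i}) ∩ (X i (t + 1)) ⁻¹' {a}) := by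
      intro ω hω
      simp only [Set.mem_ofPred_eq, samples] at hω
      split_ifs at hω with h
      · rcases List.prefix_concat_iff.1 hω with h2 | h2
        · obtain ⟨h3, h4⟩ := List.append_inj' h2 rfl
          right
          exact ⟨⟨h3.symm, h⟩, by simpa using h4.symm⟩
        · exact Or.inl h2
      · exact Or.inl hω
    have h2 : {ω | l <+: samples I X i t ω ∧ samples I X i t ω ≠ l}
          ∪ ({ω | samples I X i t ω = l} ∩ {ω | I (t + 1) ω = i})
        ⊆ {ω | l <+: samples I X i (t + 1) ω ∧ samples I X i (t + 1) ω ≠ l} := by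
      rintro ω (⟨h3, h4⟩ | ⟨h3, h4⟩)
      · simp only [Set.mem_ofPred_eq, samples]
        split_ifs with h
        · refine ⟨h3.trans (List.prefix_append _ _), fun h5 => ?_⟩
          have := h3.length_le
          have h6 := congrArg List.length h5
          simp at h6; omega
        · exact ⟨h3, h4⟩
      · simp only [Set.mem_ofPred_eq] at h3 h4
        simp only [Set.mem_ofPred_eq, samples, h4, if_true, h3]
        exact ⟨List.prefix_append _ _, by simp⟩
    have hdisj : Disjoint {ω | l <+: samples I X i t ω ∧ samples I X i t ω ≠ l}
        ({ω | samples I X i t ω = l} ∩ {ω | I (t + 1) ω = i}) :=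
      Set.disjoint_left.2 fun ω h3 h4 => h3.2 h4.1
    calc μ {ω | l ++ [a] <+: samples I X i (t + 1) ω}
        ≤ μ {ω | l ++ [a] <+: samples I X i t ω}
          + μ (({ω | samples I X i t ω = l} ∩ {ω | I (t + 1) ω = i})
              ∩ (X i (t + 1)) ⁻¹' {a}) := (measure_mono h1).trans (measure_union_le _ _)
      _ ≤ μ {ω | l <+: samples I X i t ω ∧ samples I X i t ω ≠ l} * p i a
          + μ ({ω | samples I X i t ω = l} ∩ {ω | I (t + 1) ω = i}) * p i a := by
          rw [measure_inter_symbol hX i t a hE]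
          gcongr
      _ = μ ({ω | l <+: samples I X i t ω ∧ samples I X i t ω ≠ l}
          ∪ ({ω | samples I X i t ω = l} ∩ {ω | I (t + 1) ω = i})) * p i a := by
          rw [measure_union hdisj (ℱ.le t _ hE), add_mul]
      _ ≤ _ := by gcongr

/-- Only an inequality: the player may stop playing the arm before the word is complete. -/
theorem measure_prefix_le (hX : MemorylessSources μ ℱ p X)
    (hI : ∀ t, Measurable[ℱ t] (I (t + 1))) (i : Fin K) (t : ℕ) (l : List (A i)) :
    μ {ω | l <+: samples I X i t ω} ≤ (l.map (p i)).prod := by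
  induction l using List.reverseRecOn with
  | nil => simp
  | append_singleton l a ih =>
    refine (measure_prefix_concat_le hX hI i t l a).trans ?_
    simp only [List.map_append, List.map_cons, List.map_nil, List.prod_append, List.prod_cons,
      List.prod_nil, mul_one]
    gcongr
    exact (measure_mono fun ω h => h.1).trans ih

open Classical in
/-- The samples of an arm behave at each fixed size at most as badly as an i.i.d. sample. -/
theorem measure_samples_le (hX : MemorylessSources μ ℱ p X)
    (hI : ∀ t, Measurable[ℱ t] (I (t + 1))) (i : Fin K) (t n : ℕ) (B : List (A i) → Prop) :
    μ {ω | (samples I X i t ω).length = n ∧ B (samples I X i t ω)}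
      ≤ ENNReal.ofReal (iidE (p i) n fun l => if B l then 1 else 0) := by
  have hsub : {ω | (samples I X i t ω).length = n ∧ B (samples I X i t ω)}
      ⊆ ⋃ g ∈ (Finset.univ.filter fun g : Fin n → A i => B (List.ofFn g)),
        {ω | List.ofFn g <+: samples I X i t ω} := by
    rintro ω ⟨h1, h2⟩
    obtain ⟨g, hg⟩ : ∃ g : Fin n → A i, List.ofFn g = samples I X i t ω := by
      subst h1
      exact ⟨fun j => (samples I X i t ω).get j, List.ofFn_get _⟩
    simp only [Set.mem_iUnion, Finset.mem_filter, Finset.mem_univ, true_and]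
    exact ⟨g, by rwa [hg], by simp [hg]⟩
  refine (measure_mono hsub).trans ((measure_biUnion_finset_le _ _).trans ?_)
  rw [iidE_eq_sum_ofFn, ENNReal.ofReal_sum_of_nonneg, Finset.sum_filter]
  · refine Finset.sum_le_sum fun g _ => ?_
    split_ifs with h
    · refine (measure_prefix_le hX hI i t _).trans (le_of_eq ?_)
      rw [mul_one, ENNReal.ofReal_prod_of_nonneg fun j _ => probVec_nonneg _ _,
        List.map_ofFn, List.prod_ofFn]
      exact Finset.prod_congr rfl fun j _ => by
        simp [probVec, ENNReal.ofReal_toReal ((p i).apply_ne_top _)]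
    · simp
  · intro g _
    refine mul_nonneg (Finset.prod_nonneg fun j _ => probVec_nonneg _ _) ?_
    split_ifs <;> norm_num

end SampleLaw

/-! ### UCD dominates the entropy deviation for `n c ≥ 100` -/

section Deviation

/-- The modulus of continuity `x ↦ x log (c / x) + x` of the entropy. -/
def fannes (c x : ℝ) : ℝ := x * Real.log (c / x) + x

theorem fannes_nonneg {c x : ℝ} (hx : 0 ≤ x) (hxc : x ≤ c) : 0 ≤ fannes c x := by
  unfold fannes
  rcases hx.eq_or_lt with rfl | hx
  · simp
  · have := Real.log_nonneg ((one_le_div hx).2 hxc)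
    positivity

theorem fannes_add_le {c x y : ℝ} (hc : 0 < c) (hx : 0 ≤ x) (hy : 0 ≤ y) :
    fannes c (x + y) ≤ fannes c x + fannes c y := by
  have key : ∀ {x y : ℝ}, 0 ≤ x → 0 ≤ y → x * Real.log (c / (x + y)) ≤ x * Real.log (c / x) := by
    intro x y hx hy
    rcases hx.eq_or_lt with rfl | hx
    · simp
    · have : Real.log (c / (x + y)) ≤ Real.log (c / x) :=
        Real.log_le_log (by positivity) (by gcongr; linarith)
      gcongr
  have h1 := key hx hy
  have h2 := key hy hx
  rw [add_comm y x] at h2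
  unfold fannes
  linarith

/-- The derivative of `fannes c` is `log (c / x)`, which is nonnegative only up to `c`. -/
theorem fannes_mono {c x y : ℝ} (hx : 0 ≤ x) (hxy : x ≤ y) (hyc : y ≤ c) :
    fannes c x ≤ fannes c y := by
  rcases hx.eq_or_lt with rfl | hx
  · have := fannes_nonneg hxy hyc
    simpa [fannes] using this
  have hy : 0 < y := hx.trans_le hxy
  have hc : 0 < c := hy.trans_le hyc
  have h0 : 0 ≤ Real.log (c / y) := Real.log_nonneg ((one_le_div hy).2 hyc)
  have h1 : Real.log (c / x) = Real.log (c / y) + Real.log (y / x) := by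
    rw [← Real.log_mul (by positivity) (by positivity)]; congr 1; field_simp
  have h2 := mul_le_mul_of_nonneg_left
    (Real.log_le_sub_one_of_pos (div_pos hy hx)) hx.le
  have h3 : x * (y / x - 1) = y - x := by field_simp
  unfold fannes
  rw [h1]
  nlinarith

/-- The confidence deviation in terms of `L = log (2 / δ)`. -/
def ucdLog (z c L n : ℝ) : ℝ :=
  3 * √(z * c / n) * Real.log (n * c / (36 * z))
    + 3 / 2 * √(L / n) * Real.log (n * c ^ 2 / 9)
    + 2 * √(c / n * √(L / n)) * Real.log (n * c ^ (2 / 3 : ℝ))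

theorem sqrt_mul_sqrt_eq_rpow {c L n : ℝ} (hc : 0 ≤ c) (hL : 0 ≤ L) (hn : 0 < n) :
    √(c / n * √(L / n)) = c ^ (1 / 2 : ℝ) * L ^ (1 / 4 : ℝ) / n ^ (3 / 4 : ℝ) := by
  rw [Real.sqrt_eq_rpow, Real.sqrt_eq_rpow, Real.mul_rpow (by positivity) (by positivity),
    ← Real.rpow_mul (by positivity), Real.div_rpow hc hn.le, Real.div_rpow hL hn.le]
  norm_num
  rw [show (3 / 4 : ℝ) = 1 / 2 + 1 / 4 by norm_num, Real.rpow_add hn]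
  field_simp

theorem ucdTV_eq_ucdLog (z δ : ℝ) (c n : ℕ) (hn : 0 < n) (hL : 0 ≤ Real.log (2 / δ)) :
    ucdTV z c δ n = ucdLog z c (Real.log (2 / δ)) n := by
  have hn' : (0 : ℝ) < n := by exact_mod_cast hn
  unfold ucdTV ucdLog
  rw [sqrt_mul_sqrt_eq_rpow (by positivity) hL hn']
  ring

theorem ucdLog_mono {z c L L' n : ℝ} (hn : 0 < n) (hLL : L ≤ L')
    (h2 : 1 ≤ n * c ^ 2 / 9) (h3 : 1 ≤ n * c ^ (2 / 3 : ℝ)) (hc : 0 ≤ c) :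
    ucdLog z c L n ≤ ucdLog z c L' n := by
  unfold ucdLog
  have := Real.log_nonneg h2
  have := Real.log_nonneg h3
  gcongr

theorem log_div_sqrt {c x : ℝ} (hc : 0 < c) (hx : 0 < x) :
    Real.log (c / √x) = Real.log c - Real.log x / 2 := by
  rw [Real.log_div hc.ne' (Real.sqrt_pos.2 hx).ne', Real.log_sqrt hx.le]

theorem log_six_gt : 1.79175 < Real.log 6 := by
  rw [show (6 : ℝ) = 2 * 3 by norm_num, Real.log_mul (by norm_num) (by norm_num)]
  linarith [Real.log_two_gt_d9, Real.log_three_gt_d9]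

theorem log_six_lt : Real.log 6 < 1.79176 := by
  rw [show (6 : ℝ) = 2 * 3 by norm_num, Real.log_mul (by norm_num) (by norm_num)]
  linarith [Real.log_two_lt_d9, Real.log_three_lt_d9]

theorem log_ge_one_sub_inv {x : ℝ} (hx : 0 < x) : 1 - 1 / x ≤ Real.log x := by
  have := Real.one_sub_inv_le_log_of_pos hx
  rwa [one_div]

theorem log_le_div_add {x b : ℝ} (hx : 0 < x) (hb : 0 < b) :
    Real.log x ≤ x / b + Real.log b - 1 := by
  have := Real.log_le_sub_one_of_pos (div_pos hx hb)
  rw [Real.log_div hx.ne' hb.ne'] at this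
  linarith

/-- With `W = n c / (36 z)` one has `√W √(z c / n) = c / 6`, so the logarithm in `fannes` is `log W
/ 2` plus a constant, and `n c ≥ 100` keeps `W` large enough to absorb the constant. The next two
lemmas treat the other summands of UCD alike, dropping `log L ≥ 0`. -/
theorem fannes_le_first {z c n : ℝ} (hz : 0 ≤ z) (hz1 : z ≤ 1) (hn : 0 < n) (hc : 0 < c)
    (hnc : 100 ≤ n * c) :
    fannes c (0.6125 * √(z * c / n)) ≤ 3 * √(z * c / n) * Real.log (n * c / (36 * z)) := by
  rcases hz.eq_or_lt with rfl | hz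
  · simp [fannes]
  set X := √(z * c / n) with hX
  have hX0 : 0 < X := Real.sqrt_pos.2 (by positivity)
  have hW : (100 / 36 : ℝ) ≤ n * c / (36 * z) := by
    rw [div_le_div_iff₀ (by norm_num) (by positivity)]; nlinarith
  set W := n * c / (36 * z) with hWdef
  have hW0 : 0 < W := by linarith
  have hlW : 0.97 ≤ Real.log W := by
    have h1 := log_ge_one_sub_inv (x := W / 2) (by positivity)
    have h2 : 1 / (W / 2) ≤ 0.72 := by
      rw [div_le_iff₀ (by positivity)]; linarith
    rw [Real.log_div hW0.ne' (by norm_num)] at h1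
    linarith [Real.log_two_gt_d9]
  have hlog : Real.log (c / (0.6125 * X)) = Real.log 6 - Real.log 0.6125 + Real.log W / 2 := by
    rw [← Real.log_sqrt hW0.le, ← Real.log_div (by norm_num) (by norm_num),
      ← Real.log_mul (by norm_num) (Real.sqrt_pos.2 hW0).ne']
    congr 1
    have : √W * X = c / 6 := by
      rw [hX, ← Real.sqrt_mul hW0.le, show W * (z * c / n) = (c / 6) ^ 2 by
        rw [hWdef]; field_simp; norm_num, Real.sqrt_sq (by positivity)]
    field_simp
    nlinarith
  have h6 := log_six_lt
  have hk : -0.52 ≤ Real.log 0.6125 := by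
    have h1 := log_ge_one_sub_inv (x := 1.225) (by norm_num)
    have h2 : Real.log 0.6125 = Real.log 1.225 - Real.log 2 := by
      rw [← Real.log_div (by norm_num) (by norm_num)]; norm_num
    have h3 : 1 / (1.225 : ℝ) ≤ 0.82 := by norm_num
    rw [h2]
    linarith [Real.log_two_lt_d9]
  unfold fannes
  rw [hlog]
  have : 0.6125 * (Real.log 6 - Real.log 0.6125 + Real.log W / 2) + 0.6125
      ≤ 3 * Real.log W := by linarith
  nlinarith [mul_le_mul_of_nonneg_left this hX0.le]

theorem fannes_le_second {L c n : ℝ} (hL : 1 ≤ L) (hn : 0 < n) (hc : 2 ≤ c)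
    (hnc : 100 ≤ n * c) :
    fannes c (0.7072 * √(L / n)) ≤ 3 / 2 * √(L / n) * Real.log (n * c ^ 2 / 9) := by
  set X := √(L / n) with hX
  have hX0 : 0 < X := Real.sqrt_pos.2 (by positivity)
  have hc0 : 0 < c := by linarith
  have hU : (20 : ℝ) ≤ n * c ^ 2 / 9 := by nlinarith
  set U := n * c ^ 2 / 9 with hUdef
  have hU0 : 0 < U := by linarith
  have hlU : 2.5 ≤ Real.log U := by
    have h1 : Real.log 20 ≤ Real.log U := Real.log_le_log (by norm_num) hU
    rw [show (20 : ℝ) = 2 * 2 * 5 by norm_num, Real.log_mul (by norm_num) (by norm_num),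
      Real.log_mul (by norm_num) (by norm_num)] at h1
    linarith [Real.log_two_gt_d9, Real.log_five_gt_d9]
  have hlog : Real.log (c / (0.7072 * X))
      ≤ Real.log 3 - Real.log 0.7072 + Real.log U / 2 := by
    have e1 : Real.log (c / (0.7072 * X)) = Real.log (c / X) - Real.log 0.7072 := by
      rw [← Real.log_div (by positivity) (by norm_num)]; congr 1; field_simp
    have e2 : Real.log U = Real.log (n * c ^ 2) - 2 * Real.log 3 := by
      rw [hUdef, Real.log_div (by positivity) (by norm_num), show (9 : ℝ) = 3 ^ 2 by norm_num,
        Real.log_pow]; norm_num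
    have e3 : Real.log (n * c ^ 2) = Real.log n + 2 * Real.log c := by
      rw [Real.log_mul (by positivity) (by positivity), Real.log_pow]; norm_num
    rw [e1, hX, log_div_sqrt hc0 (by positivity), Real.log_div (by positivity) (by positivity),
      e2, e3]
    linarith [Real.log_nonneg hL]
  have hk : -0.37 ≤ Real.log 0.7072 := by
    have h1 := log_ge_one_sub_inv (x := 1.4144) (by norm_num)
    have h2 : Real.log 0.7072 = Real.log 1.4144 - Real.log 2 := by
      rw [← Real.log_div (by norm_num) (by norm_num)]; norm_num
    have h3 := log_ge_one_sub_inv (x := 0.9428) (by norm_num)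
    have h4 : Real.log 1.4144 = Real.log 1.5002 + Real.log 0.9428 - Real.log (1.5002 * 0.9428 / 1.4144) := by
      rw [Real.log_div (by norm_num) (by norm_num), Real.log_mul (by norm_num) (by norm_num)]; ring
    rw [h2]
    have h5 : 2 * Real.log 1.4144 = Real.log 2.00052736 := by
      rw [show (2.00052736 : ℝ) = 1.4144 ^ 2 by norm_num, Real.log_pow]; norm_num
    have h6 : Real.log 2 ≤ Real.log 2.00052736 := Real.log_le_log (by norm_num) (by norm_num)
    linarith [Real.log_two_lt_d9, Real.log_two_gt_d9]
  unfold fannes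
  have : 0.7072 * Real.log (c / (0.7072 * X)) + 0.7072 ≤ 3 / 2 * Real.log U := by
    linarith [Real.log_three_lt_d9]
  nlinarith [mul_le_mul_of_nonneg_left this hX0.le]

theorem fannes_le_third {L c n : ℝ} (hL : 1 ≤ L) (hn : 3 ≤ n) (hc : 1 ≤ c) :
    fannes c (0.7283 * √(c / n * √(L / n)))
      ≤ 2 * √(c / n * √(L / n)) * Real.log (n * c ^ (2 / 3 : ℝ)) := by
  have hn0 : 0 < n := by linarith
  have hc0 : 0 < c := by linarith
  set X := √(c / n * √(L / n)) with hX
  have hX0 : 0 < X := Real.sqrt_pos.2 (by positivity)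
  have eV : Real.log (n * c ^ (2 / 3 : ℝ)) = Real.log n + 2 / 3 * Real.log c := by
    rw [Real.log_mul (by positivity) (by positivity), Real.log_rpow hc0]
  have hlV : 1.098 ≤ Real.log (n * c ^ (2 / 3 : ℝ)) := by
    rw [eV]
    have := Real.log_le_log (by norm_num) hn
    linarith [Real.log_three_gt_d9, Real.log_nonneg hc]
  have hlog : Real.log (c / (0.7283 * X))
      ≤ - Real.log 0.7283 + 3 / 4 * Real.log (n * c ^ (2 / 3 : ℝ)) := by
    have e1 : Real.log (c / (0.7283 * X)) = Real.log (c / X) - Real.log 0.7283 := by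
      rw [← Real.log_div (by positivity) (by norm_num)]; congr 1; field_simp
    rw [e1, hX, log_div_sqrt hc0 (by positivity), Real.log_mul (by positivity) (by positivity),
      Real.log_sqrt (by positivity), Real.log_div (by positivity) (by positivity),
      Real.log_div (by positivity) (by positivity), eV]
    linarith [Real.log_nonneg hL]
  have hk : -0.4 ≤ Real.log 0.7283 := by
    have h1 := log_ge_one_sub_inv (x := 0.7283) (by norm_num)
    norm_num at h1 ⊢
    linarith
  unfold fannes
  have : 0.7283 * Real.log (c / (0.7283 * X)) + 0.7283
      ≤ 2 * Real.log (n * c ^ (2 / 3 : ℝ)) := by linarith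
  nlinarith [mul_le_mul_of_nonneg_left this hX0.le]

/-- Needed because `a + b + d` may exceed the range in which `fannes` is monotone; monotonicity is
then used on each part separately. -/
theorem exists_add_add_eq {a b d T : ℝ} (ha : 0 ≤ a) (hb : 0 ≤ b) (hd : 0 ≤ d) (hT : 0 ≤ T)
    (h : T ≤ a + b + d) : ∃ a' b' d' : ℝ, a' ≤ a ∧ b' ≤ b ∧ d' ≤ d ∧ 0 ≤ a' ∧ 0 ≤ b' ∧ 0 ≤ d' ∧
      T = a' + b' + d' := by
  rcases le_total T a with h1 | h1
  · exact ⟨T, 0, 0, h1, hb, hd, hT, le_rfl, le_rfl, by ring⟩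
  rcases le_total (T - a) b with h2 | h2
  · exact ⟨a, T - a, 0, le_rfl, h2, hd, ha, by linarith, le_rfl, by ring⟩
  · exact ⟨a, b, T - a - b, le_rfl, le_rfl, by linarith, ha, hb, by linarith, by ring⟩

/-- The three coefficients are `0.6125 ≥ √1.5 / 2`, `0.7072 ≥ 1 / √2` and `0.7283 ≥ √(1.5 · 1.41422)
/ 2`. Here `1.5` is the largest value of `1 / (1 - 1 / n)` for `n ≥ 3`. Subadditivity of the square
root and of `fannes` separates the pieces. -/
theorem fannes_le_ucdLog {z z' c n L T : ℝ} (hz' : 0 ≤ z') (hz'1 : z' ≤ 1)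
    (hz1 : z ≤ 1) (hc : 2 ≤ c) (hn : 3 ≤ n) (hnc : 100 ≤ n * c) (hL : 1 ≤ L)
    (hT0 : 0 ≤ T) (hT1 : T ≤ 1) (hT : T ≤ √(c * z / n) / 2 + √(L / (2 * n)))
    (hzz : (1 - 1 / n) * z ≤ z' + √(2 * L / n)) :
    fannes c T ≤ ucdLog z' c L n := by
  have hn0 : 0 < n := by linarith
  have hc0 : 0 < c := by linarith
  -- At `L = 2 n` the bound on `T` already exceeds `1` and that on `z` is trivial, so larger `L`
  -- reduce to this value by monotonicity of UCD.
  wlog hLn : L ≤ 2 * n generalizing L with H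
  · have hLn' : 2 * n ≤ L := (not_le.1 hLn).le
    refine (H (L := 2 * n) (by linarith) ?_ ?_ le_rfl).trans
      (ucdLog_mono hn0 hLn' ?_ ?_ hc0.le)
    · rw [div_self (by positivity), Real.sqrt_one]
      have := Real.sqrt_nonneg (c * z / n)
      linarith
    · have e : √(2 * (2 * n) / n) = 2 := by
        rw [show 2 * (2 * n) / n = 2 ^ 2 by field_simp]
        exact Real.sqrt_sq (by norm_num)
      rw [e]
      have h1 : 0 < 1 / n := by positivity
      have h2 : 1 / n ≤ 1 / 3 := by gcongr
      nlinarith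
    · nlinarith
    · have : (1 : ℝ) ≤ c ^ (2 / 3 : ℝ) := Real.one_le_rpow (by linarith) (by norm_num)
      nlinarith
  set Y := √(L / n) with hY
  have hY0 : 0 ≤ Y := Real.sqrt_nonneg _
  have hY2 : Y ^ 2 = L / n := Real.sq_sqrt (by positivity)
  have hYle : Y ^ 2 ≤ 2 := by rw [hY2, div_le_iff₀ hn0]; linarith
  have hY15 : Y ≤ 1.5 :=
    (abs_le_of_sq_le_sq' (by norm_num; linarith : Y ^ 2 ≤ 1.5 ^ 2) (by norm_num)).2
  have hcc : c * 2 ≤ c ^ 2 := by rw [sq]; gcongr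
  have hs2 : √(2 * L / n) ≤ 1.41422 * Y := by
    rw [Real.sqrt_le_left (by positivity), mul_pow, hY2]
    have : 0 ≤ L / n := by positivity
    have e : 2 * L / n = 2 * (L / n) := by ring
    rw [e]; norm_num; linarith
  have hhalf : √(L / (2 * n)) ≤ 0.7072 * Y := by
    rw [Real.sqrt_le_left (by positivity), mul_pow, hY2]
    have : 0 ≤ L / n := by positivity
    have e : L / (2 * n) = 1 / 2 * (L / n) := by field_simp
    rw [e]; norm_num; linarith
  have hzb : z ≤ 1.5 * (z' + 1.41422 * Y) := by
    have h2 : 1 / n ≤ 1 / 3 := by gcongr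
    by_cases hz0 : 0 ≤ z
    · nlinarith
    · have : 0 ≤ z' + 1.41422 * Y := by positivity
      linarith
  set X₁ := √(z' * c / n) with hX₁
  set X₃ := √(c / n * Y) with hX₃
  have hX₁0 : 0 ≤ X₁ := Real.sqrt_nonneg _
  have hX₃0 : 0 ≤ X₃ := Real.sqrt_nonneg _
  have hX₁2 : X₁ ^ 2 = z' * c / n := Real.sq_sqrt (by positivity)
  have hX₃2 : X₃ ^ 2 = c / n * Y := Real.sq_sqrt (by positivity)
  have hsplit : √(c * z / n) / 2 ≤ 0.6125 * X₁ + 0.7283 * X₃ := by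
    have : √(c * z / n) ≤ 2 * (0.6125 * X₁ + 0.7283 * X₃) := by
      rw [Real.sqrt_le_left (by positivity)]
      have h1 : c * z / n ≤ 1.5 * (z' * c / n) + 1.5 * 1.41422 * (c / n * Y) := by
        have := mul_le_mul_of_nonneg_left hzb (by positivity : 0 ≤ c / n)
        calc c * z / n = c / n * z := by ring
          _ ≤ _ := this
          _ = _ := by ring
      rw [← hX₁2, ← hX₃2] at h1
      nlinarith [mul_nonneg hX₁0 hX₃0, sq_nonneg X₁, sq_nonneg X₃]
    linarith
  have hTle : T ≤ 0.6125 * X₁ + 0.7072 * Y + 0.7283 * X₃ := by linarith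
  have hcn : c / n ≤ c / 3 := by gcongr
  have b1 : 0.6125 * X₁ ≤ c := by
    have : X₁ ^ 2 ≤ c ^ 2 := by
      rw [hX₁2]
      have : z' * c / n ≤ c / n := by gcongr; exact mul_le_of_le_one_left hc0.le hz'1
      linarith
    have := abs_le_of_sq_le_sq' this hc0.le
    linarith
  have b2 : 0.7072 * Y ≤ c := by
    linarith
  have b3 : 0.7283 * X₃ ≤ c := by
    have : X₃ ^ 2 ≤ c ^ 2 := by
      rw [hX₃2]
      have : c / n * Y ≤ c / 3 * 1.5 := by gcongr
      linarith
    have := abs_le_of_sq_le_sq' this hc0.le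
    linarith
  obtain ⟨a, b, d, ha, hb, hd, ha0, hb0, hd0, hsum⟩ := exists_add_add_eq (a := 0.6125 * X₁)
    (b := 0.7072 * Y) (d := 0.7283 * X₃) (by positivity) (by positivity) (by positivity) hT0 hTle
  have f1 := (fannes_mono ha0 ha b1).trans (fannes_le_first hz' hz'1 hn0 hc0 hnc)
  have f2 := (fannes_mono hb0 hb b2).trans (fannes_le_second hL hn0 hc hnc)
  have f3 := (fannes_mono hd0 hd b3).trans (fannes_le_third hL hn (by linarith))
  rw [hsum]
  have g1 := fannes_add_le hc0 (add_nonneg ha0 hb0) hd0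
  have g2 := fannes_add_le hc0 ha0 hb0
  unfold ucdLog
  linarith

end Deviation

/-! ### For `n c ≤ 100`, UCD is at least `log c` -/

section SmallSamples

/-- The logarithm may be negative for small samples. The bound `log x ≥ 1 - 1 / x` at `x = c / (6
X)`, with `X = √(z c / n)`, leaves a concave quadratic in `X`. -/
theorem first_term_ge {z c n : ℝ} (hz : 0 ≤ z) (hn : 0 < n) (hc : 0 < c) :
    6 * √(z * c / n) - 36 * √(z * c / n) ^ 2 / c
      ≤ 3 * √(z * c / n) * Real.log (n * c / (36 * z)) := by
  rcases hz.eq_or_lt with rfl | hz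
  · simp
  set X := √(z * c / n) with hX
  have hX0 : 0 < X := Real.sqrt_pos.2 (by positivity)
  have hX2 : X ^ 2 = z * c / n := Real.sq_sqrt (by positivity)
  have e : n * c / (36 * z) = (c / (6 * X)) ^ 2 := by
    rw [div_pow, mul_pow, hX2]; field_simp; norm_num
  have h := log_ge_one_sub_inv (x := c / (6 * X)) (by positivity)
  rw [e, Real.log_pow]
  have h2 := mul_le_mul_of_nonneg_left h (by positivity : 0 ≤ 6 * X)
  have e2 : 6 * X * (1 - 1 / (c / (6 * X))) = 6 * X - 36 * X ^ 2 / c := by field_simp; ring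
  push_cast
  linarith

/-- The parameters `y`, `k`, `s` are numerical lower bounds for `√(L / n)`, `√(√(L / n) / n)` and
`√c`. -/
theorem le_ucdLog_of_le {z c n L y k s : ℝ} (hz : 0 ≤ z) (hn : 3 ≤ n) (hc : 2 ≤ c)
    (_hy0 : 0 ≤ y) (_hk0 : 0 ≤ k) (hy : y ^ 2 * n ≤ L) (hk : k ^ 2 * n ≤ y) (_hs0 : 0 ≤ s)
    (hs : s ^ 2 ≤ c) :
    6 * √(z * c / n) - 36 * √(z * c / n) ^ 2 / c
      + 3 / 2 * y * (Real.log n + 2 * Real.log c - 2 * Real.log 3)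
      + 2 * (k * s) * (Real.log n + 2 / 3 * Real.log c) ≤ ucdLog z c L n := by
  have hn0 : 0 < n := by linarith
  have hc0 : 0 < c := by linarith
  have e2 : Real.log (n * c ^ 2 / 9) = Real.log n + 2 * Real.log c - 2 * Real.log 3 := by
    rw [Real.log_div (by positivity) (by norm_num), Real.log_mul (by positivity) (by positivity),
      Real.log_pow, show (9 : ℝ) = 3 ^ 2 by norm_num, Real.log_pow]
    norm_num
  have e3 : Real.log (n * c ^ (2 / 3 : ℝ)) = Real.log n + 2 / 3 * Real.log c := by
    rw [Real.log_mul (by positivity) (by positivity), Real.log_rpow hc0]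
  have n2 : 0 ≤ Real.log (n * c ^ 2 / 9) := Real.log_nonneg (by nlinarith)
  have n3 : 0 ≤ Real.log n + 2 / 3 * Real.log c := by
    have := Real.log_nonneg (by linarith : 1 ≤ n)
    have := Real.log_nonneg (by linarith : 1 ≤ c)
    positivity
  have hY : y ≤ √(L / n) := Real.le_sqrt_of_sq_le (by rwa [le_div_iff₀ hn0])
  have hK : k * s ≤ √(c / n * √(L / n)) := by
    refine Real.le_sqrt_of_sq_le ?_
    have h1 : k ^ 2 ≤ √(L / n) / n := by
      rw [le_div_iff₀ hn0]; linarith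
    calc (k * s) ^ 2 = k ^ 2 * s ^ 2 := by ring
      _ ≤ √(L / n) / n * c := by gcongr
      _ = _ := by ring
  have h1 := first_term_ge hz hn0 hc0
  unfold ucdLog
  rw [e3]
  rw [e2] at n2 ⊢
  have t2 : 3 / 2 * y * (Real.log n + 2 * Real.log c - 2 * Real.log 3)
      ≤ 3 / 2 * √(L / n) * (Real.log n + 2 * Real.log c - 2 * Real.log 3) := by gcongr
  have t3 : 2 * (k * s) * (Real.log n + 2 / 3 * Real.log c)
      ≤ 2 * √(c / n * √(L / n)) * (Real.log n + 2 / 3 * Real.log c) := by gcongr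
  linarith

/-- A concave function on `[0, R]` is smallest at an endpoint, and it vanishes at `0`. -/
theorem concave_term_ge {X R c : ℝ} (hX : 0 ≤ X) (hXR : X ≤ R) (hc : 0 < c) :
    min 0 (6 * R - 36 * R ^ 2 / c) ≤ 6 * X - 36 * X ^ 2 / c := by
  have e : ∀ x : ℝ, 6 * x - 36 * x ^ 2 / c = x * (6 - 36 * x / c) := fun x => by ring
  rw [e, e]
  rcases le_total 0 (6 - 36 * X / c) with h | h
  · exact (min_le_left _ _).trans (mul_nonneg hX h)
  · refine (min_le_right _ _).trans ?_
    have h1 : 36 * X / c ≤ 36 * R / c := by gcongr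
    nlinarith

theorem first_term_ge_neg {z c n : ℝ} (hz1 : z ≤ 1 - 1 / c) (hn : 3 ≤ n)
    (hc : 2 ≤ c) :
    -3.2 ≤ 6 * √(z * c / n) - 36 * √(z * c / n) ^ 2 / c := by
  have hc0 : 0 < c := by linarith
  have hn0 : 0 < n := by linarith
  have hR : √(z * c / n) ≤ √((c - 1) / 3) := by
    refine Real.sqrt_le_sqrt ?_
    have h1 : z * c ≤ c - 1 := by
      calc z * c ≤ (1 - 1 / c) * c := by gcongr
        _ = c - 1 := by field_simp
    have : 0 ≤ c - 1 := by linarith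
    gcongr
  refine le_trans (le_min (by norm_num) ?_) (concave_term_ge (Real.sqrt_nonneg _) hR hc0)
  set R := √((c - 1) / 3) with hRdef
  have hR2 : R ^ 2 = (c - 1) / 3 := Real.sq_sqrt (by linarith)
  have hR0 : 0 ≤ R := Real.sqrt_nonneg _
  have hce : c = 1 + 3 * R ^ 2 := by linarith
  -- Clearing the denominator leaves a cubic in `R`, positive on `R ≥ 0`, with its minimum near
  -- `0.847`.
  have : 36 * R ^ 2 / c ≤ 3.2 + 6 * R := by
    rw [div_le_iff₀ hc0, hce]
    nlinarith [mul_nonneg hR0 (sq_nonneg (R - 0.847)), sq_nonneg (R - 0.847)]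
  linarith

/-- From `n = 9` on the first summand is nonnegative, by `6 R ≤ 1 + 9 R²`; the other two then cover
`log c`. -/
theorem log_card_le_ucdLog_of_nine_le {z c n L : ℝ} (hz : 0 ≤ z) (hz1 : z ≤ 1 - 1 / c)
    (hn : 9 ≤ n) (hn50 : n ≤ 50) (hc : 2 ≤ c) (hL : 4.56 ≤ L) :
    Real.log c ≤ ucdLog z c L n := by
  have hc0 : 0 < c := by linarith
  have hn0 : 0 < n := by linarith
  have h := le_ucdLog_of_le (L := L) (y := 0.3) (k := 0.07) (s := 1.4) hz (by linarith : 3 ≤ n) hc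
    (by norm_num) (by norm_num) (by norm_num; linarith) (by norm_num; linarith) (by norm_num)
    (by norm_num; linarith)
  have hR : √(z * c / n) ≤ √((c - 1) / 9) := by
    refine Real.sqrt_le_sqrt ?_
    have h1 : z * c ≤ c - 1 := by
      calc z * c ≤ (1 - 1 / c) * c := by gcongr
        _ = c - 1 := by field_simp
    have : 0 ≤ c - 1 := by linarith
    gcongr
  have h1 : 0 ≤ 6 * √(z * c / n) - 36 * √(z * c / n) ^ 2 / c := by
    refine le_trans (le_min le_rfl ?_) (concave_term_ge (Real.sqrt_nonneg _) hR hc0)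
    set R := √((c - 1) / 9) with hRdef
    have hR2 : R ^ 2 = (c - 1) / 9 := Real.sq_sqrt (by linarith)
    have hR0 : 0 ≤ R := Real.sqrt_nonneg _
    have hce : c = 1 + 9 * R ^ 2 := by linarith
    have : 36 * R ^ 2 / c ≤ 6 * R := by
      rw [div_le_iff₀ hc0, hce]
      nlinarith [mul_nonneg hR0 (sq_nonneg (3 * R - 1))]
    linarith
  have hl2 : Real.log 2 ≤ Real.log c := Real.log_le_log (by norm_num) hc
  have hl9 : 2 * Real.log 3 ≤ Real.log n := by
    have := Real.log_le_log (by norm_num) hn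
    rw [show (9 : ℝ) = 3 ^ 2 by norm_num, Real.log_pow] at this
    norm_num at this ⊢
    exact this
  have := Real.log_three_gt_d9
  have := Real.log_two_gt_d9
  linarith

theorem first_term_ge_neg_two {z n : ℝ} (hz1 : z ≤ 1 / 2) (hn : 3 ≤ n) :
    -2.537 ≤ 6 * √(z * 2 / n) - 36 * √(z * 2 / n) ^ 2 / 2 := by
  have hn0 : 0 < n := by linarith
  have hR : √(z * 2 / n) ≤ 0.5774 := by
    rw [Real.sqrt_le_left (by norm_num), div_le_iff₀ hn0]
    nlinarith
  refine le_trans (le_min (by norm_num) ?_)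
    (concave_term_ge (Real.sqrt_nonneg _) hR (by norm_num : (0 : ℝ) < 2))
  norm_num

theorem log_seven_gt : 1.9355 < Real.log 7 := by
  have h : Real.log 48 ≤ Real.log (7 ^ 2) := Real.log_le_log (by norm_num) (by norm_num)
  rw [show (48 : ℝ) = 2 ^ 4 * 3 by norm_num, Real.log_mul (by norm_num) (by norm_num),
    Real.log_pow, Real.log_pow] at h
  push_cast at h
  linarith [Real.log_two_gt_d9, Real.log_three_gt_d9]

theorem log_card_le_ucdLog_of_le_eight {z L : ℝ} {c n : ℕ} (hz : 0 ≤ z)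
    (hz1 : z ≤ 1 - 1 / (c : ℝ)) (hn : 3 ≤ n) (hn8 : n ≤ 8) (hc : 2 ≤ c) (hL : 4.56 ≤ L) :
    Real.log c ≤ ucdLog z c L n := by
  -- For each `n`, the numbers `y`, `k`, `l` are rounded-down values of `√(4.56 / n)`, `√(y / n)`
  -- and `log n`. For `c ≥ 3` the coefficient `3 y ≥ 1` of `log c` makes `c = 3` the worst case; `c
  -- = 2` needs the sharper bound on the first summand.
  have key : ∀ y k l : ℝ, 0 ≤ y → 0 ≤ k → y ^ 2 * n ≤ 4.56 → k ^ 2 * n ≤ y → l ≤ Real.log n →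
      0 ≤ l →
      3.231 ≤ 3 / 2 * y * (l + 2 * 0.69314 - 2 * 1.09862) + 2 * (k * 1.414) * (l + 2 / 3 * 0.69314)
        → 3.2 + 1.0986 ≤ 3 / 2 * y * (l - 0.0001) + 2 * (k * 1.732) * (l + 2 / 3 * 1.0986)
        → 1 ≤ 3 * y →
      Real.log c ≤ ucdLog z c L n := by
    intro y k l hy0 hk0 hy hk hl hl0 h2 h3 hy1
    have hn3 : (3 : ℝ) ≤ n := by exact_mod_cast hn
    have := Real.log_two_gt_d9
    have := Real.log_two_lt_d9
    have := Real.log_three_gt_d9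
    have := Real.log_three_lt_d9
    rcases hc.eq_or_lt with rfl | hc3
    · have h := le_ucdLog_of_le (L := L) (c := 2) (s := 1.414) hz hn3 le_rfl hy0 hk0
        (by linarith) hk (by norm_num) (by norm_num)
      have h1 := first_term_ge_neg_two (z := z) (n := n) (by norm_num at hz1; linarith) hn3
      push_cast
      have e1 : 3 / 2 * y * (l + 2 * 0.69314 - 2 * 1.09862)
          ≤ 3 / 2 * y * (Real.log n + 2 * Real.log 2 - 2 * Real.log 3) := by gcongr <;> linarith
      have e2 : 2 * (k * 1.414) * (l + 2 / 3 * 0.69314)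
          ≤ 2 * (k * 1.414) * (Real.log n + 2 / 3 * Real.log 2) := by gcongr; linarith
      linarith
    · have hc3' : (3 : ℝ) ≤ c := by exact_mod_cast hc3
      have hlc : Real.log 3 ≤ Real.log c := Real.log_le_log (by norm_num) hc3'
      have h := le_ucdLog_of_le (L := L) (c := c) (s := 1.732) hz hn3 (by linarith) hy0 hk0
        (by linarith) hk (by norm_num) (by norm_num; linarith)
      have h1 := first_term_ge_neg (z := z) (n := n) hz1 hn3 (by linarith : (2 : ℝ) ≤ c)
      have e1 : 3 / 2 * y * (l - 0.0001) + (Real.log c - 1.0986)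
          ≤ 3 / 2 * y * (Real.log n + 2 * Real.log c - 2 * Real.log 3) := by
        have a1 : 3 / 2 * y * (l - 0.0001) ≤ 3 / 2 * y * (Real.log n - 0.0001) := by gcongr
        have a2 : 1 * (Real.log c - 1.0986) ≤ 3 * y * (Real.log c - 1.0986) := by
          gcongr; linarith
        have a3 : 0 ≤ 3 / 2 * y * (0.0001 + 2 * 1.0986 - 2 * Real.log 3) := by
          have : 0 ≤ 0.0001 + 2 * 1.0986 - 2 * Real.log 3 := by linarith
          positivity
        linarith
      have e2 : 2 * (k * 1.732) * (l + 2 / 3 * 1.0986)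
          ≤ 2 * (k * 1.732) * (Real.log n + 2 / 3 * Real.log c) := by gcongr; linarith
      linarith
  have l2 := Real.log_two_gt_d9
  have l3 := Real.log_three_gt_d9
  interval_cases n
  · exact key 1.232 0.640 1.0986 (by norm_num) (by norm_num) (by norm_num) (by norm_num)
      (by push_cast; linarith) (by norm_num) (by norm_num) (by norm_num) (by norm_num)
  · refine key 1.067 0.516 1.3862 (by norm_num) (by norm_num) (by norm_num) (by norm_num)
      ?_ (by norm_num) (by norm_num) (by norm_num) (by norm_num)
    push_cast
    rw [show (4 : ℝ) = 2 ^ 2 by norm_num, Real.log_pow]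
    push_cast; linarith
  · refine key 0.954 0.436 1.6094 (by norm_num) (by norm_num) (by norm_num) (by norm_num)
      ?_ (by norm_num) (by norm_num) (by norm_num) (by norm_num)
    push_cast
    linarith [Real.log_five_gt_d9]
  · refine key 0.871 0.380 1.7917 (by norm_num) (by norm_num) (by norm_num) (by norm_num)
      ?_ (by norm_num) (by norm_num) (by norm_num) (by norm_num)
    push_cast
    linarith [log_six_gt]
  · refine key 0.807 0.339 1.9355 (by norm_num) (by norm_num) (by norm_num) (by norm_num)
      ?_ (by norm_num) (by norm_num) (by norm_num) (by norm_num)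
    push_cast
    linarith [log_seven_gt]
  · refine key 0.754 0.306 2.079 (by norm_num) (by norm_num) (by norm_num) (by norm_num)
      ?_ (by norm_num) (by norm_num) (by norm_num) (by norm_num)
    push_cast
    rw [show (8 : ℝ) = 2 ^ 3 by norm_num, Real.log_pow]
    push_cast; linarith

theorem log_card_le_ucdLog {z L : ℝ} {c n : ℕ} (hz : 0 ≤ z) (hz1 : z ≤ 1 - 1 / (c : ℝ))
    (hn : 3 ≤ n) (hnc : n * c ≤ 100) (hc : 2 ≤ c) (hL : 4.56 ≤ L) :
    Real.log c ≤ ucdLog z c L n := by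
  rcases le_or_gt n 8 with h | h
  · exact log_card_le_ucdLog_of_le_eight hz hz1 hn h hc hL
  · have : n ≤ 50 := by nlinarith
    exact log_card_le_ucdLog_of_nine_le hz hz1 (by exact_mod_cast h) (by exact_mod_cast this)
      (by exact_mod_cast hc) hL

end SmallSamples

/-! ### The index of an arm bounds its entropy -/

section LowerConfidence

variable {Y : Type*} [Fintype Y] [DecidableEq Y]

/-- When the total variation distance and `ζ` do not deviate, the upper confidence bound is at
least the entropy. -/
theorem entropy_le_upper_confidence_bound (p : PMF Y) (l : List Y)
    (hc : 2 ≤ Fintype.card Y) (hn : 3 ≤ l.length) {L : ℝ} (hL : 4.56 ≤ L)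
    (hT : tvDist (probVec p) (empirical l)
      ≤ √(Fintype.card Y * zeta (probVec p) / l.length) / 2 + √(L / (2 * l.length)))
    (hz : (1 - 1 / (l.length : ℝ)) * zeta (probVec p) ≤ plugInZeta l + √(2 * L / l.length)) :
    entropy (probVec p)
      ≤ plugInEntropy l + ucdLog (plugInZeta l) (Fintype.card Y) L l.length := by
  have hl : l ≠ [] := by rintro rfl; simp at hn
  have : Nonempty Y := Fintype.card_pos_iff.1 (by omega)
  have hq := fun y => empirical_nonneg l y
  have hq1 := sum_empirical hl
  have hp := probVec_nonneg p
  have hp1 := sum_probVec p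
  have hz0 : 0 ≤ plugInZeta l := zeta_nonneg hq hq1
  have hz1 : plugInZeta l ≤ 1 - 1 / (Fintype.card Y : ℝ) := zeta_le hq1
  rcases le_total 100 (l.length * Fintype.card Y) with h | h
  · have h1 := entropy_le_add_tvDist hp hp1 hq hq1
    have hcpos : 0 ≤ 1 / (Fintype.card Y : ℝ) := by positivity
    have h2 := fannes_le_ucdLog hz0 (by linarith)
      ((zeta_le hp1).trans (by linarith)) (by exact_mod_cast hc : (2 : ℝ) ≤ Fintype.card Y)
      (by exact_mod_cast hn : (3 : ℝ) ≤ l.length) (by exact_mod_cast h)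
      (by linarith : 1 ≤ L) (tvDist_nonneg _ _) (tvDist_le_one hp hp1 hq hq1) hT hz
    unfold fannes at h2
    unfold plugInEntropy
    linarith
  · have h1 := entropy_le_log_card hp hp1
    have h2 := log_card_le_ucdLog hz0 hz1 hn h hc hL
    have h3 : 0 ≤ plugInEntropy l := entropy_nonneg hq fun y => by
      rw [← hq1]; exact Finset.single_le_sum (fun a _ => hq a) (Finset.mem_univ y)
    linarith

end LowerConfidence

/-! ### Inverting the entries of `Γ` -/

section Threshold

/-- Bootstrapping `n ≥ 30 (2 log n + log 2)`: every lower bound for `n` improves `log n` and hence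
`n`, until `370` is reached. -/
theorem le_of_thirty_mul_le {n A : ℝ} (hn : 1 ≤ n) (hA : 2 * Real.log n ≤ A)
    (h : 30 * (A + Real.log 2) ≤ n) : 370 ≤ n ∧ 11.7 ≤ A := by
  have l2 := Real.log_two_gt_d9
  have l3 := Real.log_three_gt_d9
  have l5 := Real.log_five_gt_d9
  have h0 := Real.log_nonneg hn
  have h20 : 16 ≤ n := by linarith
  have h1 := Real.log_le_log (by norm_num) h20
  rw [show (16 : ℝ) = 2 ^ 4 by norm_num, Real.log_pow] at h1
  push_cast at h1
  have h2 : 125 ≤ n := by linarith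
  have h3 := Real.log_le_log (by norm_num) h2
  rw [show (125 : ℝ) = 5 ^ 3 by norm_num, Real.log_pow] at h3
  push_cast at h3
  have h4 : 256 ≤ n := by linarith
  have h5 := Real.log_le_log (by norm_num) h4
  rw [show (256 : ℝ) = 2 ^ 8 by norm_num, Real.log_pow] at h5
  push_cast at h5
  have h6 : 324 ≤ n := by linarith
  have h7 := Real.log_le_log (by norm_num) h6
  rw [show (324 : ℝ) = 2 ^ 2 * 3 ^ 4 by norm_num, Real.log_mul (by norm_num) (by norm_num),
    Real.log_pow, Real.log_pow] at h7
  push_cast at h7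
  have h8 : 360 ≤ n := by linarith
  have h9 := Real.log_le_log (by norm_num) h8
  rw [show (360 : ℝ) = 2 ^ 3 * 3 ^ 2 * 5 by norm_num, Real.log_mul (by norm_num) (by norm_num),
    Real.log_mul (by norm_num) (by norm_num), Real.log_pow, Real.log_pow] at h9
  push_cast at h9
  constructor <;> linarith

theorem le_rpow_three_quarters {a x : ℝ} (hx : 0 ≤ x) (h : a ^ 4 ≤ x ^ 3) :
    a ≤ x ^ (3 / 4 : ℝ) := by
  refine le_of_pow_le_pow_left₀ (n := 4) (by norm_num) (by positivity) ?_
  rw [← Real.rpow_natCast (x ^ (3 / 4 : ℝ)), ← Real.rpow_mul hx]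
  norm_num
  exact h

/-- The argument of `Lam43` is `r ^ (4 / 3)`, so the power `3 / 4` linearizes the condition; `3.039
≤ (4 / 3) · 3 ^ (3 / 4)`. -/
theorem lam43_threshold {c n A Δ : ℝ} (hc : 0 < c) (hA : 0 < A) (hΔ : 0 < Δ)
    {r : ℝ} (hr : r = (27 : ℝ) ^ (3 / 4 : ℝ) * (c * A ^ (1 / 4 : ℝ) / Δ))
    (h : 3 / c ^ (2 / 3 : ℝ) * Lam43 (27 * c ^ (4 / 3 : ℝ) * A ^ (1 / 3 : ℝ) / Δ ^ (4 / 3 : ℝ))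
      ≤ n) :
    3.039 * r * |Real.log r| ≤ n ^ (3 / 4 : ℝ) * c ^ (1 / 2 : ℝ) := by
  have hr0 : 0 < r := by rw [hr]; positivity
  have e : 27 * c ^ (4 / 3 : ℝ) * A ^ (1 / 3 : ℝ) / Δ ^ (4 / 3 : ℝ) = r ^ (4 / 3 : ℝ) := by
    rw [hr, Real.mul_rpow (by positivity) (by positivity), Real.div_rpow (by positivity) hΔ.le,
      Real.mul_rpow hc.le (by positivity), ← Real.rpow_mul (by norm_num), ← Real.rpow_mul hA.le]
    norm_num
    ring
  rw [e] at h
  unfold Lam43 fourThirdsPow at h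
  rw [Real.log_rpow hr0, abs_mul, abs_of_pos (by norm_num : (0 : ℝ) < 4 / 3)] at h
  have h2 := Real.rpow_le_rpow (by positivity) h (by norm_num : (0 : ℝ) ≤ 3 / 4)
  rw [Real.mul_rpow (by positivity) (by positivity), Real.mul_rpow (by positivity) (by positivity),
    ← Real.rpow_mul hr0.le, ← Real.rpow_mul (by positivity), Real.div_rpow (by norm_num)
    (by positivity), ← Real.rpow_mul hc.le] at h2
  norm_num at h2
  have h3 : (2.2795 : ℝ) ≤ 3 ^ (3 / 4 : ℝ) :=
    le_rpow_three_quarters (by norm_num) (by norm_num)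
  have hch : 0 < c ^ (1 / 2 : ℝ) := by positivity
  rw [div_mul_eq_mul_div, div_le_iff₀ hch] at h2
  refine le_trans ?_ h2
  have : 0 ≤ r * |Real.log r| := by positivity
  nlinarith

theorem lam1_threshold {c n A : ℝ} (hc : 0 < c) (hA : 0 < A) {l : ℝ}
    (h : 36230 * (A ^ (1 / 3 : ℝ) / c ^ (2 / 3 : ℝ)) * fourThirdsPow l ≤ n) :
    2620 * A ^ (1 / 4 : ℝ) * |l| ≤ n ^ (3 / 4 : ℝ) * c ^ (1 / 2 : ℝ) ∧
      36230 ^ 3 * A * l ^ 4 ≤ n ^ 3 * c ^ 2 := by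
  unfold fourThirdsPow at h
  constructor
  · have h2 := Real.rpow_le_rpow (by positivity) h (by norm_num : (0 : ℝ) ≤ 3 / 4)
    rw [Real.mul_rpow (by positivity) (by positivity), Real.mul_rpow (by norm_num) (by positivity),
      Real.div_rpow (by positivity) (by positivity), ← Real.rpow_mul hA.le, ← Real.rpow_mul hc.le,
      ← Real.rpow_mul (abs_nonneg l)] at h2
    have h3 : (2620 : ℝ) ≤ 36230 ^ (3 / 4 : ℝ) :=
      le_rpow_three_quarters (by norm_num) (by norm_num)
    norm_num at h2
    have hch : 0 < c ^ (1 / 2 : ℝ) := by positivity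
    have e : (36230 : ℝ) ^ (3 / 4 : ℝ) * (A ^ (1 / 4 : ℝ) / c ^ (1 / 2 : ℝ)) * |l|
        = 36230 ^ (3 / 4 : ℝ) * (A ^ (1 / 4 : ℝ) * |l|) / c ^ (1 / 2 : ℝ) := by ring
    rw [e, div_le_iff₀ hch] at h2
    refine le_trans ?_ h2
    rw [mul_assoc]
    gcongr
  · have h2 := pow_le_pow_left₀ (by positivity) h 3
    rw [mul_pow, mul_pow, div_pow, ← Real.rpow_natCast (A ^ (1 / 3 : ℝ)),
      ← Real.rpow_natCast (c ^ (2 / 3 : ℝ)), ← Real.rpow_natCast (|l| ^ (4 / 3 : ℝ)),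
      ← Real.rpow_mul hA.le, ← Real.rpow_mul hc.le, ← Real.rpow_mul (abs_nonneg l)] at h2
    norm_num at h2
    rw [show |l| ^ 4 = l ^ 4 from Even.pow_abs (by decide) l] at h2
    have e : 47555965367000 * (A / c ^ 2) * l ^ 4 = 47555965367000 * A * l ^ 4 / c ^ 2 := by ring
    rw [e, div_le_iff₀ (by positivity)] at h2
    norm_num
    exact h2

/-- The quotient `log u / u` decreases once `log u ≥ 1`, so it may be evaluated at the threshold. -/
theorem log_mul_le_mul_log {v u : ℝ} (hv0 : 0 < v) (hv : 1 ≤ Real.log v) (hvu : v ≤ u) :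
    Real.log u * v ≤ u * Real.log v := by
  have h := log_le_div_add (hv0.trans_le hvu) hv0
  have h2 : 1 ≤ u / v := (one_le_div hv0).2 hvu
  have h3 : u / v * v = u := by field_simp
  have h4 : Real.log u ≤ u / v * Real.log v := by nlinarith
  calc Real.log u * v ≤ u / v * Real.log v * v := by gcongr
    _ = u * Real.log v := by rw [mul_right_comm, h3]

theorem log_le_mul_sub {x a : ℝ} (hx : 0 < x) (ha : 0 < a) :
    Real.log x ≤ a * x - Real.log a - 1 := by
  have h := log_le_div_add hx (inv_pos.2 ha)
  rw [Real.log_inv, div_inv_eq_mul] at h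
  linarith

theorem log_le_mul_of_ge {u : ℝ} (hu : 6.4 ≤ u) : Real.log u ≤ 0.2902 * u := by
  have h := log_le_mul_sub (x := u) (a := 0.15625) (by linarith) (by norm_num)
  have e : Real.log 0.15625 = Real.log 5 - 5 * Real.log 2 := by
    rw [show (0.15625 : ℝ) = 5 / 2 ^ 5 by norm_num, Real.log_div (by norm_num) (by norm_num),
      Real.log_pow]
    norm_num
  have := Real.log_two_lt_d9
  have := Real.log_five_gt_d9
  rw [e] at h
  linarith

/-- Evaluates `log u / u` at `u = 7.745 q y`; the constant `2.0472` bounds `log 7.745`. -/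
theorem mul_log_le_of_threshold {q u y κ : ℝ} (hq : 0 < q) (hy : y = Real.log q) (hy1 : 1 ≤ y)
    (hu : 7.745 * q * y ≤ u) (hκ : 2.0472 + y + Real.log y ≤ 7.745 * y * κ) :
    q * Real.log u ≤ κ * u := by
  have hy0 : 0 < y := by linarith
  have e : Real.log (7.745 * q * y) = Real.log 7.745 + y + Real.log y := by
    rw [Real.log_mul (by positivity) (by positivity), Real.log_mul (by norm_num) (by positivity),
      ← hy]
  have h1 : Real.log 7.745 ≤ 2.0472 := by
    have h := Real.log_le_log (by norm_num) (by norm_num : (7.745 : ℝ) ^ 2 ≤ 2 ^ 2 * 3 * 5)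
    rw [Real.log_pow, Real.log_mul (by norm_num) (by norm_num),
      Real.log_mul (by norm_num) (by norm_num), Real.log_pow] at h
    push_cast at h
    linarith [Real.log_two_lt_d9, Real.log_three_lt_d9, Real.log_five_lt_d9]
  have h0 : 0 ≤ Real.log 7.745 := Real.log_nonneg (by norm_num)
  have h2 := log_mul_le_mul_log (by positivity)
    (by rw [e]; linarith [Real.log_nonneg hy1]) hu
  have hu0 : 0 ≤ u := le_trans (by positivity) hu
  have h3 : Real.log u * (7.745 * q * y) ≤ u * (7.745 * y * κ) :=
    h2.trans (by gcongr; rw [e]; linarith)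
  have h4 : (q * Real.log u) * (7.745 * y) ≤ (κ * u) * (7.745 * y) := by linarith
  exact le_of_mul_le_mul_right h4 (by positivity)

/-- For `r ≤ 10` the floor `v ≥ 84` suffices. Beyond, the tangent of `log` at `3.039 r log r`
reduces the claim to an inequality in `log r`. -/
theorem third_term_log_le {r v : ℝ} (hr : 0 < r) (hv : 84 ≤ v)
    (h : 3.039 * r * |Real.log r| ≤ v) : r * (9.803 * Real.log v - 18.4) ≤ 3.85 * v := by
  have l2 := Real.log_two_gt_d9
  have l2' := Real.log_two_lt_d9
  have l3 := Real.log_three_lt_d9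
  have l3' := Real.log_three_gt_d9
  have l5 := Real.log_five_lt_d9
  have l5' := Real.log_five_gt_d9
  rcases le_total r 10 with h10 | h10
  · have h1 := log_le_div_add (x := v) (b := 84) (by linarith) (by norm_num)
    have h2 : Real.log 84 ≤ 4.5 := by
      have := Real.log_le_log (by norm_num) (by norm_num : (84 : ℝ) ≤ 2 * 3 ^ 2 * 5)
      rw [Real.log_mul (by norm_num) (by norm_num), Real.log_mul (by norm_num) (by norm_num),
        Real.log_pow] at this
      push_cast at this
      linarith
    have h3 : 9.803 * Real.log v - 18.4 ≤ 0.32 * v := by linarith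
    calc r * (9.803 * Real.log v - 18.4) ≤ r * (0.32 * v) := by gcongr
      _ ≤ 10 * (0.32 * v) := by gcongr
      _ ≤ 3.85 * v := by linarith
  · set y := Real.log r with hy
    have hy2 : 2.3 ≤ y := by
      have := Real.log_le_log (by norm_num) h10
      rw [Real.log_ten_eq] at this
      linarith
    have hy0 : 0 < y := by linarith
    rw [abs_of_pos hy0] at h
    have e : Real.log (3.039 * r * y) = Real.log 3.039 + y + Real.log y := by
      rw [Real.log_mul (by positivity) (by positivity), Real.log_mul (by norm_num) hr.ne', ← hy]
    have e1 : Real.log 3.039 ≤ 1.112 := by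
      have := log_le_div_add (x := 3.039) (b := 3) (by norm_num) (by norm_num)
      norm_num at this ⊢
      linarith
    have e0 : 1 ≤ Real.log 3.039 := by
      have := Real.log_le_log (by norm_num) (by norm_num : (3 : ℝ) ≤ 3.039)
      linarith
    have hly := Real.log_nonneg (by linarith : 1 ≤ y)
    set v₁ := 3.039 * r * y with hv₁
    have hv₁0 : 0 < v₁ := by positivity
    have h2 := mul_le_mul_of_nonneg_right (log_le_div_add (x := v) (by linarith) hv₁0) hv₁0.le
    have e2 : (v / v₁ + Real.log v₁ - 1) * v₁ = v + (Real.log v₁ - 1) * v₁ := by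
      field_simp
      ring
    have h3 := log_le_mul_sub (x := y) (a := 0.1875) hy0 (by norm_num)
    have h4 : -1.675 ≤ Real.log 0.1875 := by
      rw [show (0.1875 : ℝ) = 3 / 2 ^ 4 by norm_num,
        Real.log_div (by norm_num) (by norm_num), Real.log_pow]
      push_cast
      linarith
    have hv0 : 0 < v := by linarith
    rw [e2] at h2
    have h5 : (r * (9.803 * Real.log v - 18.4)) * (3.039 * y) ≤ (3.85 * v) * (3.039 * y) := by
      have a1 : (9.803 * (Real.log v₁ - 1) - 18.4) * v₁ ≤ (9.803 * (Real.log v₁ - 1) - 18.4) * v := by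
        gcongr
        rw [e]; linarith
      have a2 : (9.803 * Real.log v₁ - 18.4) * v ≤ (3.85 * 3.039 * y) * v := by
        gcongr
        rw [e]; linarith
      have a3 : (r * (9.803 * Real.log v - 18.4)) * (3.039 * y)
          = 9.803 * (Real.log v * v₁) - 18.4 * v₁ := by rw [hv₁]; ring
      rw [a3]
      linarith
    exact le_of_mul_le_mul_right h5 (by positivity)

end Threshold

/-! ### Numerical cases for the normalized deviation -/

section ThresholdCases

/-- Since `s² ≤ 7.39²`, the hypothesis forces `s ≤ 0.058 w`. Its constant is just below `0.206 · 292
^ 4`. -/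
theorem mul_log_le_of_mid {s w : ℝ} (hs : 0 < s) (hs2 : s ≤ 7.39) (hw : 0 < w)
    (h : 1.49e9 * s ^ 4 ≤ w ^ 6) : s * Real.log w ≤ 0.2832 * w := by
  have h1 : s ≤ 0.058 * w := by
    by_contra hlt
    rw [not_le] at hlt
    have h2 := pow_lt_pow_left₀ hlt (by positivity) (by norm_num : (6 : ℕ) ≠ 0)
    rw [mul_pow] at h2
    have h3 : s ^ 2 ≤ 7.39 ^ 2 := by gcongr
    have h4 : s ^ 6 ≤ 7.39 ^ 2 * s ^ 4 := by
      calc s ^ 6 = s ^ 2 * s ^ 4 := by ring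
        _ ≤ _ := by gcongr
    have h5 : 0 < s ^ 4 := by positivity
    norm_num at h h2 h4
    linarith
  have h2 := log_le_mul_sub (x := w) (a := 0.01) hw (by norm_num)
  have h3 : -4.6052 ≤ Real.log 0.01 := by
    rw [show (0.01 : ℝ) = 1 / 10 ^ 2 by norm_num, Real.log_div (by norm_num) (by norm_num),
      Real.log_pow, Real.log_ten_eq]
    push_cast
    linarith [Real.log_two_lt_d9, Real.log_five_lt_d9, Real.log_one]
  calc s * Real.log w ≤ s * (0.01 * w + 3.6052) := by gcongr; linarith
    _ = (s * 0.01) * w + 3.6052 * s := by ring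
    _ ≤ (7.39 * 0.01) * w + 3.6052 * (0.058 * w) := by gcongr
    _ ≤ 0.2832 * w := by linarith

/-- The bound `s x ≤ 2981 · 8`, with `2981 ≥ exp 8`, supplies the two powers of `s x` missing
between the sixth and the eighth; the tangent of `log` is taken at `8 s`. -/
theorem mul_log_le_of_log_le_eight {s w x A : ℝ} (hs : 0 < s) (hx : x = Real.log s) (hx2 : 2 ≤ x)
    (hx8 : x ≤ 8) (hw : 0 < w) (hA : 11.7 ≤ A) (h : 3.09e11 * A ^ 2 * (s ^ 6 * x ^ 6) ≤ w ^ 8) :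
    s * Real.log w ≤ 0.51 * w := by
  have hx0 : 0 < x := by linarith
  have hs8 : s ≤ 2981 := by
    have : s = Real.exp x := by rw [hx, Real.exp_log hs]
    have h8 : Real.exp 8 ≤ 2981 := by
      have e : Real.exp 8 = Real.exp 1 ^ 8 := by rw [← Real.exp_nat_mul]; norm_num
      rw [e]
      calc Real.exp 1 ^ 8 ≤ 2.7182818286 ^ 8 := by
            gcongr
            exact Real.exp_one_lt_d9.le
        _ ≤ 2981 := by norm_num
    rw [this]
    exact (Real.exp_le_exp.2 hx8).trans h8
  have h1 : s * (x + 1.08) ≤ 0.385 * w := by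
    by_contra hlt
    rw [not_le] at hlt
    have hle : s * (x + 1.08) ≤ s * (1.54 * x) := by gcongr; linarith
    have h2 := pow_lt_pow_left₀ (hlt.trans_le hle) (by positivity) (by norm_num : (8 : ℕ) ≠ 0)
    have e : (s * (1.54 * x)) ^ 8 = 1.54 ^ 8 * (s ^ 2 * x ^ 2) * (s ^ 6 * x ^ 6) := by ring
    have hP : 0 < s ^ 6 * x ^ 6 := by positivity
    have h3 : s ^ 2 * x ^ 2 ≤ 2981 ^ 2 * 8 ^ 2 := by gcongr
    have h4 : (11.7 : ℝ) ^ 2 ≤ A ^ 2 := by gcongr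
    have h5 : 1.54 ^ 8 * (s ^ 2 * x ^ 2) * (s ^ 6 * x ^ 6)
        ≤ 1.54 ^ 8 * (2981 ^ 2 * 8 ^ 2) * (s ^ 6 * x ^ 6) := by gcongr
    have h6 : 3.09e11 * 11.7 ^ 2 * (s ^ 6 * x ^ 6) ≤ 3.09e11 * A ^ 2 * (s ^ 6 * x ^ 6) := by gcongr
    rw [e, mul_pow] at h2
    set P := s ^ 6 * x ^ 6
    set W := w ^ 8
    have h7 : 0.385 ^ 8 * W < 1.54 ^ 8 * (2981 ^ 2 * 8 ^ 2) * P := h2.trans_le h5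
    have h8 : 3.09e11 * 11.7 ^ 2 * P ≤ W := h6.trans h
    norm_num at h7 h8
    linarith
  have h2 := log_le_mul_sub (x := w) (a := 1 / (8 * s)) hw (by positivity)
  have h3 : Real.log (1 / (8 * s)) = -(3 * Real.log 2 + x) := by
    rw [one_div, Real.log_inv, Real.log_mul (by norm_num) hs.ne', hx,
      show (8 : ℝ) = 2 ^ 3 by norm_num, Real.log_pow]
    push_cast; ring
  rw [h3] at h2
  have := Real.log_two_lt_d9
  calc s * Real.log w ≤ s * (1 / (8 * s) * w + (x + 1.08)) := by gcongr; linarith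
    _ = 0.125 * w + s * (x + 1.08) := by field_simp; ring
    _ ≤ 0.51 * w := by linarith

theorem mul_log_le_of_eight_le_log {s w x : ℝ} (hs : 0 < s) (hx : x = Real.log s) (hx8 : 8 ≤ x)
    (hw : 0 < w) (h : 8 * (s * x) ^ 2 ≤ w ^ 2) : s * Real.log w ≤ 0.51 * w := by
  have hx0 : 0 < x := by linarith
  have h1 : 2.828 * s * x ≤ w := by
    refine le_of_pow_le_pow_left₀ (n := 2) (by norm_num) hw.le ?_
    refine le_trans ?_ h
    have : 0 ≤ (s * x) ^ 2 := by positivity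
    nlinarith
  have e : Real.log (2.828 * s * x) = Real.log 2.828 + x + Real.log x := by
    rw [Real.log_mul (by positivity) hx0.ne', Real.log_mul (by norm_num) hs.ne', ← hx]
  have h2 : Real.log 2.828 ≤ 1.04 := by
    have h := Real.log_le_log (by norm_num) (by norm_num : (2.828 : ℝ) ^ 2 ≤ 2 ^ 3)
    rw [Real.log_pow, Real.log_pow] at h
    push_cast at h
    linarith [Real.log_two_lt_d9]
  have h2' : 0 ≤ Real.log 2.828 := Real.log_nonneg (by norm_num)
  have h3 := log_le_mul_sub (x := x) (a := 0.125) hx0 (by norm_num)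
  have h4 : Real.log 0.125 = -(3 * Real.log 2) := by
    rw [show (0.125 : ℝ) = (2 ^ 3)⁻¹ by norm_num, Real.log_inv, Real.log_pow]
    norm_num
  have := Real.log_two_lt_d9
  have h5 := log_mul_le_mul_log (by positivity)
    (by rw [e]; linarith [Real.log_nonneg (by linarith : 1 ≤ x)]) h1
  have h6 : (s * Real.log w) * (2.828 * x) ≤ (0.51 * w) * (2.828 * x) := by
    calc (s * Real.log w) * (2.828 * x) = Real.log w * (2.828 * s * x) := by ring
      _ ≤ w * Real.log (2.828 * s * x) := h5
      _ ≤ w * (0.51 * 2.828 * x) := by gcongr; rw [e]; linarith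
      _ = _ := by ring
  exact le_of_mul_le_mul_right h6 (by positivity)

theorem mul_log_le_of_cube_le {s w : ℝ} (hs : 7.38 ≤ s) (hw : s ^ 3 ≤ w) :
    s * Real.log w ≤ 0.12 * w := by
  have hs0 : 0 < s := by linarith
  have h1 := log_le_mul_sub (x := s) (a := 0.125) hs0 (by norm_num)
  have h4 : Real.log 0.125 = -(3 * Real.log 2) := by
    rw [show (0.125 : ℝ) = (2 ^ 3)⁻¹ by norm_num, Real.log_inv, Real.log_pow]
    norm_num
  have := Real.log_two_lt_d9
  have := Real.log_two_gt_d9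
  have hs4 := Real.log_le_log (by norm_num) (by linarith : (4 : ℝ) ≤ s)
  rw [show (4 : ℝ) = 2 ^ 2 by norm_num, Real.log_pow] at hs4
  push_cast at hs4
  have e : Real.log (s ^ 3) = 3 * Real.log s := by rw [Real.log_pow]; norm_num
  have h5 := log_mul_le_mul_log (by positivity) (by rw [e]; linarith) hw
  have hw0 : 0 < w := lt_of_lt_of_le (by positivity) hw
  have h7 : 3 * Real.log s ≤ 0.12 * s ^ 2 := by nlinarith
  have h6 : (s * Real.log w) * s ^ 2 ≤ (0.12 * w) * s ^ 2 := by
    calc (s * Real.log w) * s ^ 2 = Real.log w * s ^ 3 := by ring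
      _ ≤ w * Real.log (s ^ 3) := h5
      _ ≤ w * (0.12 * s ^ 2) := by rw [e]; gcongr
      _ = _ := by ring
  exact le_of_mul_le_mul_right h6 (by positivity)

/-- At the threshold `2620 a s x` the logarithm is at most `8.5 x`, because `log A ≤ 12 x`. -/
theorem third_part_le {s A v x a k₃ : ℝ} (hx : x = Real.log s) (hx2 : 2 < x)
    (ha : 0 < a) (haA : a ^ 4 = A) (hv0 : 0 < v) (hs : 0 < s) (hAx : Real.log A ≤ 12 * x)
    (hva : 2620 * a * |s * x| ≤ v) (hk₃' : k₃ * v ≤ 14.97 * (s * a) * Real.log v)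
    (hA : 0 ≤ Real.log A) : k₃ ≤ 0.06 := by
  have l2 := Real.log_two_gt_d9
  have l2' := Real.log_two_lt_d9
  have l3' := Real.log_three_lt_d9
  have l5' := Real.log_five_lt_d9
  have hx0 : 0 < x := by linarith
  rw [abs_of_pos (by positivity)] at hva
  have hla : Real.log a = Real.log A / 4 := by
    rw [← haA, Real.log_pow]; push_cast; ring
  have hlv : Real.log (2620 * a * (s * x)) = Real.log 2620 + Real.log A / 4 + x + Real.log x := by
    rw [Real.log_mul (by positivity) (by positivity), Real.log_mul (by norm_num) ha.ne',
      Real.log_mul hs.ne' hx0.ne', ← hx, hla]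
    ring
  have h2620 : Real.log 2620 ≤ 7.91 := by
    have := Real.log_le_log (by norm_num) (by norm_num : (2620 : ℝ) ≤ 2 * 3 ^ 3 * 5 ^ 2 * 2)
    rw [Real.log_mul (by norm_num) (by norm_num), Real.log_mul (by norm_num) (by norm_num),
      Real.log_mul (by norm_num) (by norm_num), Real.log_pow, Real.log_pow] at this
    push_cast at this
    linarith
  have h2620' : 0 ≤ Real.log 2620 := Real.log_nonneg (by norm_num)
  have hlx := log_le_mul_sub (x := x) (a := 0.5) hx0 (by norm_num)
  have hlh : Real.log 0.5 = - Real.log 2 := by rw [← Real.log_inv]; norm_num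
  have hlx0 := Real.log_nonneg (by linarith : 1 ≤ x)
  have h5 := log_mul_le_mul_log (by positivity) (by rw [hlv]; linarith) hva
  rw [hlv] at h5
  have h6 : Real.log 2620 + Real.log A / 4 + x + Real.log x ≤ 8.5 * x := by linarith
  have h7 : k₃ * v * (2620 * x) ≤ 0.06 * v * (2620 * x) := by
    calc k₃ * v * (2620 * x) ≤ 14.97 * (s * a) * Real.log v * (2620 * x) := by gcongr
      _ = 14.97 * (Real.log v * (2620 * a * (s * x))) := by ring
      _ ≤ 14.97 * (v * (8.5 * x)) := mul_le_mul_of_nonneg_left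
          (h5.trans (mul_le_mul_of_nonneg_left h6 hv0.le)) (by norm_num)
      _ = 14.97 * 8.5 * (v * x) := by ring
      _ ≤ 0.06 * 2620 * (v * x) :=
        mul_le_mul_of_nonneg_right (by norm_num) (mul_pos hv0 hx0).le
      _ = 0.06 * v * (2620 * x) := by ring
  exact le_of_mul_le_mul_right (le_of_mul_le_mul_right h7 (by positivity)) hv0

/-- The case distinction behind the choice of the threshold: `k₁`, `k₂`, `k₃` are the three parts
of the confidence deviation relative to the gap. -/
theorem normalized_deviation_lt_one {s A q u v w a k₁ k₂ k₃ : ℝ} (hs : 0 < s) (hA : 11.7 ≤ A)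
    (ha : 0 < a) (haA : a ^ 4 = A) (hq : q = 4.5 * s * √A) (hu : 6.4 ≤ u)
    (huq : 7.745 * q * |Real.log q| ≤ u) (hv : 84 ≤ v)
    (hva : 2620 * a * |s * Real.log s| ≤ v)
    (hk₁ : k₁ = 0 ∨ 6.4 ≤ w ∧ k₁ * w = s * Real.log w ∧ 0.206 * u ^ 4 ≤ w ^ 6 ∧
      (1 ≤ s → 3.09e11 * A ^ 2 * (s * Real.log s) ^ 6 ≤ w ^ 8) ∧ 8 * (s * Real.log s) ^ 2 ≤ w ^ 2)
    (hk₂ : k₂ * u = q * Real.log u) (hk₃ : k₃ ≤ 0.331)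
    (hk₃' : k₃ * v ≤ 14.97 * (s * a) * Real.log v) :
    1.5 * k₁ + 0.687 * k₂ + k₃ < 1 := by
  have l2 := Real.log_two_gt_d9
  have l2' := Real.log_two_lt_d9
  have l3 := Real.log_three_gt_d9
  have l3' := Real.log_three_lt_d9
  have l5 := Real.log_five_gt_d9
  have l5' := Real.log_five_lt_d9
  have hA0 : 0 < A := by linarith
  have hu0 : 0 < u := by linarith
  have hv0 : 0 < v := by linarith
  have hsA : 3.42 ≤ √A := Real.le_sqrt_of_sq_le (by norm_num; linarith)
  have hq0 : 0 < q := by rw [hq]; positivity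
  have hk2le : ∀ κ, q * Real.log u ≤ κ * u → k₂ ≤ κ := fun κ h =>
    le_of_mul_le_mul_right (by rw [hk₂]; exact h) hu0
  have hk1le : ∀ κ, 0 ≤ κ → (∀ w, 6.4 ≤ w → 0.206 * u ^ 4 ≤ w ^ 6 →
      (1 ≤ s → 3.09e11 * A ^ 2 * (s * Real.log s) ^ 6 ≤ w ^ 8) → 8 * (s * Real.log s) ^ 2 ≤ w ^ 2 →
      s * Real.log w ≤ κ * w) → k₁ ≤ κ := by
    intro κ hκ h
    rcases hk₁ with h0 | ⟨h1, h2, h3, h4, h5⟩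
    · rw [h0]; exact hκ
    · exact le_of_mul_le_mul_right (by rw [h2]; exact h w h1 h3 h4 h5) (by linarith : 0 < w)
  have hk1s : k₁ ≤ 0.2902 * s := hk1le _ (by positivity) fun w h1 _ _ _ => by
    have := mul_le_mul_of_nonneg_left (log_le_mul_of_ge h1) hs.le
    linarith
  have hlq : Real.log q = Real.log 4.5 + Real.log s + Real.log A / 2 := by
    rw [hq, Real.log_mul (by positivity) (by positivity), Real.log_mul (by norm_num) hs.ne',
      Real.log_sqrt hA0.le]
  have h45 : 1.504 ≤ Real.log 4.5 := by
    rw [show (4.5 : ℝ) = 3 ^ 2 / 2 by norm_num, Real.log_div (by norm_num) (by norm_num),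
      Real.log_pow]
    push_cast; linarith
  have hlA : 2.42 ≤ Real.log A := by
    have := Real.log_le_log (by norm_num) (by linarith : 3 ^ 2 * 5 / 2 ^ 2 ≤ A)
    rw [Real.log_div (by norm_num) (by norm_num), Real.log_mul (by norm_num) (by norm_num),
      Real.log_pow, Real.log_pow] at this
    push_cast at this
    linarith
  -- The available bounds do not peak together: as `s` grows, that for `k₂` falls while that for
  -- `k₁` rises. For `log s > 2` the split is on `A`: if `log A ≤ 12 log s` then `k₃` is tiny, and
  -- otherwise `A ≥ s ^ 12` forces `w ≥ s ^ 3` and `k₁` is small.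
  rcases le_or_gt (Real.log q) 1 with hq1 | hq1
  · have hqe : q ≤ 2.7183 := by
      have := (Real.log_le_iff_le_exp hq0).1 hq1
      linarith [Real.exp_one_lt_d9]
    have hs1 : s ≤ 0.177 := by
      rw [hq] at hqe
      nlinarith
    have h2 : k₂ ≤ 0.7889 := hk2le _ (by
      have h := mul_le_mul_of_nonneg_left (log_le_mul_of_ge hu) hq0.le
      nlinarith)
    linarith
  rw [abs_of_pos (by linarith)] at huq
  have hy0 : 0 < Real.log q := by linarith
  rcases le_or_gt s 0.8 with hs1 | hs1
  · have h2 : k₂ ≤ 0.394 := hk2le _ (mul_log_le_of_threshold hq0 rfl hq1.le huq (by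
      have := log_le_mul_sub (x := Real.log q) (a := 1) hy0 one_pos
      rw [Real.log_one] at this
      linarith))
    linarith
  rcases le_or_gt (Real.log s) 2 with hs2 | hs2
  · have hl8 : -0.2232 ≤ Real.log s := by
      have := Real.log_le_log (by norm_num) hs1.le
      rw [show (0.8 : ℝ) = 2 ^ 2 / 5 by norm_num, Real.log_div (by norm_num) (by norm_num),
        Real.log_pow] at this
      push_cast at this
      linarith
    have hy : 2.45 ≤ Real.log q := by linarith
    have h2 : k₂ ≤ 0.285 := hk2le _ (mul_log_le_of_threshold hq0 rfl hq1.le huq (by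
      have h := log_le_mul_sub (x := Real.log q) (a := 0.4) hy0 (by norm_num)
      have : Real.log 0.4 = Real.log 2 - Real.log 5 := by
        rw [← Real.log_div (by norm_num) (by norm_num)]; norm_num
      linarith))
    have hs739 : s ≤ 7.39 := by
      have h := (Real.log_le_iff_le_exp hs).1 hs2
      have e : Real.exp 2 = Real.exp 1 ^ 2 := by rw [← Real.exp_nat_mul]; norm_num
      have h3 : Real.exp 1 ^ 2 ≤ 2.7182818286 ^ 2 := by
        gcongr
        exact Real.exp_one_lt_d9.le
      norm_num at h3 ⊢
      linarith
    have hus : 292 * s ≤ u := by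
      refine le_trans ?_ huq
      have h3 : 15.39 * s ≤ q := by rw [hq]; nlinarith
      calc 292 * s ≤ 7.745 * (15.39 * s) * 2.45 := by linarith
        _ ≤ 7.745 * q * Real.log q := by gcongr
    have h1 : k₁ ≤ 0.2832 := hk1le _ (by norm_num) fun w h1 h3 _ _ =>
      mul_log_le_of_mid hs hs739 (by linarith) (by
        have h4 : (292 * s) ^ 4 ≤ u ^ 4 := by gcongr
        rw [mul_pow] at h4
        have : 0 < s ^ 4 := by positivity
        norm_num at h3 h4 ⊢
        linarith)
    linarith
  have hy : 4.7 ≤ Real.log q := by linarith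
  have h2 : k₂ ≤ 0.228 := hk2le _ (mul_log_le_of_threshold hq0 rfl hq1.le huq (by
    have h := log_le_mul_sub (x := Real.log q) (a := 0.2) hy0 (by norm_num)
    have : Real.log 0.2 = - Real.log 5 := by
      rw [← Real.log_inv]; norm_num
    linarith))
  have hs738 : 7.38 ≤ s := by
    have h := (Real.le_log_iff_exp_le hs).1 hs2.le
    have e : Real.exp 2 = Real.exp 1 ^ 2 := by rw [← Real.exp_nat_mul]; norm_num
    have h3 : 2.7182818283 ^ 2 ≤ Real.exp 1 ^ 2 := by
      gcongr
      exact Real.exp_one_gt_d9.le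
    norm_num at h3 ⊢
    linarith
  set x := Real.log s with hx
  have hx0 : 0 < x := by linarith
  rcases le_or_gt (Real.log A) (12 * x) with hAx | hAx
  · have h1 : k₁ ≤ 0.51 := hk1le _ (by norm_num) fun w h1 _ h3 h4 => by
      rcases le_total x 8 with hx8 | hx8
      · exact mul_log_le_of_log_le_eight hs hx hs2.le hx8 (by linarith) hA
          (by rw [← mul_pow]; exact h3 (by linarith))
      · exact mul_log_le_of_eight_le_log hs hx hx8 (by linarith) h4
    have h3 : k₃ ≤ 0.06 := third_part_le hx hs2 ha haA hv0 hs hAx hva hk₃' (by linarith)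
    linarith
  · have h1 : k₁ ≤ 0.12 := hk1le _ (by norm_num) fun w h1 _ h3 _ => by
      refine mul_log_le_of_cube_le hs738 ?_
      have hsA' : s ^ 12 ≤ A := by
        rw [← Real.log_le_log_iff (by positivity) hA0, Real.log_pow]
        push_cast; linarith
      refine le_of_pow_le_pow_left₀ (n := 8) (by norm_num) (by linarith)
        (le_trans ?_ (h3 (by linarith)))
      have h0 : 1 ≤ s * x := one_le_mul_of_one_le_of_one_le (by linarith) (by linarith)
      have h4 : 1 ≤ (s * x) ^ 6 := one_le_pow₀ h0
      have h5 : (s ^ 12) ^ 2 ≤ A ^ 2 := by gcongr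
      calc (s ^ 3) ^ 8 = (s ^ 12) ^ 2 := by ring
        _ ≤ A ^ 2 := h5
        _ ≤ A ^ 2 * (s * x) ^ 6 := le_mul_of_one_le_right (by positivity) h4
        _ ≤ 3.09e11 * A ^ 2 * (s * x) ^ 6 := by
          have : 0 ≤ A ^ 2 * (s * x) ^ 6 := by positivity
          norm_num
          linarith
    linarith

end ThresholdCases

/-! ### Bounds for the parts of the deviation -/

section ThresholdSuffices

/-- Replacing `c` by `c / e` absorbs the linear term, so the first summand of UCD is itself a
`fannes` value and inherits subadditivity and monotonicity. -/
theorem fannes_div_exp {c x : ℝ} (hc : 0 < c) (hx : 0 ≤ x) :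
    fannes (c / Real.exp 1) x = x * Real.log (c / x) := by
  unfold fannes
  rcases hx.eq_or_lt with rfl | hx
  · simp
  · have : c / Real.exp 1 / x = c / x / Real.exp 1 := by ring
    rw [this, Real.log_div (by positivity) (Real.exp_pos 1).ne', Real.log_exp]
    ring

theorem first_term_eq_fannes {z c n : ℝ} (hz : 0 ≤ z) (hn : 0 < n) (hc : 0 < c) :
    3 * √(z * c / n) * Real.log (n * c / (36 * z))
      = fannes (c / Real.exp 1) (6 * √(z * c / n)) := by
  rw [fannes_div_exp hc (by positivity)]
  rcases hz.eq_or_lt with rfl | hz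
  · simp
  have hX2 : √(z * c / n) ^ 2 = z * c / n := Real.sq_sqrt (by positivity)
  have e : n * c / (36 * z) = (c / (6 * √(z * c / n))) ^ 2 := by
    rw [div_pow, mul_pow, hX2]; field_simp; norm_num
  rw [e, Real.log_pow]
  push_cast
  ring

/-- The part of the deviation bound that comes from `√(L / n)`. -/
theorem second_part_le {c n A L Δ q u : ℝ} (hc : 1 ≤ c) (hn : 370 ≤ n) (hA : 11.7 ≤ A)
    (hL0 : 0 ≤ L) (hL : L ≤ 1.06 * A) (hΔ : 0 < Δ) (hq : q = 3 * c * √A / Δ)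
    (hu : u = √n * c / 3) :
    (Real.log n + 1) * √(L / (2 * n)) + 3 / 2 * √(L / n) * Real.log (n * c ^ 2 / 9)
      ≤ 0.687 * (q * Real.log u / u) * Δ := by
  have hn0 : 0 < n := by linarith
  have hc0 : 0 < c := by linarith
  have hA0 : 0 < A := by linarith
  have hsn : 0 < √n := Real.sqrt_pos.2 hn0
  have hu0 : 0 < u := by rw [hu]; positivity
  have hU : n * c ^ 2 / 9 = u ^ 2 := by
    rw [hu, div_pow, mul_pow, Real.sq_sqrt hn0.le]; norm_num
  have hlu : Real.log n = 2 * Real.log u + 2 * Real.log 3 - 2 * Real.log c := by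
    have : Real.log (n * c ^ 2 / 9) = 2 * Real.log u := by rw [hU, Real.log_pow]; norm_num
    rw [Real.log_div (by positivity) (by norm_num), Real.log_mul (by positivity) (by positivity),
      Real.log_pow, show (9 : ℝ) = 3 ^ 2 by norm_num, Real.log_pow] at this
    push_cast at this
    linarith
  have hu6 : 6 ≤ u := by
    have : 18 ≤ √n := Real.le_sqrt_of_sq_le (by norm_num; linarith)
    rw [hu]; nlinarith
  have hlu1 : 1.79 ≤ Real.log u := by
    have := Real.log_le_log (by norm_num) hu6
    linarith [log_six_gt]
  have hY : √(L / (2 * n)) ≤ 0.7072 * √(L / n) := by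
    rw [Real.sqrt_le_left (by positivity), mul_pow, Real.sq_sqrt (by positivity)]
    have : 0 ≤ L / n := by positivity
    have e : L / (2 * n) = 1 / 2 * (L / n) := by field_simp
    rw [e]; norm_num; linarith
  have hlc := Real.log_nonneg hc
  have h3 := Real.log_three_lt_d9
  have hlogn : Real.log n + 1 ≤ 2 * Real.log u + 3.198 := by linarith
  have hlogn0 : 0 ≤ Real.log n + 1 := by
    have := Real.log_nonneg (by linarith : 1 ≤ n)
    linarith
  rw [hU, Real.log_pow]
  have hY0 := Real.sqrt_nonneg (L / n)
  have h1 : (Real.log n + 1) * √(L / (2 * n)) ≤ 3 * √(L / n) * Real.log u := by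
    calc (Real.log n + 1) * √(L / (2 * n))
        ≤ (2 * Real.log u + 3.198) * (0.7072 * √(L / n)) := by gcongr
      _ = (0.7072 * (2 * Real.log u + 3.198)) * √(L / n) := by ring
      _ ≤ (3 * Real.log u) * √(L / n) := mul_le_mul_of_nonneg_right (by linarith) hY0
      _ = _ := by ring
  have hsL : √L ≤ 1.0296 * √A := by
    rw [Real.sqrt_le_left (by positivity), mul_pow, Real.sq_sqrt hA0.le]
    norm_num; linarith
  have hYe : √(L / n) = √L * c / (3 * u) := by
    rw [Real.sqrt_div hL0, hu]; field_simp
  have h2 : √L * c ≤ 1.0296 * q * Δ / 3 := by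
    have : q * Δ = 3 * c * √A := by rw [hq]; field_simp
    calc √L * c ≤ 1.0296 * √A * c := by gcongr
      _ = 1.0296 * (3 * c * √A) / 3 := by ring
      _ = _ := by rw [← this]; ring
  have hq0 : 0 ≤ q := by rw [hq]; positivity
  calc (Real.log n + 1) * √(L / (2 * n)) + 3 / 2 * √(L / n) * (((2 : ℕ) : ℝ) * Real.log u)
      ≤ 6 * (√L * c / (3 * u)) * Real.log u := by
        rw [← hYe]; push_cast; linarith
    _ = 2 * (√L * c) * (Real.log u / u) := by field_simp; ring
    _ ≤ 2 * (1.0296 * q * Δ / 3) * (Real.log u / u) := by gcongr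
    _ = (2 * 1.0296 / 3) * (q * Real.log u / u * Δ) := by ring
    _ ≤ 0.687 * (q * Real.log u / u * Δ) := by
        gcongr
        norm_num
    _ = _ := by ring

/-- The part of the deviation bound of order `n ^ (-3/4)`. -/
theorem third_part_eq_le {c n A L : ℝ} (hc : 1 ≤ c) (hn : 370 ≤ n) (hA : 11.7 ≤ A)
    (hL : L = A + Real.log 2) :
    2 * √(c / n * √(L / n)) * Real.log (n * c ^ (2 / 3 : ℝ))
        + fannes (c / Real.exp 1) (7.136 * √(c / n * √(L / n)))
      ≤ 1.0147 * (c * A ^ (1 / 4 : ℝ)) / (n ^ (3 / 4 : ℝ) * c ^ (1 / 2 : ℝ))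
        * (9.803 * Real.log (n ^ (3 / 4 : ℝ) * c ^ (1 / 2 : ℝ)) - 18.4) ∧
      84 ≤ n ^ (3 / 4 : ℝ) * c ^ (1 / 2 : ℝ) := by
  have l2 := Real.log_two_gt_d9
  have l2' := Real.log_two_lt_d9
  have l3 := Real.log_three_gt_d9
  have l5 := Real.log_five_gt_d9
  have l5' := Real.log_five_lt_d9
  have hn0 : 0 < n := by linarith
  have hc0 : 0 < c := by linarith
  have hA0 : 0 < A := by linarith
  have hL0 : 0 < L := by linarith
  have hv84 : 84 ≤ n ^ (3 / 4 : ℝ) * c ^ (1 / 2 : ℝ) := by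
    have h1 : 84 ≤ n ^ (3 / 4 : ℝ) := by
      refine le_rpow_three_quarters hn0.le ?_
      calc (84 : ℝ) ^ 4 ≤ 370 ^ 3 := by norm_num
        _ ≤ n ^ 3 := by gcongr
    have h2 : 1 ≤ c ^ (1 / 2 : ℝ) := Real.one_le_rpow hc (by norm_num)
    nlinarith
  refine ⟨?_, hv84⟩
  set v := n ^ (3 / 4 : ℝ) * c ^ (1 / 2 : ℝ) with hv
  have hv0 : 0 < v := by linarith
  have hlv : Real.log v = 3 / 4 * Real.log n + 1 / 2 * Real.log c := by
    rw [hv, Real.log_mul (by positivity) (by positivity), Real.log_rpow hn0, Real.log_rpow hc0]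
  have hV : Real.log (n * c ^ (2 / 3 : ℝ)) = 4 / 3 * Real.log v := by
    rw [Real.log_mul (by positivity) (by positivity), Real.log_rpow hc0, hlv]; ring
  have hZ : √(c / n * √(L / n)) = c * L ^ (1 / 4 : ℝ) / v := by
    rw [sqrt_mul_sqrt_eq_rpow hc0.le hL0.le hn0, hv]
    have : c = c ^ (1 / 2 : ℝ) * c ^ (1 / 2 : ℝ) := by
      rw [← Real.rpow_add hc0]; norm_num
    field_simp
    rw [sq, ← this]
  have hlog : Real.log (c / (7.136 * √(c / n * √(L / n))))
      = Real.log v - Real.log 7.136 - Real.log L / 4 := by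
    have : c / (7.136 * √(c / n * √(L / n))) = v / (7.136 * L ^ (1 / 4 : ℝ)) := by
      rw [hZ]; field_simp
    have h1 : Real.log (v / (7.136 * L ^ (1 / 4 : ℝ)))
        = Real.log v - Real.log (7.136 * L ^ (1 / 4 : ℝ)) :=
      Real.log_div hv0.ne' (by positivity)
    have h2 : Real.log (7.136 * L ^ (1 / 4 : ℝ)) = Real.log 7.136 + Real.log (L ^ (1 / 4 : ℝ)) :=
      Real.log_mul (by norm_num) (by positivity)
    rw [this, h1, h2, Real.log_rpow hL0]
    ring
  have h7 : 1.956 ≤ Real.log 7.136 := by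
    have h := Real.log_le_log (by norm_num) (by norm_num : (2 * 5 ^ 2 : ℝ) ≤ 7.136 ^ 2)
    rw [Real.log_pow, Real.log_mul (by norm_num) (by norm_num), Real.log_pow] at h
    push_cast at h
    linarith
  have hlL : 2.497 ≤ Real.log L := by
    have h := Real.log_le_log (by norm_num) (by norm_num; linarith : (3 ^ 5 / (2 ^ 2 * 5) : ℝ) ≤ L)
    rw [Real.log_div (by norm_num) (by norm_num), Real.log_mul (by norm_num) (by norm_num),
      Real.log_pow, Real.log_pow] at h
    push_cast at h
    linarith
  have hlv84 : 4.15 ≤ Real.log v := by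
    have h := Real.log_le_log (by norm_num) (by norm_num; linarith : (2 ^ 6 : ℝ) ≤ v)
    rw [Real.log_pow] at h
    push_cast at h
    linarith
  have hbr : 0 ≤ 9.803 * Real.log v - 18.4 := by linarith
  rw [fannes_div_exp hc0 (by positivity), hlog, hV]
  set Z := √(c / n * √(L / n)) with hZdef
  have hZ0 : 0 ≤ Z := Real.sqrt_nonneg _
  have hL4 : L ^ (1 / 4 : ℝ) ≤ 1.0147 * A ^ (1 / 4 : ℝ) := by
    have h1 : L ≤ 1.0147 ^ 4 * A := by norm_num; linarith
    calc L ^ (1 / 4 : ℝ) ≤ (1.0147 ^ 4 * A) ^ (1 / 4 : ℝ) :=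
          Real.rpow_le_rpow hL0.le h1 (by norm_num)
      _ = 1.0147 * A ^ (1 / 4 : ℝ) := by
          rw [Real.mul_rpow (by positivity) hA0.le, ← Real.rpow_natCast, ← Real.rpow_mul (by norm_num)]
          norm_num
  calc 2 * Z * (4 / 3 * Real.log v)
        + 7.136 * Z * (Real.log v - Real.log 7.136 - Real.log L / 4)
      = (8 / 3 * Real.log v + 7.136 * (Real.log v - Real.log 7.136 - Real.log L / 4)) * Z := by ring
    -- Here `9.803 ≥ 8 / 3 + 7.136` and `18.4 ≤ 7.136 (1.956 + 2.497 / 4)`.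
    _ ≤ (9.803 * Real.log v - 18.4) * Z := by
        gcongr
        linarith
    _ = (c * L ^ (1 / 4 : ℝ)) / v * (9.803 * Real.log v - 18.4) := by rw [hZ]; ring
    _ ≤ (c * (1.0147 * A ^ (1 / 4 : ℝ))) / v * (9.803 * Real.log v - 18.4) := by gcongr
    _ = _ := by ring

/-- With argument `q ^ 2` the condition reads `60 q² log² q ≤ u²`, and `7.745 ≤ √60`. -/
theorem lam2_threshold {c n A Δ q u : ℝ} (hc : 0 < c) (hn : 0 < n) (hA : 0 < A)
    (hΔ : 0 < Δ) (hq : q = 3 * c * √A / Δ) (hu : u = √n * c / 3)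
    (h : 135 / c ^ 2 * Lam2 (9 * c ^ 2 * A / Δ ^ 2) ≤ n) :
    7.745 * q * |Real.log q| ≤ u := by
  have hq0 : 0 < q := by rw [hq]; positivity
  have hm : 9 * c ^ 2 * A / Δ ^ 2 = q ^ 2 := by
    rw [hq, div_pow, mul_pow, mul_pow, Real.sq_sqrt hA.le]; norm_num
  have hU : u ^ 2 = n * c ^ 2 / 9 := by
    rw [hu, div_pow, mul_pow, Real.sq_sqrt hn.le]; norm_num
  unfold Lam2 at h
  rw [hm, Real.log_pow, div_mul_eq_mul_div, div_le_iff₀ (by positivity)] at h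
  push_cast at h
  refine le_of_pow_le_pow_left₀ (n := 2) (by norm_num) (by rw [hu]; positivity) ?_
  rw [hU, mul_pow, sq_abs, mul_pow]
  have : 0 ≤ q ^ 2 * Real.log q ^ 2 := by positivity
  norm_num
  linarith

/-- The properties of `w = √(n c / (36 ζ))` that bound the leading part of the deviation. -/
theorem first_part_bounds {c n A ζ s q u w : ℝ} (hc : 1 ≤ c) (hn : 370 ≤ n) (hA : 11.7 ≤ A)
    (hζ : 0 < ζ) (hζ1 : ζ ≤ 1 - 1 / c) (hs : 0 < s) (hq : q = 4.5 * s * √A)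
    (hu : u = √n * c / 3) (huq : 7.745 * q * |Real.log q| ≤ u) (hw : w = √(n * c / (36 * ζ)))
    (h1 : 288 * (ζ / c) * (s * Real.log s) ^ 2 ≤ n) (h6 : 119 * ζ * c ≤ n)
    (h2 : 36230 ^ 3 * A * (s * Real.log s) ^ 4 ≤ n ^ 3 * c ^ 2) :
    6.4 ≤ w ∧ 0.206 * u ^ 4 ≤ w ^ 6 ∧
      (1 ≤ s → 3.09e11 * A ^ 2 * (s * Real.log s) ^ 6 ≤ w ^ 8) ∧
      8 * (s * Real.log s) ^ 2 ≤ w ^ 2 := by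
  have hn0 : 0 < n := by linarith
  have hc0 : 0 < c := by linarith
  have hA0 : 0 < A := by linarith
  have hW : w ^ 2 = n * c / (36 * ζ) := by rw [hw]; exact Real.sq_sqrt (by positivity)
  have hw0 : 0 ≤ w := by rw [hw]; exact Real.sqrt_nonneg _
  have hU : u ^ 2 = n * c ^ 2 / 9 := by
    rw [hu, div_pow, mul_pow, Real.sq_sqrt hn0.le]; norm_num
  have hζle1 : ζ ≤ 1 := hζ1.trans (by have : 0 ≤ 1 / c := by positivity
                                      linarith)
  have hWu : u ^ 2 / (4 * c) ≤ w ^ 2 := by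
    rw [hW, hU, div_div, div_le_div_iff₀ (by positivity) (by positivity)]
    have : 0 ≤ n * c ^ 2 := by positivity
    nlinarith
  have hWc : 119 / 36 * c ^ 2 ≤ w ^ 2 := by
    rw [hW, le_div_iff₀ (by positivity)]
    have := mul_le_mul_of_nonneg_right h6 hc0.le
    linarith
  have hWl : 36230 ^ 3 / 46656 * (A * c * (s * Real.log s) ^ 4) ≤ (w ^ 2) ^ 3 := by
    rw [hW, div_pow, le_div_iff₀ (by positivity)]
    have hζ3 : ζ ^ 3 ≤ 1 := pow_le_one₀ hζ.le hζle1
    have hP : 0 ≤ A * c * (s * Real.log s) ^ 4 := by positivity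
    calc 36230 ^ 3 / 46656 * (A * c * (s * Real.log s) ^ 4) * (36 * ζ) ^ 3
        = 36230 ^ 3 * (A * c * (s * Real.log s) ^ 4) * ζ ^ 3 := by ring
      _ ≤ 36230 ^ 3 * (A * c * (s * Real.log s) ^ 4) * 1 := by gcongr
      _ = 36230 ^ 3 * A * (s * Real.log s) ^ 4 * c := by ring
      _ ≤ n ^ 3 * c ^ 2 * c := by gcongr
      _ = (n * c) ^ 3 := by ring
  refine ⟨?_, ?_, fun hs1 => ?_, ?_⟩
  · refine le_of_pow_le_pow_left₀ (n := 2) (by norm_num) hw0 ?_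
    rw [hW, le_div_iff₀ (by positivity)]
    have h4 : ζ * 4 ≤ c := by
      have : ζ * c ≤ c - 1 := by
        calc ζ * c ≤ (1 - 1 / c) * c := by gcongr
          _ = c - 1 := by field_simp
      nlinarith [sq_nonneg (c - 2)]
    norm_num
    nlinarith
  · have hWu2 : (u ^ 2 / (4 * c)) ^ 2 ≤ (w ^ 2) ^ 2 := by gcongr
    calc 0.206 * u ^ 4 ≤ 119 / 36 / 16 * u ^ 4 := by gcongr; norm_num
      _ = 119 / 36 * c ^ 2 * (u ^ 2 / (4 * c)) ^ 2 := by field_simp; norm_num; ring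
      _ ≤ w ^ 2 * (w ^ 2) ^ 2 := by gcongr
      _ = w ^ 6 := by ring
  · have hls := Real.log_nonneg hs1
    have hsA : 1 ≤ √A := Real.le_sqrt_of_sq_le (by norm_num; linarith)
    have hsq : s ≤ q := by rw [hq]; nlinarith
    have hlq : Real.log s ≤ Real.log q := Real.log_le_log hs hsq
    have hq2 : q ^ 2 = 20.25 * s ^ 2 * A := by
      rw [hq, mul_pow, mul_pow, Real.sq_sqrt hA0.le]; norm_num
    have hul : 7.745 ^ 2 * 20.25 * (A * (s * Real.log s) ^ 2) ≤ u ^ 2 := by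
      rw [abs_of_nonneg (hls.trans hlq)] at huq
      have hq0 : 0 ≤ q := hs.le.trans hsq
      calc 7.745 ^ 2 * 20.25 * (A * (s * Real.log s) ^ 2)
          = 7.745 ^ 2 * (20.25 * s ^ 2 * A) * Real.log s ^ 2 := by ring
        _ = (7.745 * q * Real.log s) ^ 2 := by rw [← hq2]; ring
        _ ≤ (7.745 * q * Real.log q) ^ 2 := by gcongr
        _ ≤ u ^ 2 := pow_le_pow_left₀
            (mul_nonneg (by positivity) (hls.trans hlq)) huq 2
    have hWu3 : 7.745 ^ 2 * 20.25 * (A * (s * Real.log s) ^ 2) / (4 * c) ≤ w ^ 2 :=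
      le_trans (by gcongr) hWu
    have hP : 0 ≤ A ^ 2 * (s * Real.log s) ^ 6 := by positivity
    calc 3.09e11 * A ^ 2 * (s * Real.log s) ^ 6
        = 3.09e11 * (A ^ 2 * (s * Real.log s) ^ 6) := by ring
      _ ≤ 36230 ^ 3 / 46656 * (7.745 ^ 2 * 20.25 / 4) * (A ^ 2 * (s * Real.log s) ^ 6) := by
          gcongr
          norm_num
      _ = 36230 ^ 3 / 46656 * (A * c * (s * Real.log s) ^ 4)
            * (7.745 ^ 2 * 20.25 * (A * (s * Real.log s) ^ 2) / (4 * c)) := by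
          field_simp
      _ ≤ (w ^ 2) ^ 3 * w ^ 2 := by gcongr
      _ = w ^ 8 := by ring
  · rw [hW, le_div_iff₀ (by positivity)]
    have e : 288 * (ζ / c) * (s * Real.log s) ^ 2 = 288 * ζ * (s * Real.log s) ^ 2 / c := by ring
    rw [e, div_le_iff₀ hc0] at h1
    linarith

end ThresholdSuffices

/-! ### `Γ` plays push the deviation below the gap -/

section Deviation

/-- As `z` exceeds `ζ` by at most `√2 √(L / n)`, the square root grows by at most `2 ^ (1 / 4)`
times the quantity in the third summand, and `7.136 ≥ 6 · 2 ^ (1 / 4)`. The numerical bounds keep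
the arguments below `c / e`, where `fannes` is monotone. -/
theorem first_term_le {c n ζ z L : ℝ} (hc : 1 ≤ c) (hn : 370 ≤ n) (hζ0 : 0 ≤ ζ)
    (hζ : ζ ≤ 1 - 1 / c) (hz0 : 0 ≤ z) (hz : z ≤ ζ + √(2 * L / n)) (hL : 0 ≤ L)
    (hLn : 30 * L ≤ n) :
    3 * √(z * c / n) * Real.log (n * c / (36 * z))
      ≤ fannes (c / Real.exp 1) (6 * √(ζ * c / n))
        + fannes (c / Real.exp 1) (7.136 * √(c / n * √(L / n))) := by
  have hn0 : 0 < n := by linarith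
  have hc0 : 0 < c := by linarith
  have hX0 : √(ζ * c / n) ≤ 0.0261 * c := by
    have hcc : ζ * c ≤ c - 1 := by
      calc ζ * c ≤ (1 - 1 / c) * c := by gcongr
        _ = c - 1 := by field_simp
    rw [Real.sqrt_le_left (by positivity), div_le_iff₀ hn0]
    have h1 : (0.0261 * c) ^ 2 * 370 ≤ (0.0261 * c) ^ 2 * n := by gcongr
    nlinarith [sq_nonneg (c - 2)]
  have hLn' : √(L / n) ≤ 0.183 := by
    rw [Real.sqrt_le_left (by norm_num), div_le_iff₀ hn0]
    norm_num; linarith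
  have hY0 := Real.sqrt_nonneg (L / n)
  have hZ2 : √(c / n * √(L / n)) ^ 2 = c / n * √(L / n) := Real.sq_sqrt (by positivity)
  have hZ : √(c / n * √(L / n)) ≤ 0.0223 * c := by
    rw [Real.sqrt_le_left (by positivity)]
    calc c / n * √(L / n) ≤ c / 370 * 0.183 := by gcongr
      _ ≤ 0.000497 * c := by linarith
      _ ≤ (0.0223 * c) ^ 2 := by nlinarith
  set Z := √(c / n * √(L / n))
  have hZ0 : 0 ≤ Z := Real.sqrt_nonneg _
  have hX00 : 0 ≤ √(ζ * c / n) := Real.sqrt_nonneg _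
  have hX02 : √(ζ * c / n) ^ 2 = ζ * c / n := Real.sq_sqrt (by positivity)
  have hY2 : √(2 * L / n) ≤ 1.41422 * √(L / n) := by
    rw [Real.sqrt_le_left (by positivity), mul_pow, Real.sq_sqrt (by positivity)]
    have : 0 ≤ L / n := by positivity
    have e : 2 * L / n = 2 * (L / n) := by ring
    rw [e]; norm_num; linarith
  have hXz : √(z * c / n) ≤ √(ζ * c / n) + 7.136 / 6 * Z := by
    rw [Real.sqrt_le_left (by positivity)]
    have hcn : 0 ≤ c / n * √(L / n) := by positivity
    calc z * c / n = z * (c / n) := by ring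
      _ ≤ (ζ + 1.41422 * √(L / n)) * (c / n) := by gcongr; linarith
      _ = ζ * c / n + 1.41422 * (c / n * √(L / n)) := by ring
      _ ≤ √(ζ * c / n) ^ 2 + (7.136 / 6) ^ 2 * Z ^ 2 := by rw [hX02, hZ2]; norm_num; linarith
      _ ≤ _ := by nlinarith [mul_nonneg hX00 hZ0]
  rw [first_term_eq_fannes hz0 hn0 hc0]
  have hce : 0.3678 * c ≤ c / Real.exp 1 := by
    rw [le_div_iff₀ (Real.exp_pos 1)]
    have h := Real.exp_one_lt_d9
    calc 0.3678 * c * Real.exp 1 ≤ 0.3678 * c * 2.7182818286 := by gcongr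
      _ ≤ c := by linarith
  calc fannes (c / Real.exp 1) (6 * √(z * c / n))
      ≤ fannes (c / Real.exp 1) (6 * √(ζ * c / n) + 7.136 * Z) := by
        apply fannes_mono (by positivity) (by linarith)
        linarith
    _ ≤ _ := fannes_add_le (by positivity) (by positivity) (by positivity)

-- The entropy fluctuation is merged with the second summand of UCD, and the error of `ζ̂` in the
-- first summand with the third. Divided by `Δ`, the three groups are at most `1.5 k₁`, `0.687 k₂`
-- and `k₃`.
set_option maxHeartbeats 800000 in
theorem deviation_lt_of_thresholds {c n A ζ z L Δ : ℝ} (hc : 1 ≤ c) (hn : 370 ≤ n)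
    (hA : 11.7 ≤ A) (hLn : 30 * (A + Real.log 2) ≤ n) (hζ0 : 0 ≤ ζ) (hζ : ζ ≤ 1 - 1 / c)
    (hz0 : 0 ≤ z) (hz : z ≤ ζ + √(2 * L / n)) (hL : L = A + Real.log 2) (hΔ : 0 < Δ)
    (h1 : 288 * (ζ / c) * Lam1 (2 * c / (3 * Δ)) ^ 2 ≤ n)
    (h2 : 36230 * (A ^ (1 / 3 : ℝ) / c ^ (2 / 3 : ℝ)) * fourThirdsPow (Lam1 (2 * c / (3 * Δ))) ≤ n)
    (h3 : 135 / c ^ 2 * Lam2 (9 * c ^ 2 * A / Δ ^ 2) ≤ n)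
    (h4 : 3 / c ^ (2 / 3 : ℝ) * Lam43 (27 * c ^ (4 / 3 : ℝ) * A ^ (1 / 3 : ℝ) / Δ ^ (4 / 3 : ℝ))
      ≤ n)
    (h6 : 119 * ζ * c ≤ n) :
    (Real.log n + 1) * √(L / (2 * n)) + ucdLog z c L n < Δ := by
  have hn0 : 0 < n := by linarith
  have hc0 : 0 < c := by linarith
  have hA0 : 0 < A := by linarith
  have l2 := Real.log_two_gt_d9
  have l2' := Real.log_two_lt_d9
  have hL0 : 0 ≤ L := by linarith
  obtain ⟨s, hs⟩ : ∃ s, s = 2 * c / (3 * Δ) := ⟨_, rfl⟩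
  obtain ⟨q, hq⟩ : ∃ q, q = 3 * c * √A / Δ := ⟨_, rfl⟩
  obtain ⟨u, hu⟩ : ∃ u, u = √n * c / 3 := ⟨_, rfl⟩
  obtain ⟨a, ha⟩ : ∃ a, a = A ^ (1 / 4 : ℝ) := ⟨_, rfl⟩
  obtain ⟨v, hv⟩ : ∃ v, v = n ^ (3 / 4 : ℝ) * c ^ (1 / 2 : ℝ) := ⟨_, rfl⟩
  obtain ⟨w, hw⟩ : ∃ w, w = √(n * c / (36 * ζ)) := ⟨_, rfl⟩
  obtain ⟨r, hr⟩ : ∃ r, r = (27 : ℝ) ^ (3 / 4 : ℝ) * (c * a / Δ) := ⟨_, rfl⟩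
  have hs0 : 0 < s := by rw [hs]; positivity
  have hcs : c = 1.5 * s * Δ := by rw [hs]; field_simp; norm_num
  have hqs : q = 4.5 * s * √A := by rw [hq, hs]; field_simp; norm_num
  have ha0 : 0 < a := by rw [ha]; positivity
  have haA : a ^ 4 = A := by
    rw [ha, ← Real.rpow_natCast, ← Real.rpow_mul hA0.le]; norm_num
  have hu64 : 6.4 ≤ u := by
    have : 19.2 ≤ √n := Real.le_sqrt_of_sq_le (by norm_num; linarith)
    rw [hu]; nlinarith
  have huq := lam2_threshold hc0 hn0 hA0 hΔ hq hu h3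
  rw [← hs] at h1 h2
  obtain ⟨hva, h2'⟩ := lam1_threshold hc0 hA0 h2
  unfold Lam1 at h1 hva h2'
  rw [← ha, ← hv] at hva
  have hr0 : 0 < r := by rw [hr]; positivity
  have hvr := lam43_threshold hc0 hA0 hΔ (ha ▸ hr) h4
  rw [← hv] at hvr
  obtain ⟨hT, hv84⟩ := third_part_eq_le hc hn hA hL
  rw [← hv] at hT hv84
  rw [← ha] at hT
  have hv0 : 0 < v := by linarith
  have hS := second_part_le hc hn hA hL0 (by linarith : L ≤ 1.06 * A) hΔ hq hu
  have hF := first_term_le hc hn hζ0 hζ hz0 hz hL0 (by linarith)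
  obtain ⟨k₁, hk₁, hk₁'⟩ : ∃ k₁ : ℝ, fannes (c / Real.exp 1) (6 * √(ζ * c / n)) = 1.5 * k₁ * Δ ∧
      (k₁ = 0 ∨ 6.4 ≤ w ∧ k₁ * w = s * Real.log w ∧ 0.206 * u ^ 4 ≤ w ^ 6 ∧
      (1 ≤ s → 3.09e11 * A ^ 2 * (s * Real.log s) ^ 6 ≤ w ^ 8) ∧
      8 * (s * Real.log s) ^ 2 ≤ w ^ 2) := by
    rcases hζ0.eq_or_lt with h0 | hζ0
    · exact ⟨0, by rw [← h0]; simp [fannes], Or.inl rfl⟩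
    · obtain ⟨b1, b2, b3, b4⟩ :=
        first_part_bounds hc hn hA hζ0 hζ hs0 hqs hu huq hw h1 h6 h2'
      have hw0 : 0 < w := by linarith
      refine ⟨s * Real.log w / w, ?_, Or.inr ⟨b1, by field_simp, b2, b3, b4⟩⟩
      have hW : n * c / (36 * ζ) = w ^ 2 := by rw [hw]; exact (Real.sq_sqrt (by positivity)).symm
      have hXw : √(ζ * c / n) * w = c / 6 := by
        rw [hw, ← Real.sqrt_mul (by positivity),
          show ζ * c / n * (n * c / (36 * ζ)) = (c / 6) ^ 2 by field_simp; norm_num]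
        exact Real.sqrt_sq (by positivity)
      have hX : √(ζ * c / n) = c / 6 / w := by rw [← hXw]; field_simp
      rw [← first_term_eq_fannes hζ0.le hn0 hc0, hW, Real.log_pow, hX]
      push_cast
      nth_rewrite 1 [hcs]
      ring
  obtain ⟨k₃, hk₃⟩ : ∃ k₃, k₃ = 1.0147 * (c * a) / v * (9.803 * Real.log v - 18.4) / Δ := ⟨_, rfl⟩
  have hk₃a : k₃ ≤ 0.331 := by
    have h := third_term_log_le hr0 hv84 hvr
    have h27 : (11.84 : ℝ) ≤ 27 ^ (3 / 4 : ℝ) :=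
      le_rpow_three_quarters (by norm_num) (by norm_num)
    have e : k₃ * (27 ^ (3 / 4 : ℝ) * v) = 1.0147 * (r * (9.803 * Real.log v - 18.4)) := by
      rw [hk₃, hr]; field_simp
    refine le_of_mul_le_mul_right ?_ (by positivity : 0 < (27 : ℝ) ^ (3 / 4 : ℝ) * v)
    have h5 : 11.84 * v ≤ (27 : ℝ) ^ (3 / 4 : ℝ) * v := by gcongr
    rw [e]
    linarith
  have hk₃b : k₃ * v ≤ 14.97 * (s * a) * Real.log v := by
    have hlv : 0 ≤ Real.log v := Real.log_nonneg (by linarith)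
    have e : k₃ * v = 1.0147 * 1.5 * (s * a) * (9.803 * Real.log v - 18.4) := by
      rw [hk₃, hs]; field_simp; ring
    rw [e]
    have h1 : 0 ≤ s * a := by positivity
    have h2 := mul_nonneg h1 hlv
    calc _ = 1.0147 * 1.5 * 9.803 * (s * a * Real.log v) - 1.0147 * 1.5 * 18.4 * (s * a) := by ring
      _ ≤ 14.97 * (s * a * Real.log v) := by linarith
      _ = _ := by ring
  have hlt := normalized_deviation_lt_one hs0 hA ha0 haA hqs hu64 huq hv84 hva hk₁'
    (k₂ := q * Real.log u / u) (by field_simp) hk₃a hk₃b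
  have hk₃Δ : k₃ * Δ = 1.0147 * (c * a) / v * (9.803 * Real.log v - 18.4) := by
    rw [hk₃]; field_simp
  unfold ucdLog
  calc _ ≤ (1.5 * k₁ + 0.687 * (q * Real.log u / u) + k₃) * Δ := by
        have e : (1.5 * k₁ + 0.687 * (q * Real.log u / u) + k₃) * Δ
            = 1.5 * k₁ * Δ + 0.687 * (q * Real.log u / u) * Δ + k₃ * Δ := by ring
        rw [e, hk₃Δ, ← hk₁]
        linarith
    _ < 1 * Δ := by gcongr
    _ = Δ := one_mul Δ

/-- Once arm `i` was played `Γ` times, its confidence deviation together with the fluctuation of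
the plug-in estimator is smaller than the gap. -/
theorem deviation_lt_gap {c n t : ℕ} {α ζ z Δ L : ℝ} (hc : 1 ≤ c) (hn : 1 ≤ n) (hnt : n ≤ t)
    (hα : 2 < α) (hΔ : 0 < Δ) (hζ0 : 0 ≤ ζ) (hζ : ζ ≤ 1 - 1 / (c : ℝ)) (hz0 : 0 ≤ z)
    (hz : z ≤ ζ + √(2 * L / n)) (hL : L ≤ Real.log 2 + α * Real.log t)
    (hΓ : gammaTV c α ζ Δ t ≤ n) :
    (Real.log n + 1) * √(L / (2 * n)) + ucdLog z c L n < Δ := by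
  have hn1 : (1 : ℝ) ≤ n := by exact_mod_cast hn
  have hnt' : (n : ℝ) ≤ t := by exact_mod_cast hnt
  have hc1 : (1 : ℝ) ≤ c := by exact_mod_cast hc
  have ht0 : (0 : ℝ) < t := by linarith
  have hlt : 0 ≤ Real.log t := Real.log_nonneg (by linarith)
  obtain ⟨A, hA⟩ : ∃ A, A = α * Real.log t := ⟨_, rfl⟩
  unfold gammaTV at hΓ
  simp only [max_le_iff] at hΓ
  obtain ⟨h1, h2, h3, h4, h5, h6⟩ := hΓ
  have hA3 : α ^ (1 / 3 : ℝ) * Real.log t ^ (1 / 3 : ℝ) = A ^ (1 / 3 : ℝ) := by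
    rw [hA, Real.mul_rpow (by linarith) hlt]
  rw [hA3] at h2
  rw [mul_assoc (9 * (c : ℝ) ^ 2) α, ← hA] at h3
  rw [mul_assoc (27 * (c : ℝ) ^ (4 / 3 : ℝ)), hA3] at h4
  have e5 : 30 * α * Real.log ((2 : ℝ) ^ (1 / α) * t) = 30 * (A + Real.log 2) := by
    rw [Real.log_mul (by positivity) ht0.ne', Real.log_rpow (by norm_num), hA]
    have : α ≠ 0 := by linarith
    field_simp
    ring
  rw [e5] at h5
  -- Since `α > 2` and `n ≤ t`, the number `A` dominates `2 log n`, which makes the fifth entry of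
  -- `Γ` an absolute lower bound on `n`.
  have hAn : 2 * Real.log n ≤ A := by
    have := Real.log_le_log (by linarith) hnt'
    rw [hA]
    nlinarith
  obtain ⟨hn370, hA11⟩ := le_of_thirty_mul_le hn1 hAn h5
  have hLA : L ≤ A + Real.log 2 := by linarith
  have hlogn := Real.log_nonneg hn1
  have hz' : z ≤ ζ + √(2 * (A + Real.log 2) / n) := hz.trans (by gcongr)
  have hmono : ucdLog z c L n ≤ ucdLog z c (A + Real.log 2) n := by
    refine ucdLog_mono (by linarith) hLA ?_ ?_ (by linarith)
    · nlinarith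
    · have := Real.one_le_rpow hc1 (by norm_num : (0 : ℝ) ≤ 2 / 3)
      nlinarith
  calc _ ≤ (Real.log n + 1) * √((A + Real.log 2) / (2 * n)) + ucdLog z c (A + Real.log 2) n := by
        gcongr
    _ < Δ := deviation_lt_of_thresholds hc1 hn370 hA11 h5 hζ0 hζ hz0 hz' rfl hΔ h1 h2 h3 h4 h6

end Deviation

/-! ### From rare deviations to expected play counts -/

section Regret

/-- Comparison with the integral of `x ^ (1 - α)`: each term is at most a difference of consecutive
values of `x ^ (2 - α) / (α - 2)`, and these telescope. -/
theorem sum_mul_rpow_le {α : ℝ} (hα : 2 < α) (t : ℕ) :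
    ∑ s ∈ Finset.range (t + 1), (s : ℝ) * ((s + 1 : ℕ) : ℝ) ^ (-α)
      ≤ (1 - ((t + 1 : ℕ) : ℝ) ^ (2 - α)) / (α - 2) := by
  induction t with
  | zero => simp
  | succ t ih =>
    rw [Finset.sum_range_succ]
    have hβ : 0 < α - 2 := by linarith
    obtain ⟨x, hx⟩ : ∃ x : ℝ, x = ((t + 1 : ℕ) : ℝ) := ⟨_, rfl⟩
    have hx0 : 0 < x := by rw [hx]; positivity
    have hy : ((t + 1 + 1 : ℕ) : ℝ) = x + 1 := by rw [hx]; push_cast; ring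
    rw [← hx] at ih ⊢
    rw [hy]
    have hy0 : 0 < x + 1 := by linarith
    have h1 : (1 + (α - 2) / (x + 1)) * (x + 1) ^ (2 - α) ≤ x ^ (2 - α) := by
      have hl : 1 / (x + 1) ≤ Real.log (x + 1) - Real.log x := by
        have h := Real.log_le_sub_one_of_pos (div_pos hx0 hy0)
        rw [Real.log_div hx0.ne' hy0.ne'] at h
        have e : x / (x + 1) - 1 = -(1 / (x + 1)) := by field_simp; ring
        linarith
      rw [Real.rpow_def_of_pos hx0, Real.rpow_def_of_pos hy0]
      have h2 : 1 + (α - 2) / (x + 1) ≤ Real.exp ((α - 2) * (Real.log (x + 1) - Real.log x)) := by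
        refine le_trans ?_ (Real.add_one_le_exp _)
        have h := mul_le_mul_of_nonneg_left hl hβ.le
        rw [mul_one_div] at h
        linarith
      refine (mul_le_mul_of_nonneg_right h2 (Real.exp_pos _).le).trans (le_of_eq ?_)
      rw [← Real.exp_add]
      ring_nf
    have h3 : x * (x + 1) ^ (-α) ≤ (x + 1) ^ (2 - α) / (x + 1) := by
      have e : (x + 1) ^ (2 - α) = (x + 1) ^ (-α) * (x + 1) ^ 2 := by
        rw [show (2 : ℝ) - α = -α + 2 by ring, Real.rpow_add hy0]
        norm_num
      rw [e, le_div_iff₀ hy0]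
      have : 0 ≤ (x + 1) ^ (-α) := by positivity
      nlinarith [mul_nonneg this hy0.le]
    have h4 : x * (x + 1) ^ (-α) ≤ (x ^ (2 - α) - (x + 1) ^ (2 - α)) / (α - 2) := by
      rw [le_div_iff₀ hβ]
      calc _ ≤ (x + 1) ^ (2 - α) / (x + 1) * (α - 2) := by gcongr
        _ = (1 + (α - 2) / (x + 1)) * (x + 1) ^ (2 - α) - (x + 1) ^ (2 - α) := by ring
        _ ≤ _ := by linarith
    calc _ ≤ (1 - x ^ (2 - α)) / (α - 2) + (x ^ (2 - α) - (x + 1) ^ (2 - α)) / (α - 2) :=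
          add_le_add ih h4
      _ = _ := by ring

/-- Makes `Γ` exceed `20`, so an arm with `Γ` plays is past its initial ones. -/
theorem thirty_mul_log_le_gammaTV {c t : ℕ} {α z Δ : ℝ} (hα : 0 < α) (ht : 1 ≤ t) :
    30 * Real.log 2 ≤ gammaTV c α z Δ t := by
  have ht' : (1 : ℝ) ≤ t := by exact_mod_cast ht
  have h : 30 * α * Real.log ((2 : ℝ) ^ (1 / α) * t) ≤ gammaTV c α z Δ t := by
    unfold gammaTV
    simp only [le_max_iff, le_refl, true_or, or_true]
  refine le_trans ?_ h
  rw [Real.log_mul (by positivity) (by positivity), Real.log_rpow (by norm_num)]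
  have := Real.log_nonneg ht'
  have e : 30 * α * (1 / α * Real.log 2 + Real.log t)
      = 30 * Real.log 2 + 30 * (α * Real.log t) := by field_simp
  rw [e]
  have : 0 ≤ α * Real.log t := by positivity
  linarith

section PlayCount

variable {K : ℕ} {Ω : Type*} (I : ℕ → Ω → Fin K)

theorem playCount_succ (i : Fin K) (t : ℕ) (ω : Ω) :
    playCount I i (t + 1) ω = playCount I i t ω + if I (t + 1) ω = i then 1 else 0 := by
  simp only [playCount]
  rw [Finset.sum_Icc_succ_top (by omega)]

theorem playCount_le (i : Fin K) (t : ℕ) (ω : Ω) : playCount I i t ω ≤ t := by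
  induction t with
  | zero => simp [playCount]
  | succ t ih => rw [playCount_succ]; split_ifs <;> omega

theorem sum_playCount (t : ℕ) (ω : Ω) : ∑ i, playCount I i t ω = t := by
  induction t with
  | zero => simp [playCount]
  | succ t ih => simp [playCount_succ, Finset.sum_add_distrib, ih]

theorem playCount_le_add_sum (i : Fin K) (m t : ℕ) (ω : Ω) :
    playCount I i t ω ≤ m + ∑ s ∈ Finset.range t,
      if I (s + 1) ω = i ∧ m ≤ playCount I i s ω then 1 else 0 := by
  have h : playCount I i t ω ≤ m ∨ m ≤ playCount I i t ω := le_total _ _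
  induction t with
  | zero => simp [playCount]
  | succ t ih =>
    have ih := ih (le_total _ _)
    rw [Finset.sum_range_succ]
    rw [playCount_succ] at h ⊢
    by_cases h1 : I (t + 1) ω = i
    · simp only [h1, if_true, true_and] at h ⊢
      by_cases h2 : m ≤ playCount I i t ω
      · simp only [h2, if_true]; omega
      · omega
    · simp only [h1, if_false, false_and]; omega

end PlayCount

/-! ### Late suboptimal plays force a deviation -/

section UCB

variable {K : ℕ} {A : Fin K → Type*} [∀ i, Fintype (A i)] [∀ i, DecidableEq (A i)]
  {Ω : Type*} {p : ∀ i, PMF (A i)} {X : ∀ i, ℕ → Ω → A i} {I : ℕ → Ω → Fin K}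

/-- The outcomes for which the sample of arm `j` underestimates its entropy. -/
def lowDeviation (p : ∀ i, PMF (A i)) (X : ∀ i, ℕ → Ω → A i) (I : ℕ → Ω → Fin K) (j : Fin K)
    (L : ℝ) (t : ℕ) : Set Ω :=
  {ω | 0 < (samples I X j t ω).length ∧
    √(Fintype.card (A j) * zeta (probVec (p j)) / (samples I X j t ω).length) / 2
      + √(L / (2 * (samples I X j t ω).length))
      < tvDist (probVec (p j)) (empirical (samples I X j t ω))} ∪
  {ω | 0 < (samples I X j t ω).length ∧
    plugInZeta (samples I X j t ω) + √(2 * L / (samples I X j t ω).length)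
      < (1 - 1 / ((samples I X j t ω).length : ℝ)) * zeta (probVec (p j))}

/-- The outcomes for which the sample of arm `i` overestimates `ζ` or the entropy. -/
def highDeviation (p : ∀ i, PMF (A i)) (X : ∀ i, ℕ → Ω → A i) (I : ℕ → Ω → Fin K) (i : Fin K)
    (L : ℝ) (t : ℕ) : Set Ω :=
  {ω | 0 < (samples I X i t ω).length ∧
    zeta (probVec (p i)) + √(2 * L / (samples I X i t ω).length)
      < plugInZeta (samples I X i t ω)} ∪
  {ω | 0 < (samples I X i t ω).length ∧
    entropy (probVec (p i)) + (Real.log (samples I X i t ω).length + 1)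
        * √(L / (2 * (samples I X i t ω).length))
      < plugInEntropy (samples I X i t ω)}

theorem nonempty_of_pmf {Y : Type*} (q : PMF Y) : Nonempty Y :=
  let ⟨a, _⟩ := q.support_nonempty
  ⟨a⟩

theorem armEntropy_nonneg (p : ∀ i, PMF (A i)) (i : Fin K) : 0 ≤ armEntropy p i :=
  entropy_nonneg (probVec_nonneg _) (probVec_le_one _)

/-- A suboptimal arm that was played often enough is not played again, unless one of the samples
deviates. -/
theorem mem_deviation_of_play {α : ℝ} (hα : 2 < α) {i j : Fin K}
    (hj : armEntropy p j = bestEntropy p) (hi : 0 < gap p i) {s t : ℕ} (hst : s + 1 ≤ t) {ω : Ω}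
    (hrun : IsUCBRun
      (fun _ S => plugInEntropy S)
      (fun i S δ n => ucdTV (plugInZeta S) (Fintype.card (A i)) δ n)
      (fun t => (t : ℝ) ^ (-α)) 3 I X ω)
    (hplay : I (s + 1) ω = i)
    (hΓ : gammaTV (Fintype.card (A i)) α (zeta (probVec (p i))) (gap p i) t ≤ playCount I i s ω) :
    ω ∈ lowDeviation p X I j (Real.log 2 + α * Real.log (s + 1 : ℕ)) s ∪
      highDeviation p X I i (Real.log 2 + α * Real.log (s + 1 : ℕ)) s := by
  set L := Real.log 2 + α * Real.log (s + 1 : ℕ) with hLdef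
  have l2 := Real.log_two_gt_d9
  have hΓ3 := thirty_mul_log_le_gammaTV (c := Fintype.card (A i)) (z := zeta (probVec (p i)))
    (Δ := gap p i) (by linarith : 0 < α) (by omega : 1 ≤ t)
  have hn20 : 20 ≤ playCount I i s ω := by
    have : (20 : ℝ) ≤ playCount I i s ω := by linarith
    exact_mod_cast this
  have hs20 : 20 ≤ s := hn20.trans (playCount_le I i s ω)
  -- Otherwise the run would choose an arm with fewer than three plays, but it chooses `i`.
  have hall : ∀ k, 3 ≤ playCount I k s ω := by
    by_contra! h
    have := (hrun s).1 h
    rw [hplay] at this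
    omega
  have hidx := (hrun s).2 hall j
  rw [hplay] at hidx
  by_contra hgood
  simp only [lowDeviation, highDeviation, Set.mem_union, Set.mem_ofPred_eq, not_or, not_and,
    not_lt] at hgood
  obtain ⟨⟨g1, g2⟩, g3, g4⟩ := hgood
  have hnj := hall j
  have hlen := fun k => length_samples I X k s ω
  have hδ : Real.log (2 / ((s + 1 : ℕ) : ℝ) ^ (-α)) = L := by
    rw [Real.log_div (by norm_num) (by positivity), Real.log_rpow (by positivity), hLdef]
    ring
  have hL7 : 4.56 ≤ L := by
    have h7 : Real.log 7 ≤ Real.log (s + 1 : ℕ) := by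
      refine Real.log_le_log (by norm_num) ?_
      exact_mod_cast (by omega : 7 ≤ s + 1)
    have := log_seven_gt
    rw [hLdef]
    nlinarith
  beta_reduce at hidx
  rw [ucdTV_eq_ucdLog _ _ _ _ (by omega) (by rw [hδ]; linarith), ucdTV_eq_ucdLog _ _ _ _ (by omega)
    (by rw [hδ]; linarith), hδ, ← hlen, ← hlen] at hidx
  rw [← hlen] at hnj hn20 hΓ
  have hni := hlen i
  have hile := playCount_le I i s ω
  have hne : ∀ k, Nonempty (A k) := fun k => nonempty_of_pmf (p k)
  have hij : armEntropy p i < armEntropy p j := by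
    unfold gap at hi
    linarith
  -- A one-letter alphabet has entropy `0` and cannot beat arm `i` strictly.
  have hcj : 2 ≤ Fintype.card (A j) := by
    have h0 := armEntropy_nonneg p i
    have h1 : armEntropy p j ≤ Real.log (Fintype.card (A j)) :=
      entropy_le_log_card (probVec_nonneg _) (sum_probVec _)
    by_contra h
    have h2 : Fintype.card (A j) = 1 := by
      have := Fintype.card_pos (α := A j)
      omega
    rw [h2] at h1
    simp only [Nat.cast_one, Real.log_one] at h1
    linarith
  have hlow := entropy_le_upper_confidence_bound (p j) (samples I X j s ω) hcj hnj hL7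
    (g1 (by omega)) (g2 (by omega))
  have hSi : samples I X i s ω ≠ [] := by
    intro h
    rw [h] at hn20
    simp at hn20
  have hhigh := deviation_lt_gap (L := L) (z := plugInZeta (samples I X i s ω))
    (Fintype.card_pos (α := A i)) (by omega : 1 ≤ (samples I X i s ω).length)
    (by omega : (samples I X i s ω).length ≤ t) hα hi
    (zeta_nonneg (probVec_nonneg (p i)) (sum_probVec _)) (zeta_le (sum_probVec _))
    (zeta_nonneg (empirical_nonneg _) (sum_empirical hSi)) (g3 (by omega))
    (by
      rw [hLdef]
      gcongr)
    hΓ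
  have g4 := g4 (by omega)
  -- The contradiction: `H_j ≤` index of `j` `≤` index of `i` `< H_i + Δ_i = H_j`.
  unfold gap armEntropy at *
  linarith

end UCB

/-! ### Probabilities and expectations -/

section Expectation

variable {K : ℕ} {A : Fin K → Type*} [∀ i, Fintype (A i)] [∀ i, DecidableEq (A i)]
  [∀ i, MeasurableSpace (A i)] [∀ i, MeasurableSingletonClass (A i)]
  {Ω : Type*} [mΩ : MeasurableSpace Ω] {μ : Measure Ω} [IsProbabilityMeasure μ]
  {ℱ : Filtration ℕ mΩ} {p : ∀ i, PMF (A i)} {X : ∀ i, ℕ → Ω → A i} {I : ℕ → Ω → Fin K}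

open Classical in
-- The sample size is random, so a union over its values costs the factor `t`.
theorem measure_samples_union_le (hX : MemorylessSources μ ℱ p X)
    (hI : ∀ t, Measurable[ℱ t] (I (t + 1))) (i : Fin K) (t : ℕ) {B : List (A i) → Prop} {ε : ℝ}
    (hB : ∀ n, 0 < n → iidE (p i) n (fun l => if B l then 1 else 0) ≤ ε) :
    μ {ω | 0 < (samples I X i t ω).length ∧ B (samples I X i t ω)} ≤ t * ENNReal.ofReal ε := by
  have hsub : {ω | 0 < (samples I X i t ω).length ∧ B (samples I X i t ω)}
      ⊆ ⋃ n ∈ Finset.Icc 1 t,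
        {ω | (samples I X i t ω).length = n ∧ B (samples I X i t ω)} := by
    rintro ω ⟨h1, h2⟩
    simp only [Set.mem_iUnion, Finset.mem_Icc]
    refine ⟨_, ⟨h1, ?_⟩, rfl, h2⟩
    rw [length_samples]
    exact playCount_le I i t ω
  refine (measure_mono hsub).trans ((measure_biUnion_finset_le _ _).trans ?_)
  calc _ ≤ ∑ n ∈ Finset.Icc 1 t, ENNReal.ofReal ε := Finset.sum_le_sum fun n hn =>
        (measure_samples_le hX hI i t n B).trans
          (ENNReal.ofReal_le_ofReal (hB n (by simp at hn; omega)))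
    _ = _ := by simp

theorem measure_lowDeviation_le (hX : MemorylessSources μ ℱ p X)
    (hI : ∀ t, Measurable[ℱ t] (I (t + 1))) (j : Fin K) {L : ℝ} (hL : 0 ≤ L) (t : ℕ) :
    μ (lowDeviation p X I j L t) ≤ 2 * (t * ENNReal.ofReal (Real.exp (-L))) := by
  rw [two_mul]
  refine (measure_union_le _ _).trans (add_le_add ?_ ?_)
  · refine measure_samples_union_le hX hI j t (B := fun l =>
      √(Fintype.card (A j) * zeta (probVec (p j)) / l.length) / 2 + √(L / (2 * l.length))
        < tvDist (probVec (p j)) (empirical l)) fun n hn => ?_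
    refine le_trans (iidE_mono _ fun l hl => ?_) (iidE_tvDist_deviation (p j) hn hL)
    rw [hl]
  · refine measure_samples_union_le hX hI j t (B := fun l =>
      plugInZeta l + √(2 * L / l.length) < (1 - 1 / (l.length : ℝ)) * zeta (probVec (p j)))
      fun n hn => ?_
    refine le_trans (iidE_mono _ fun l hl => ?_) (iidE_zeta_lower_deviation (p j) hn hL)
    rw [hl]

theorem measure_highDeviation_le (hX : MemorylessSources μ ℱ p X)
    (hI : ∀ t, Measurable[ℱ t] (I (t + 1))) (i : Fin K) {L : ℝ} (hL : 0 ≤ L) (t : ℕ) :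
    μ (highDeviation p X I i L t) ≤ 2 * (t * ENNReal.ofReal (Real.exp (-L))) := by
  rw [two_mul]
  refine (measure_union_le _ _).trans (add_le_add ?_ ?_)
  · refine measure_samples_union_le hX hI i t (B := fun l =>
      zeta (probVec (p i)) + √(2 * L / l.length) < plugInZeta l) fun n hn => ?_
    refine le_trans (iidE_mono _ fun l hl => ?_) (iidE_zeta_upper_deviation (p i) hn hL)
    rw [hl]
  · refine measure_samples_union_le hX hI i t (B := fun l =>
      entropy (probVec (p i)) + (Real.log l.length + 1) * √(L / (2 * l.length))
        < plugInEntropy l) fun n hn => ?_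
    refine le_trans (iidE_mono _ fun l hl => ?_) (iidE_entropy_upper_deviation (p i) hn hL)
    rw [hl]

/-- A suboptimal arm is rarely played after its first `Γ` plays. -/
theorem measure_play_le (hX : MemorylessSources μ ℱ p X)
    (hI : ∀ t, Measurable[ℱ t] (I (t + 1))) {α : ℝ} (hα : 2 < α)
    (hrun : ∀ᵐ ω ∂μ, IsUCBRun
      (fun _ S => plugInEntropy S)
      (fun i S δ n => ucdTV (plugInZeta S) (Fintype.card (A i)) δ n)
      (fun t => (t : ℝ) ^ (-α)) 3 I X ω)
    {i : Fin K} (hi : 0 < gap p i) {m s t : ℕ} (hst : s + 1 ≤ t)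
    (hm : gammaTV (Fintype.card (A i)) α (zeta (probVec (p i))) (gap p i) t ≤ m) :
    μ.real {ω | I (s + 1) ω = i ∧ m ≤ playCount I i s ω}
      ≤ 2 * (s * ((s + 1 : ℕ) : ℝ) ^ (-α)) := by
  obtain ⟨j, hj⟩ : ∃ j, armEntropy p j = bestEntropy p := by
    have : Nonempty (Fin K) := ⟨i⟩
    exact exists_eq_ciSup_of_finite
  obtain ⟨L, hL⟩ : ∃ L, L = Real.log 2 + α * Real.log (s + 1 : ℕ) := ⟨_, rfl⟩
  have hL0 : 0 ≤ L := by
    have h1 := Real.log_two_gt_d9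
    have h2 := Real.log_natCast_nonneg (s + 1)
    rw [hL]
    nlinarith
  -- Four events of probability at most `s exp (-L) = s δ / 2` each add up to `2 s δ`.
  have hexp : Real.exp (-L) = ((s + 1 : ℕ) : ℝ) ^ (-α) / 2 := by
    have h1 : (0 : ℝ) < ((s + 1 : ℕ) : ℝ) := by positivity
    rw [hL, Real.rpow_def_of_pos h1, neg_add, Real.exp_add, Real.exp_neg,
      Real.exp_log (by norm_num)]
    ring_nf
  have hle : μ {ω | I (s + 1) ω = i ∧ m ≤ playCount I i s ω}
      ≤ ENNReal.ofReal (2 * (s * ((s + 1 : ℕ) : ℝ) ^ (-α))) := by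
    calc μ {ω | I (s + 1) ω = i ∧ m ≤ playCount I i s ω}
        ≤ μ (lowDeviation p X I j L s ∪ highDeviation p X I i L s) := by
          refine measure_mono_ae ?_
          filter_upwards [hrun] with ω hω h
          have hmn : (m : ℝ) ≤ playCount I i s ω := by exact_mod_cast h.2
          rw [hL]
          exact mem_deviation_of_play hα hj hi hst hω h.1 (hm.trans hmn)
      _ ≤ 2 * (s * ENNReal.ofReal (Real.exp (-L))) + 2 * (s * ENNReal.ofReal (Real.exp (-L))) :=
          (measure_union_le _ _).trans (add_le_add (measure_lowDeviation_le hX hI j hL0 s)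
            (measure_highDeviation_le hX hI i hL0 s))
      _ = ENNReal.ofReal (2 * (s * Real.exp (-L)) + 2 * (s * Real.exp (-L))) := by
          have h2 : 2 * ((s : ENNReal) * ENNReal.ofReal (Real.exp (-L)))
              = ENNReal.ofReal (2 * (s * Real.exp (-L))) := by
            rw [ENNReal.ofReal_mul (by norm_num), ENNReal.ofReal_mul (by positivity)]
            simp
          rw [h2, ENNReal.ofReal_add (by positivity) (by positivity)]
      _ = _ := by
          rw [hexp]
          ring_nf
  exact ENNReal.toReal_le_of_le_ofReal (by positivity) hle

theorem integrable_playCount (hI : ∀ t, Measurable[ℱ t] (I (t + 1))) (i : Fin K) (t : ℕ) :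
    Integrable (fun ω => (playCount I i t ω : ℝ)) μ := by
  have hmeas : Measurable (fun ω => (playCount I i t ω : ℝ)) := by
    induction t with
    | zero => simp [playCount]
    | succ t ih =>
      have hs : MeasurableSet {ω | I (t + 1) ω = i} := ℱ.le t _ (measurableSet_play hI i t)
      simp only [playCount_succ]
      push_cast
      exact ih.add (Measurable.ite hs measurable_const measurable_const)
  refine Integrable.of_bound hmeas.aestronglyMeasurable (t : ℝ) (Filter.Eventually.of_forall fun ω => ?_)
  rw [Real.norm_of_nonneg (by positivity)]
  exact_mod_cast playCount_le I i t ω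

/-- The expected number of plays of a suboptimal arm. -/
theorem integral_playCount_le (hX : MemorylessSources μ ℱ p X)
    (hI : ∀ t, Measurable[ℱ t] (I (t + 1))) {α : ℝ} (hα : 2 < α)
    (hrun : ∀ᵐ ω ∂μ, IsUCBRun
      (fun _ S => plugInEntropy S)
      (fun i S δ n => ucdTV (plugInZeta S) (Fintype.card (A i)) δ n)
      (fun t => (t : ℝ) ^ (-α)) 3 I X ω)
    {i : Fin K} (hi : 0 < gap p i) {t : ℕ} (ht : 1 ≤ t) :
    ∫ ω, (playCount I i t ω : ℝ) ∂μ
      ≤ gammaTV (Fintype.card (A i)) α (zeta (probVec (p i))) (gap p i) t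
        + 4 * (α - 1) / (α - 2) := by
  obtain ⟨Γ, hΓ⟩ : ∃ Γ, Γ = gammaTV (Fintype.card (A i)) α (zeta (probVec (p i))) (gap p i) t :=
    ⟨_, rfl⟩
  have hΓ0 : 0 ≤ Γ := by
    have := thirty_mul_log_le_gammaTV (c := Fintype.card (A i)) (z := zeta (probVec (p i)))
      (Δ := gap p i) (by linarith : 0 < α) ht
    have l2 := Real.log_two_gt_d9
    linarith
  set m := ⌈Γ⌉₊ with hm
  have hmle : (m : ℝ) ≤ Γ + 1 := (Nat.ceil_lt_add_one hΓ0).le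
  let E : ℕ → Set Ω := fun s => {ω | I (s + 1) ω = i ∧ m ≤ playCount I i s ω}
  have hE : ∀ s, MeasurableSet (E s) := fun s => by
    have h1 := measurableSet_play hI i s
    have h2 := measurableSet_samples hX hI i s fun l => m ≤ l.length
    simp only [length_samples] at h2
    exact ℱ.le s _ (h1.inter h2)
  have hint : ∀ s, Integrable ((E s).indicator fun _ => (1 : ℝ)) μ := fun s =>
    (integrable_const 1).indicator (hE s)
  have hpt : ∀ ω, (playCount I i t ω : ℝ)
      ≤ m + ∑ s ∈ Finset.range t, (E s).indicator (fun _ => (1 : ℝ)) ω := by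
    intro ω
    have h := playCount_le_add_sum I i m t ω
    have e : ∀ s, (E s).indicator (fun _ => (1 : ℝ)) ω
        = ((if I (s + 1) ω = i ∧ m ≤ playCount I i s ω then 1 else 0 : ℕ) : ℝ) := fun s => by
      simp only [Set.indicator_apply, E, Set.mem_ofPred_eq]
      split_ifs <;> simp
    simp only [e]
    exact_mod_cast h
  have hβ : 0 < α - 2 := by linarith
  have hΓm : gammaTV (Fintype.card (A i)) α (zeta (probVec (p i))) (gap p i) t ≤ m := by
    rw [← hΓ]; exact Nat.le_ceil Γ
  rw [← hΓ]
  calc ∫ ω, (playCount I i t ω : ℝ) ∂μ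
      ≤ ∫ ω, (m + ∑ s ∈ Finset.range t, (E s).indicator (fun _ => (1 : ℝ)) ω) ∂μ :=
        integral_mono (integrable_playCount hI i t)
          ((integrable_const _).add (integrable_finsetSum _ fun s _ => hint s)) hpt
    _ = m + ∑ s ∈ Finset.range t, μ.real (E s) := by
        rw [integral_add (integrable_const _) (integrable_finsetSum _ fun s _ => hint s),
          integral_finsetSum _ fun s _ => hint s]
        congr 1
        · simp
        · exact Finset.sum_congr rfl fun s _ => integral_indicator_one (hE s)
    _ ≤ m + ∑ s ∈ Finset.range t, 2 * (s * ((s + 1 : ℕ) : ℝ) ^ (-α)) := by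
        gcongr with s hs
        exact measure_play_le hX hI hα hrun hi (Finset.mem_range.1 hs) hΓm
    _ ≤ m + ∑ s ∈ Finset.range (t + 1), 2 * (s * ((s + 1 : ℕ) : ℝ) ^ (-α)) := by
        gcongr
        omega
    _ ≤ m + 2 * ((1 - ((t + 1 : ℕ) : ℝ) ^ (2 - α)) / (α - 2)) := by
        rw [← Finset.mul_sum]
        gcongr
        exact sum_mul_rpow_le hα t
    _ ≤ Γ + 1 + 2 * (1 / (α - 2)) := by
        have : 0 ≤ ((t + 1 : ℕ) : ℝ) ^ (2 - α) := by positivity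
        gcongr
        linarith
    -- The `1` comes from rounding `Γ` up; `1 + 2 / (α - 2)` is below the stated `4 + 4 / (α - 2)`.
    _ ≤ Γ + 4 * (α - 1) / (α - 2) := by
        have e : 4 * (α - 1) / (α - 2) = 4 + 4 * (1 / (α - 2)) := by field_simp; ring
        have : 0 ≤ 1 / (α - 2) := by positivity
        rw [e]
        linarith

theorem gap_nonneg (p : ∀ i, PMF (A i)) (i : Fin K) : 0 ≤ gap p i :=
  sub_nonneg.2 (le_ciSup (Set.finite_range _).bddAbove i)

theorem pseudoRegret_eq_sum_gap (hI : ∀ t, Measurable[ℱ t] (I (t + 1))) (t : ℕ) :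
    pseudoRegret μ p I t = ∑ i, (∫ ω, (playCount I i t ω : ℝ) ∂μ) * gap p i := by
  have h : ∑ i, ∫ ω, (playCount I i t ω : ℝ) ∂μ = t := by
    rw [← integral_finsetSum _ fun i _ => integrable_playCount hI i t]
    have : ∀ ω, ∑ i, (playCount I i t ω : ℝ) = t := fun ω => by
      exact_mod_cast sum_playCount I t ω
    simp [this]
  unfold pseudoRegret gap
  simp only [mul_sub, Finset.sum_sub_distrib, ← Finset.sum_mul, h]

end Expectation

end Regret

end EntropyBandit

end

theorem theorem11 {K : ℕ} (hK : 2 ≤ K) {A : Fin K → Type*}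
    [∀ i, Fintype (A i)] [∀ i, DecidableEq (A i)]
    [∀ i, MeasurableSpace (A i)] [∀ i, MeasurableSingletonClass (A i)]
    {Ω : Type*} [mΩ : MeasurableSpace Ω] (μ : Measure Ω) [IsProbabilityMeasure μ]
    (ℱ : Filtration ℕ mΩ) (p : ∀ i, PMF (A i)) (X : ∀ i, ℕ → Ω → A i)
    (hX : EntropyBandit.MemorylessSources μ ℱ p X)
    (α : ℝ) (hα : 2 < α)
    (I : ℕ → Ω → Fin K)
    (hI_past : ∀ t, Measurable[ℱ t] (I (t + 1)))
    (hI : ∀ᵐ ω ∂μ, EntropyBandit.IsUCBRun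
      (fun _ S => EntropyBandit.plugInEntropy S)
      (fun i S δ n =>
        EntropyBandit.ucdTV (EntropyBandit.plugInZeta S) (Fintype.card (A i)) δ n)
      (fun t => (t : ℝ) ^ (-α)) 3 I X ω)
    (t : ℕ) (ht : 1 ≤ t) :
    EntropyBandit.pseudoRegret μ p I t ≤
      ∑ i with 0 < EntropyBandit.gap p i,
        (EntropyBandit.gammaTV (Fintype.card (A i)) α
            (EntropyBandit.zeta (EntropyBandit.probVec (p i))) (EntropyBandit.gap p i) t
              * EntropyBandit.gap p i
          + 4 * (α - 1) / (α - 2) * EntropyBandit.gap p i) := by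
  rw [EntropyBandit.pseudoRegret_eq_sum_gap hI_past, Finset.sum_filter]
  refine Finset.sum_le_sum fun i _ => ?_
  split_ifs with hi
  · rw [← add_mul]
    exact mul_le_mul_of_nonneg_right
      (EntropyBandit.integral_playCount_le hX hI_past hα hI hi ht) hi.le
  · rw [le_antisymm (not_lt.1 hi) (EntropyBandit.gap_nonneg p i), mul_zero]
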